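/- Let $(X,d)$ be a uniformly discrete metric space of bounded geometry, let $H$ be a real Hilbert space and let $f:X\to H$ be a coarse embedding: there are non-decreasing $\rho_\pm:[0,\infty)\to[0,\infty)$ with $\rho_-(t)\to\infty$ as $t\to\infty$ and $\rho_-(d(x,y))\le\|f(x)-f(y)\|\le\rho_+(d(x,y))$ for all $x,y\in X$. Put $V=\operatorname{span}_{\mathbb R} f(X)$ and assume that $V$ is dense in $H$. **The algebra $\mathcal A(V)$.** For a finite-dimensional affine subspace $E$ of $V$ with space of differences $E^0$, let $\mathcal C(E)=C_0(E,\mathrm{Cliff}_{\mathbb C}(E^0))$ (with $v=v^*$ and $v^2=\|v\|^2$ for $v\in E^0$), let $\mathcal S=C_0(\mathbb R)$, graded by even and odd functions, and let $\mathcal A(E)=\mathcal S\hat\otimes\mathcal C(E)$ be the graded spatial tensor product; as a vector space it is $C_0(\mathbb R\times E,\mathrm{Cliff}_{\mathbb C}(E^0))$. For $E\subseteq F$ the $*$-homomorphism $\mathcal A(E)\to\mathcal A(F)$ is given by $g\hat\otimes h\mapsto g(t\,\hat\otimes\,1+1\hat\otimes C)(1\hat\otimes\tilde h)$, where $t$ is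 the multiplier $t\mapsto t$ of $\mathcal S$, $C(v)=v-p_E(v)\in \mathrm{Cliff}_{\mathbb C}(F^0)$, $\tilde h(v)=h(p_E(v))$, and $p_E$ is the orthogonal projection to $E$. Let $\mathcal A(V)=\varinjlim\mathcal A(E)$ be the C*-algebraic direct limit. It is a module over $C_0([0,\infty)\times H)=\varinjlim C_0([0,\infty)\times E)$, where $[0,\infty)\times H$ has the weakest topology for which the projection to $H$ is weakly continuous and $(t,v)\mapsto t^2+\|v\|^2$ is continuous. The support of $a\in\mathcal A(V)$ is the complement of the set of all $u\in[0,\infty)\times H$ for which there is $g\in C_0([0,\infty)\times H)$ with $g(u)\ne0$ and $g\cdot a=0$. Let $W_n(x)=\operatorname{span}_{\mathbb R}\{f(y):d(x,y)\le n^2\}$ and let $\beta_n(x):\mathcal A(W_n(x))\to\mathcal A(V)$ be the canonical map. **The algebraic twisted Roe algebra.** $\mathbb C[X,\mathcal A]$ is the set of all functions $T:X\times X\to\mathcal A(V)$ such that 1. there is $N\in\mathbb N$ such that $T(x,y)=\beta_N(x)(T_1(x,y))$ with $T_1(x,y)\in\mathcal A(W_N(x))$ for all $x,y\in X$; 2.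 there is $M>0$ with $\|T(x,y)\|\le M$ for all $x,y$; 3. there is $r_1>0$ with $T(x,y)=0$ whenever $d(x,y)>r_1$; 4. there is $r_2>0$ such that, for all $x,y$, the support of $T(x,y)$ is contained in $\{(t,v):t^2+\|v-f(x)\|^2<r_2^2\}$; 5. there is $c>0$ such that, for all $x,y$ and all $Y\in\mathbb R\times W_N(x)$ with $\|Y\|<1$, the function $T_1(x,y):\mathbb R\times W_N(x)\to\mathrm{Cliff}_{\mathbb C}(W_N(x))$ has at each point a derivative in the direction of $Y$, of norm at most $c$. **The completions.** Let $E_X$ be the Hilbert $\mathcal A(V)$-module of all families $(a_x)_{x\in X}$ in $\mathcal A(V)$ for which $\sum_x a_x^*a_x$ converges in norm, with inner product $\langle a,b\rangle=\sum_x a_x^*b_x$. **Proposition.** The set $\mathbb C[X,\mathcal A]$ is a $*$-algebra under matrix multiplication and adjunction, and it acts on $E_X$ by adjointable operators, by matrix multiplication. For every $T\in\mathbb C[X,\mathcal A]$ the universal norm $\|T\|_{\max}=\sup_\pi\|\pi(T)\|$, where $\pi$ ranges over all $*$-representations of $\mathbb C[X,\mathcal A]$ by bounded operators on Hilbert spaces,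 is finite. Let $C^*_u(X,\mathcal A)$ be the norm closure of $\mathbb C[X,\mathcal A]$ in the adjointable operators on $E_X$, and let $C^*_{u,\max}(X,\mathcal A)$ be the completion of $\mathbb C[X,\mathcal A]$ in the universal norm. Then the identity of $\mathbb C[X,\mathcal A]$ extends uniquely to a continuous $*$-homomorphism $\lambda:C^*_{u,\max}(X,\mathcal A)\to C^*_u(X,\mathcal A)$, and $\lambda$ is an (isometric) isomorphism. -/

import Mathlib

open Filter Topology Set
open scoped NNReal ENNReal InnerProductSpace

noncomputable section

namespace TwistedRoe

universe u v

/-! ### Coarse geometry -/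

/-- Distinct points are at distance at least `δ`, for some `δ > 0`. -/
def UniformlyDiscrete (X : Type*) [MetricSpace X] : Prop :=
  ∃ δ : ℝ, 0 < δ ∧ ∀ x y : X, x ≠ y → δ ≤ dist x y

/-- Balls of a given radius have uniformly bounded cardinality. -/
def BoundedGeometry (X : Type*) [MetricSpace X] : Prop :=
  ∀ r : ℝ, 0 < r → ∃ N : ℕ, ∀ x : X, (Metric.ball x r).encard ≤ N

/-- `ρ₋ (d (x, y)) ≤ ‖f x - f y‖ ≤ ρ₊ (d (x, y))` for some non-decreasing functions `ρ₋`, `ρ₊` on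
`[0, ∞)` such that `ρ₋` tends to infinity. -/
def IsCoarseEmbedding {X H : Type*} [MetricSpace X] [NormedAddCommGroup H] (f : X → H) : Prop :=
  ∃ ρm ρp : ℝ≥0 → ℝ≥0, Monotone ρm ∧ Monotone ρp ∧ Tendsto ρm atTop atTop ∧
    ∀ x y : X, ρm (nndist x y) ≤ ‖f x - f y‖₊ ∧ ‖f x - f y‖₊ ≤ ρp (nndist x y)

/-! ### Complex Clifford algebras as C⋆-algebras -/

section Clifford

variable (E : Type v) [NormedAddCommGroup E] [InnerProductSpace ℝ E]

/-- The quadratic form `w ↦ ‖w‖ ^ 2` of a real inner product space. -/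
def normForm : QuadraticForm ℝ E := LinearMap.BilinMap.toQuadraticMap (innerₗ E)

/-- A `⋆`-representation of the complexified Clifford algebra of `E` on a nonzero complex Hilbert
space: a representation of the real Clifford algebra (with `w ^ 2 = ‖w‖ ^ 2`) in which the vectors
of `E` act by self-adjoint operators. -/
structure CliffordRep where
  K : Type v
  [grp : NormedAddCommGroup K]
  [ips : InnerProductSpace ℂ K]
  [cpl : CompleteSpace K]
  [nt : Nontrivial K]
  hom : CliffordAlgebra (normForm E) →ₐ[ℝ] (K →L[ℂ] K)
  selfAdjoint : ∀ w : E, IsSelfAdjoint (hom (CliffordAlgebra.ι (normForm E) w))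

attribute [instance] CliffordRep.grp CliffordRep.ips CliffordRep.cpl CliffordRep.nt

/-- The product C⋆-algebra of all the representations of the Clifford algebra of `E`. It contains
the complex Clifford algebra of `E`, with its C⋆-norm, as the closed `⋆`-subalgebra generated by
the vectors of `E` (see `cliffordVec`). -/
def CliffordHull : Type (v + 1) := lp (fun ρ : CliffordRep E => ρ.K →L[ℂ] ρ.K) ∞

instance instCStarLpClifford : CStarAlgebra (lp (fun ρ : CliffordRep E => ρ.K →L[ℂ] ρ.K) ∞) where

/-- The pointwise operations and the supremum norm. -/
instance instCStarCliffordHull : CStarAlgebra (CliffordHull E) :=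
  inferInstanceAs (CStarAlgebra (lp (fun ρ : CliffordRep E => ρ.K →L[ℂ] ρ.K) ∞))

variable {E}

lemma normForm_apply (w : E) : normForm E w = ‖w‖ ^ 2 := by
  simp [normForm, LinearMap.BilinMap.toQuadraticMap_apply]

lemma CliffordRep.norm_hom_le (ρ : CliffordRep E) (w : E) :
    ‖ρ.hom (CliffordAlgebra.ι (normForm E) w)‖ ≤ ‖w‖ := by
  set a := ρ.hom (CliffordAlgebra.ι (normForm E) w) with ha
  have h1 : a * a = algebraMap ℝ _ (‖w‖ ^ 2) := by
    rw [ha, ← map_mul, CliffordAlgebra.ι_sq_scalar, normForm_apply, AlgHom.commutes]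
  have h2 : ‖a‖ * ‖a‖ = ‖w‖ ^ 2 := by
    rw [← CStarRing.norm_star_mul_self, (ρ.selfAdjoint w).star_eq, h1, norm_algebraMap']
    simp
  nlinarith [norm_nonneg a, norm_nonneg w]

/-- A vector of `E`, as an element of the complex Clifford algebra of `E`. -/
def cliffordVec (w : E) : CliffordHull E :=
  ⟨fun ρ => ρ.hom (CliffordAlgebra.ι (normForm E) w), by
    refine memℓp_infty ⟨‖w‖, ?_⟩
    rintro _ ⟨ρ, rfl⟩
    exact ρ.norm_hom_le w⟩

end Clifford

/-! ### The C⋆-algebra of a Euclidean space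

For a finite-dimensional affine subspace `E` of `H`, with space of differences `E⁰`, the graded
tensor product `𝒜(E) = 𝒮 ⊗̂ 𝒞(E)` of `𝒮 = C₀(ℝ)` and `𝒞(E) = C₀(E, Cliff E⁰)` is, as a vector
space, `C₀(ℝ × E, Cliff E⁰)`, where `g ⊗̂ h` is the function `(t, p) ↦ g t • h p`. Its
multiplication and norm are obtained from the faithful `⋆`-representation that sends `g ⊗̂ h` to
the function `(t, p) ↦ (gₑ t + gₒ t • ε) * h p` on `[0, ∞) × E` with values in `Cliff (ℝ ⊕ E⁰)`.
Here `ε = (1, 0) ∈ ℝ ⊕ E⁰` is an odd self-adjoint unitary that anticommutes with `E⁰`, and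
`g = gₑ + gₒ` is the decomposition into an even and an odd function. In this picture the
functional calculus of `X ⊗̂ 1 + 1 ⊗̂ C` is pointwise the functional calculus of the Clifford
vector `(t, w)`, whose square is `t ^ 2 + ‖w‖ ^ 2`. -/

section Bott

variable (H : Type v) [NormedAddCommGroup H] [InnerProductSpace ℝ H]

/-- The C⋆-algebra in which the complex Clifford algebras of `ℝ ⊕ U`, `U` a subspace of `H`,
live. -/
abbrev Cl : Type (v + 1) := CliffordHull (WithLp 2 (ℝ × H))

variable {H}

/-- The Clifford vector `(t, w)`. -/
def cvec (t : ℝ) (w : H) : Cl H := cliffordVec (WithLp.toLp 2 (t, w))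

/-- The complex Clifford algebra of a (finite-dimensional) subspace `U` of `H`. -/
def cliff (U : Submodule ℝ H) : StarSubalgebra ℂ (Cl H) :=
  StarAlgebra.adjoin ℂ (cvec 0 '' (U : Set H))

/-- `G`, restricted to `ℝ × E`, is an element of `C₀(ℝ × E, Cliff E⁰) = 𝒜(E)`. The values of `G`
outside `ℝ × E` play no role. -/
structure IsTensorFn (E : AffineSubspace ℝ H) (G : ℝ × H → Cl H) : Prop where
  continuousOn : ContinuousOn G (univ ×ˢ (E : Set H))
  zero_at_infty : Tendsto G (Bornology.cobounded (ℝ × H) ⊓ 𝓟 (univ ×ˢ (E : Set H))) (𝓝 0)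
  mem_cliff : ∀ t : ℝ, ∀ p ∈ E, G (t, p) ∈ cliff E.direction

open Classical in
/-- The orthogonal projection of `w` to the affine subspace `E`. -/
def foot (E : AffineSubspace ℝ H) (w : H) : H :=
  if h : ∃ p ∈ E, w - p ∈ E.directionᗮ then h.choose else w

/-- The even part in the real variable. -/
def evenPart (G : ℝ × H → Cl H) (t : ℝ) (p : H) : Cl H := (2⁻¹ : ℝ) • (G (t, p) + G (-t, p))

/-- The odd part in the real variable. -/
def oddPart (G : ℝ × H → Cl H) (t : ℝ) (p : H) : Cl H := (2⁻¹ : ℝ) • (G (t, p) - G (-t, p))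

/-- The image of `G ∈ 𝒜(E)` in the limit algebra, as a function on `[0, ∞) × H` with values in the
Clifford algebra of `ℝ ⊕ H`. With `w = p + w'`, where `p` is the projection of `w` to `E`, it sends
`g ⊗̂ h` to the function `(t, w) ↦ g (cvec t w') * h p`, in the sense of functional calculus: if
`r ^ 2 = t ^ 2 + ‖w'‖ ^ 2` then `g (cvec t w') = gₑ r + (gₒ r / r) • cvec t w'`. -/
def bott (E : AffineSubspace ℝ H) (G : ℝ × H → Cl H) (u : ℝ≥0 × H) : Cl H :=
  let p := foot E u.2
  let r := √((u.1 : ℝ) ^ 2 + ‖u.2 - p‖ ^ 2)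
  evenPart G r p + (r⁻¹ • cvec u.1 (u.2 - p)) * oddPart G r p

lemma cvec_mul_self (t : ℝ) (w : H) :
    cvec t w * cvec t w = (t ^ 2 + ‖w‖ ^ 2) • (1 : Cl H) := by
  refine Subtype.ext (funext fun ρ => ?_)
  change ρ.hom _ * ρ.hom _ = (t ^ 2 + ‖w‖ ^ 2) • (1 : ρ.K →L[ℂ] ρ.K)
  rw [← map_mul, CliffordAlgebra.ι_sq_scalar, normForm_apply, AlgHom.commutes,
    WithLp.prod_norm_sq_eq_of_L2, Algebra.algebraMap_eq_smul_one]
  simp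

lemma isSelfAdjoint_cvec (t : ℝ) (w : H) : IsSelfAdjoint (cvec t w) :=
  Subtype.ext (funext fun ρ => ρ.selfAdjoint _)

/-- On an elementary tensor `g ⊗̂ h`, the map `bott` is `g (X ⊗̂ 1 + 1 ⊗̂ C) (1 ⊗̂ h)`. -/
lemma bott_tensor (E : AffineSubspace ℝ H) (g : ℝ → ℝ) (h : H → Cl H) (u : ℝ≥0 × H) :
    bott E (fun q => g q.1 • h q.2) u =
      cfc g (cvec u.1 (u.2 - foot E u.2)) * h (foot E u.2) := by
  simp only [bott, evenPart, oddPart]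
  set p := foot E u.2
  set a := cvec (u.1 : ℝ) (u.2 - p) with ha
  have hsa : IsSelfAdjoint a := isSelfAdjoint_cvec _ _
  set r := √((u.1 : ℝ) ^ 2 + ‖u.2 - p‖ ^ 2) with hr
  have haa : a * a = (r ^ 2) • (1 : Cl H) := by
    rw [hr, Real.sq_sqrt (by positivity), cvec_mul_self]
  have hspec : ∀ x ∈ spectrum ℝ a, x = r ∨ x = -r := fun x hx => by
    have h2 : x ^ 2 ∈ spectrum ℝ (a ^ 2) := spectrum.pow_mem_pow a 2 hx
    rw [pow_two a, haa, ← Algebra.algebraMap_eq_smul_one] at h2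
    have : x ^ 2 = r ^ 2 := by
      by_contra hne
      refine h2 ?_
      change IsUnit _
      rw [← map_sub]
      exact (IsUnit.mk0 _ (sub_ne_zero.2 hne)).map _
    exact sq_eq_sq_iff_eq_or_eq_neg.1 this
  have hcfc : cfc g a = (2⁻¹ * (g r + g (-r))) • (1 : Cl H) +
      (2⁻¹ * (g r - g (-r)) * r⁻¹) • a := by
    have e : Set.EqOn g (fun x => 2⁻¹ * (g r + g (-r)) + 2⁻¹ * (g r - g (-r)) * r⁻¹ * x)
        (spectrum ℝ a) := fun x hx => by
      rcases eq_or_ne r 0 with h0 | h0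
      · rcases hspec x hx with rfl | rfl <;> simp [h0] <;> ring
      · rcases hspec x hx with rfl | rfl <;> simp only [] <;> field_simp <;> ring
    rw [cfc_congr e, cfc_const_add .., cfc_const_mul_id .., Algebra.algebraMap_eq_smul_one]
  rw [hcfc, add_mul, smul_mul_assoc, smul_mul_assoc, smul_mul_assoc, one_mul, mul_smul_comm,
    ← add_smul, ← sub_smul, mul_smul_comm]
  simp only [smul_smul]
  congr 2
  ring

variable (H) in
/-- The C⋆-algebra of bounded functions on `[0, ∞) × H` with values in `Cl H`, with the supremum
norm. -/
def BddFn : Type (v + 1) := lp (fun _ : ℝ≥0 × H => Cl H) ∞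

instance instCStarBddFn : NonUnitalCStarAlgebra (BddFn H) :=
  inferInstanceAs (NonUnitalCStarAlgebra (lp (fun _ : ℝ≥0 × H => Cl H) ∞))

instance instCoeFunBddFn : CoeFun (BddFn H) fun _ => ℝ≥0 × H → Cl H := ⟨fun a => a.1⟩

/-- The `⋆`-algebra generated by the images of the algebras `𝒜(E)`, for `E` a finite-dimensional
affine subspace of `V`. (Since these images form an increasing net of `⋆`-algebras, it is just
their union.) -/
def unionAlg (V : Submodule ℝ H) : NonUnitalStarSubalgebra ℂ (BddFn H) :=
  NonUnitalStarAlgebra.adjoin ℂ {a | ∃ (E : AffineSubspace ℝ H) (G : ℝ × H → Cl H),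
    (E : Set H).Nonempty ∧ FiniteDimensional ℝ E.direction ∧ (E : Set H) ⊆ V ∧
    IsTensorFn E G ∧ ∀ u, a u = bott E G u}

/-- The C⋆-algebra `𝒜(V) = lim 𝒜(E)`, `E` ranging over the finite-dimensional affine subspaces
of `V`. The connecting maps are isometric, so that the limit is the closed union of the `𝒜(E)`. -/
def limAlg (V : Submodule ℝ H) : NonUnitalStarSubalgebra ℂ (BddFn H) :=
  (unionAlg V).topologicalClosure

instance instCStarLimAlg (V : Submodule ℝ H) : NonUnitalCStarAlgebra (limAlg V) :=
  NonUnitalStarSubalgebra.nonUnitalCStarAlgebra (limAlg V)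
    (h_closed := NonUnitalStarSubalgebra.isClosed_topologicalClosure _)

variable (H) in
/-- The set `[0, ∞) × H`, with the weakest topology for which the projection to `H` is weakly
continuous and `(t, w) ↦ t ^ 2 + ‖w‖ ^ 2` is continuous. -/
def RayProd : Type v := ℝ≥0 × H

instance instTopRayProd : TopologicalSpace (RayProd H) :=
  TopologicalSpace.induced
    (fun u : ℝ≥0 × H => ((fun w : H => ⟪w, u.2⟫_ℝ), (u.1 : ℝ) ^ 2 + ‖u.2‖ ^ 2)) inferInstance

/-- The support of an element of the limit algebra: the complement of the set of all
`u ∈ [0, ∞) × H` for which there is `g ∈ C₀([0, ∞) × H)` with `g u ≠ 0` and `g · a = 0`. -/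
def support (a : BddFn H) : Set (ℝ≥0 × H) :=
  {u | ∃ g : ZeroAtInftyContinuousMap (RayProd H) ℂ,
    g (show RayProd H from u) ≠ 0 ∧ ∀ w : ℝ≥0 × H, g (show RayProd H from w) • a w = 0}ᶜ

/-- The open ball of radius `r` about `(0, v)` in `[0, ∞) × H`. -/
def rayBall (v : H) (r : ℝ) : Set (ℝ≥0 × H) :=
  {u | (u.1 : ℝ) ^ 2 + ‖u.2 - v‖ ^ 2 < r ^ 2}

end Bott

/-! ### The standard Hilbert module over a C⋆-algebra and its adjointable operators -/

section HilbertModule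

variable {X : Type u} {A : Type v} [NonUnitalCStarAlgebra A]

/-- The norm `‖∑ x ∈ s, (a x)⋆ (a x)‖ ^ (1 / 2)` of the restriction of a family to a finite set. -/
def partNorm (s : Finset X) (a : X → A) : ℝ := √‖∑ x ∈ s, star (a x) * a x‖

lemma partNorm_nonneg (s : Finset X) (a : X → A) : 0 ≤ partNorm s a := Real.sqrt_nonneg _

section aux
attribute [local instance] CStarAlgebra.spectralOrder CStarAlgebra.spectralOrderedRing

def toPi (s : Finset X) (a : X → A) : WithCStarModule A (s → A) :=
  (WithCStarModule.equiv A (s → A)).symm (fun x => star (a x))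

lemma inner_toPi (s : Finset X) (a b : X → A) :
    inner A (toPi s b) (toPi s a) = ∑ x ∈ s, star (a x) * b x := by
  rw [WithCStarModule.pi_inner, ← Finset.sum_coe_sort s]
  simp [toPi, WithCStarModule.inner_def]

lemma norm_toPi (s : Finset X) (a : X → A) : ‖toPi s a‖ = partNorm s a := by
  rw [CStarModule.norm_eq_sqrt_norm_inner_self (A := A), inner_toPi, partNorm]

lemma norm_sum_le_partNorm (s : Finset X) (a b : X → A) :
    ‖∑ x ∈ s, star (a x) * b x‖ ≤ partNorm s a * partNorm s b := by
  rw [← inner_toPi, ← norm_toPi, ← norm_toPi, mul_comm]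
  exact CStarModule.norm_inner_le _

lemma partNorm_add_le (s : Finset X) (a b : X → A) :
    partNorm s (a + b) ≤ partNorm s a + partNorm s b := by
  rw [← norm_toPi, ← norm_toPi, ← norm_toPi]
  have : toPi s (a + b) = toPi s a + toPi s b := by
    unfold toPi; ext x; simp
  rw [this]
  exact CStarModule.norm_triangle A _ _

lemma norm_apply_le_partNorm (s : Finset X) (a : X → A) {x : X} (hx : x ∈ s) :
    ‖a x‖ ≤ partNorm s a := by
  rw [← norm_toPi]
  have := WithCStarModule.norm_apply_le_norm (toPi s a) ⟨x, hx⟩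
  simpa [toPi] using this

lemma partNorm_mono (a : X → A) {s t : Finset X} (h : s ⊆ t) : partNorm s a ≤ partNorm t a := by
  refine Real.sqrt_le_sqrt (CStarAlgebra.norm_le_norm_of_nonneg_of_le
    (Finset.sum_nonneg fun x _ => star_mul_self_nonneg _) ?_)
  exact Finset.sum_le_sum_of_subset_of_nonneg h fun x _ _ => star_mul_self_nonneg _

end aux

lemma continuous_partNorm (s : Finset X) : Continuous (partNorm s : (X → A) → ℝ) := by
  unfold partNorm
  fun_prop

lemma partNorm_smul (s : Finset X) (z : ℂ) (a : X → A) :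
    partNorm s (z • a) = ‖z‖ * partNorm s a := by
  have h : ∑ x ∈ s, star ((z • a) x) * (z • a) x =
      (star z * z) • ∑ x ∈ s, star (a x) * a x := by
    rw [Finset.smul_sum]
    refine Finset.sum_congr rfl fun x _ => ?_
    simp [star_smul, smul_mul_smul_comm]
  rw [partNorm, h, norm_smul, norm_mul, norm_star, Real.sqrt_mul (by positivity),
    Real.sqrt_mul_self (norm_nonneg z), partNorm]

lemma summable_iff_partNorm (a : X → A) :
    (Summable fun x => star (a x) * a x) ↔
      ∀ ε > 0, ∃ s : Finset X, ∀ t : Finset X, Disjoint t s → partNorm t a < ε := by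
  rw [summable_iff_vanishing_norm]
  constructor
  · intro h ε hε
    obtain ⟨s, hs⟩ := h (ε ^ 2) (by positivity)
    exact ⟨s, fun t ht => (Real.sqrt_lt' hε).2 (hs t ht)⟩
  · intro h ε hε
    obtain ⟨s, hs⟩ := h (√ε) (by positivity)
    exact ⟨s, fun t ht => (Real.sqrt_lt_sqrt_iff (norm_nonneg _)).1 (hs t ht)⟩

variable (X A)

/-- The families `a : X → A` such that `∑ x, (a x)⋆ (a x)` is norm convergent. -/
def l2Submodule : Submodule ℂ (X → A) where
  carrier := {a | Summable fun x => star (a x) * a x}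
  zero_mem' := by simp
  add_mem' := by
    intro a b ha hb
    simp only [mem_ofPred_eq, summable_iff_partNorm] at *
    intro ε hε
    obtain ⟨s, hs⟩ := ha (ε / 2) (by positivity)
    obtain ⟨s', hs'⟩ := hb (ε / 2) (by positivity)
    classical
    refine ⟨s ∪ s', fun t ht => ?_⟩
    rw [Finset.disjoint_union_right] at ht
    have := partNorm_add_le t a b
    linarith [hs t ht.1, hs' t ht.2]
  smul_mem' := by
    intro z a ha
    have : (fun x => star ((z • a) x) * (z • a) x) =
        fun x => (star z * z) • (star (a x) * a x) := by
      ext x; simp [star_smul, smul_mul_smul_comm]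
    simp only [mem_ofPred_eq] at ha ⊢
    rw [this]
    exact ha.const_smul _

/-- The Hilbert `A`-module of all families `a : X → A` such that `∑ x, (a x)⋆ (a x)` is norm
convergent, with inner product `⟨a, b⟩ = ∑ x, (a x)⋆ (b x)`. -/
def HilbertSum : Type (max u v) := l2Submodule X A

variable {X A}

namespace HilbertSum

instance instAddCommGroup : AddCommGroup (HilbertSum X A) := inferInstanceAs (AddCommGroup (l2Submodule X A))
instance instModule : Module ℂ (HilbertSum X A) := inferInstanceAs (Module ℂ (l2Submodule X A))
instance instCoeFun : CoeFun (HilbertSum X A) fun _ => X → A := ⟨fun a => a.1⟩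

@[ext] lemma ext {a b : HilbertSum X A} (h : ∀ x, a x = b x) : a = b := Subtype.ext (funext h)

@[simp] lemma add_apply (a b : HilbertSum X A) (x : X) : (a + b) x = a x + b x := rfl
@[simp] lemma smul_apply (z : ℂ) (a : HilbertSum X A) (x : X) : (z • a) x = z • a x := rfl
@[simp] lemma zero_apply (x : X) : (0 : HilbertSum X A) x = 0 := rfl

/-- The `A`-valued inner product. -/
def inn (a b : HilbertSum X A) : A := ∑' x, star (a x) * b x

lemma summable_inn (a b : HilbertSum X A) : Summable fun x => star (a x) * b x := by
  have ha := (summable_iff_partNorm _).1 a.2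
  have hb := (summable_iff_partNorm _).1 b.2
  rw [summable_iff_vanishing_norm]
  intro ε hε
  obtain ⟨s, hs⟩ := ha (√ε) (by positivity)
  obtain ⟨s', hs'⟩ := hb (√ε) (by positivity)
  classical
  refine ⟨s ∪ s', fun t ht => ?_⟩
  rw [Finset.disjoint_union_right] at ht
  calc _ ≤ partNorm t a * partNorm t b := norm_sum_le_partNorm t a b
    _ < √ε * √ε := mul_lt_mul'' (hs t ht.1) (hs' t ht.2) (partNorm_nonneg _ _) (partNorm_nonneg _ _)
    _ = ε := Real.mul_self_sqrt hε.le

lemma inn_add_left (a b c : HilbertSum X A) : inn (a + b) c = inn a c + inn b c := by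
  simp only [inn, add_apply, star_add, add_mul]
  exact (summable_inn a c).tsum_add (summable_inn b c)

lemma inn_add_right (a b c : HilbertSum X A) : inn a (b + c) = inn a b + inn a c := by
  simp only [inn, add_apply, mul_add]
  exact (summable_inn a b).tsum_add (summable_inn a c)

lemma inn_smul_right (z : ℂ) (a b : HilbertSum X A) : inn a (z • b) = z • inn a b := by
  simp only [inn, smul_apply, mul_smul_comm]
  exact (summable_inn a b).tsum_const_smul z

lemma star_inn (a b : HilbertSum X A) : star (inn a b) = inn b a := by
  simp only [inn, tsum_star, star_mul, star_star]

lemma inn_smul_left (z : ℂ) (a b : HilbertSum X A) : inn (z • a) b = star z • inn a b := by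
  rw [← star_inn, inn_smul_right, star_smul, star_inn]

/-- The Hilbert module norm `‖a‖ = ‖⟨a, a⟩‖ ^ (1 / 2)`. -/
instance instNorm : Norm (HilbertSum X A) := ⟨fun a => √‖inn a a‖⟩

lemma norm_def (a : HilbertSum X A) : ‖a‖ = √‖inn a a‖ := rfl

lemma norm_sq (a : HilbertSum X A) : ‖a‖ ^ 2 = ‖inn a a‖ := Real.sq_sqrt (norm_nonneg _)

lemma tendsto_partNorm (a : HilbertSum X A) :
    Tendsto (fun s : Finset X => partNorm s a) atTop (𝓝 ‖a‖) :=
  (Real.continuous_sqrt.tendsto _).comp ((summable_inn a a).hasSum.norm)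

lemma norm_inn_le (a b : HilbertSum X A) : ‖inn a b‖ ≤ ‖a‖ * ‖b‖ :=
  le_of_tendsto_of_tendsto' (summable_inn a b).hasSum.norm
    ((tendsto_partNorm a).mul (tendsto_partNorm b)) fun s => norm_sum_le_partNorm s a b

lemma norm_apply_le (a : HilbertSum X A) (x : X) : ‖a x‖ ≤ ‖a‖ :=
  ge_of_tendsto (tendsto_partNorm a) <|
    (eventually_ge_atTop {x}).mono fun s hs => norm_apply_le_partNorm s a (hs (by simp))

lemma core : NormedSpace.Core ℂ (HilbertSum X A) where
  norm_nonneg a := Real.sqrt_nonneg _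
  norm_smul z a := by
    refine tendsto_nhds_unique (tendsto_partNorm (z • a)) ?_
    have : (fun s : Finset X => partNorm s (z • a : HilbertSum X A)) =
        fun s => ‖z‖ * partNorm s a := funext fun s => partNorm_smul s z a
    rw [this]
    exact (tendsto_partNorm a).const_mul _
  norm_triangle a b :=
    le_of_tendsto_of_tendsto' (tendsto_partNorm (a + b))
      ((tendsto_partNorm a).add (tendsto_partNorm b)) fun s => partNorm_add_le s a b
  norm_eq_zero_iff a := by
    constructor
    · intro h
      ext x
      have := norm_apply_le a x
      rw [h] at this
      simpa using this
    · rintro rfl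
      simp [norm_def, inn]

instance instNormedAddCommGroup : NormedAddCommGroup (HilbertSum X A) := NormedAddCommGroup.ofCore core
instance instNormedSpace : NormedSpace ℂ (HilbertSum X A) := NormedSpace.ofCore core

lemma partNorm_le (a : HilbertSum X A) (s : Finset X) : partNorm s a ≤ ‖a‖ :=
  ge_of_tendsto (tendsto_partNorm a) <|
    (eventually_ge_atTop s).mono fun _ h => partNorm_mono a h

instance instCompleteSpace : CompleteSpace (HilbertSum X A) := by
  refine Metric.complete_of_cauchySeq_tendsto fun u hu => ?_
  have hx : ∀ x, ∃ l, Tendsto (fun n => u n x) atTop (𝓝 l) := fun x => by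
    refine cauchySeq_tendsto_of_complete (Metric.cauchySeq_iff.2 fun ε hε => ?_)
    obtain ⟨N, hN⟩ := Metric.cauchySeq_iff.1 hu ε hε
    refine ⟨N, fun m hm n hn => lt_of_le_of_lt ?_ (hN m hm n hn)⟩
    rw [dist_eq_norm, dist_eq_norm]
    exact norm_apply_le (u m - u n) x
  choose l hl using hx
  have key : ∀ ε > 0, ∃ N, ∀ n ≥ N, ∀ s, partNorm s (l - (u n : X → A)) ≤ ε := by
    intro ε hε
    obtain ⟨N, hN⟩ := Metric.cauchySeq_iff.1 hu ε hε
    refine ⟨N, fun n hn s => ?_⟩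
    have ht : Tendsto (fun m => partNorm s ((u m : X → A) - (u n : X → A))) atTop
        (𝓝 (partNorm s (l - (u n : X → A)))) :=
      ((continuous_partNorm s).tendsto _).comp
        ((tendsto_pi_nhds.2 hl).sub tendsto_const_nhds)
    refine le_of_tendsto ht ((eventually_ge_atTop N).mono fun m hm => ?_)
    refine (partNorm_le (u m - u n) s).trans ?_
    rw [← dist_eq_norm]
    exact (hN m hm n hn).le
  have hmem : l ∈ l2Submodule X A := by
    refine (summable_iff_partNorm l).2 fun ε hε => ?_
    obtain ⟨N, hN⟩ := key (ε / 2) (by positivity)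
    obtain ⟨s, hs⟩ := (summable_iff_partNorm _).1 (u N).2 (ε / 2) (by positivity)
    refine ⟨s, fun t ht => ?_⟩
    have h1 := partNorm_add_le t (l - (u N : X → A)) (u N : X → A)
    rw [sub_add_cancel] at h1
    linarith [hN N le_rfl t, hs t ht]
  let l' : HilbertSum X A := ⟨l, hmem⟩
  refine ⟨l', Metric.tendsto_atTop.2 fun ε hε => ?_⟩
  obtain ⟨N, hN⟩ := key (ε / 2) (by positivity)
  refine ⟨N, fun n hn => ?_⟩
  rw [dist_comm, dist_eq_norm]
  have : ‖l' - u n‖ ≤ ε / 2 :=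
    le_of_tendsto' (tendsto_partNorm _) fun s => hN n hn s
  linarith

lemma tendsto_inn_right (a : HilbertSum X A) {ι : Type*} {F : Filter ι} {u : ι → HilbertSum X A}
    {b : HilbertSum X A} (h : Tendsto u F (𝓝 b)) :
    Tendsto (fun i => inn a (u i)) F (𝓝 (inn a b)) := by
  let L : HilbertSum X A →ₗ[ℂ] A :=
    { toFun := inn a
      map_add' := inn_add_right a
      map_smul' := fun z b => inn_smul_right z a b }
  exact ((L.mkContinuous ‖a‖ (norm_inn_le a)).continuous.tendsto b).comp h

lemma tendsto_inn_left (a : HilbertSum X A) {ι : Type*} {F : Filter ι} {u : ι → HilbertSum X A}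
    {b : HilbertSum X A} (h : Tendsto u F (𝓝 b)) :
    Tendsto (fun i => inn (u i) a) F (𝓝 (inn b a)) := by
  simpa only [star_inn] using (tendsto_inn_right a h).star

lemma inn_self_eq_zero {a : HilbertSum X A} (h : inn a a = 0) : a = 0 := by
  rw [← norm_eq_zero, norm_def, h]; simp

lemma ext_inn_left {a b : HilbertSum X A} (h : ∀ c, inn c a = inn c b) : a = b := by
  rw [← sub_eq_zero]
  apply inn_self_eq_zero
  have h' : ∀ c, inn c (a + (-1 : ℂ) • b) = 0 := fun c => by
    rw [inn_add_right, inn_smul_right, h c]; simp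
  have e : a - b = a + (-1 : ℂ) • b := by rw [neg_one_smul, sub_eq_add_neg]
  rw [e]
  exact h' _

end HilbertSum

variable (X A)

/-- The adjointable operators on the Hilbert `A`-module `HilbertSum X A`. -/
def adjointableSubalgebra : Subalgebra ℂ (HilbertSum X A →L[ℂ] HilbertSum X A) where
  carrier := {T | ∃ S : HilbertSum X A →L[ℂ] HilbertSum X A,
    ∀ a b, HilbertSum.inn (T a) b = HilbertSum.inn a (S b)}
  mul_mem' := by
    rintro T T' ⟨S, hS⟩ ⟨S', hS'⟩
    exact ⟨S' * S, fun a b => by simp [hS, hS']⟩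
  add_mem' := by
    rintro T T' ⟨S, hS⟩ ⟨S', hS'⟩
    exact ⟨S + S', fun a b => by
      simp [hS, hS', HilbertSum.inn_add_left, HilbertSum.inn_add_right]⟩
  algebraMap_mem' z := ⟨algebraMap ℂ _ (star z), fun a b => by
    simp [Algebra.algebraMap_eq_smul_one, HilbertSum.inn_smul_left, HilbertSum.inn_smul_right]⟩

/-- The C⋆-algebra of adjointable operators on the Hilbert `A`-module `HilbertSum X A`, with the
operator norm and the adjoint as involution. -/
def Adjointable : Type (max u v) := adjointableSubalgebra X A

variable {X A}

namespace Adjointable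

instance instNormedRing : NormedRing (Adjointable X A) := inferInstanceAs (NormedRing (adjointableSubalgebra X A))
instance instNormedAlgebra : NormedAlgebra ℂ (Adjointable X A) :=
  inferInstanceAs (NormedAlgebra ℂ (adjointableSubalgebra X A))

open HilbertSum

/-- The adjoint of an adjointable operator. -/
instance instStar : Star (Adjointable X A) where
  star T := ⟨T.2.choose, T.1, fun a b => by
    rw [← star_inn, ← T.2.choose_spec, star_inn]⟩

lemma inn_apply (T : Adjointable X A) (a b : HilbertSum X A) :
    inn (T.1 a) b = inn a ((star T).1 b) := T.2.choose_spec a b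

lemma eq_star {T S : Adjointable X A} (h : ∀ a b, inn (T.1 a) b = inn a (S.1 b)) : star T = S :=
  Subtype.ext <| ContinuousLinearMap.ext fun b => ext_inn_left fun a => by
    rw [← inn_apply, h]

instance instStarRing : StarRing (Adjointable X A) where
  star_involutive T := eq_star fun a b => by rw [← star_inn, ← inn_apply, star_inn]
  star_mul T S := eq_star fun a b => by
    change inn (T.1 (S.1 a)) b = inn a ((star S).1 ((star T).1 b))
    rw [inn_apply, inn_apply]
  star_add T S := eq_star fun a b => by
    change inn (T.1 a + S.1 a) b = inn a ((star T).1 b + (star S).1 b)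
    rw [inn_add_left, inn_add_right, inn_apply, inn_apply]

instance instStarModule : StarModule ℂ (Adjointable X A) where
  star_smul z T := eq_star fun a b => by
    change inn (z • T.1 a) b = inn a (star z • (star T).1 b)
    rw [inn_smul_left, inn_smul_right, inn_apply]

lemma norm_sq_apply_le (T : Adjointable X A) (a : HilbertSum X A) :
    ‖T.1 a‖ ^ 2 ≤ ‖star T * T‖ * ‖a‖ ^ 2 := by
  rw [norm_sq, inn_apply]
  calc _ ≤ ‖a‖ * ‖(star T * T).1 a‖ := norm_inn_le _ _
    _ ≤ ‖a‖ * (‖star T * T‖ * ‖a‖) := by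
        gcongr; exact (star T * T).1.le_opNorm a
    _ = _ := by ring

lemma norm_sq_le (T : Adjointable X A) : ‖T‖ * ‖T‖ ≤ ‖star T * T‖ := by
  have h : ‖T‖ ≤ √‖star T * T‖ := by
    refine T.1.opNorm_le_bound (Real.sqrt_nonneg _) fun a => ?_
    refine le_of_sq_le_sq ?_ (by positivity)
    rw [mul_pow, Real.sq_sqrt (norm_nonneg (star T * T))]
    exact norm_sq_apply_le T a
  calc _ ≤ √‖star T * T‖ * √‖star T * T‖ := by gcongr
    _ = _ := Real.mul_self_sqrt (norm_nonneg _)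

instance instCStarRing : CStarRing (Adjointable X A) := ⟨norm_sq_le⟩

instance instCompleteSpace : CompleteSpace (Adjointable X A) := by
  refine Metric.complete_of_cauchySeq_tendsto fun u hu => ?_
  have hs : CauchySeq fun n => star (u n) := by
    rw [Metric.cauchySeq_iff] at hu ⊢
    simpa only [dist_eq_norm, ← star_sub, norm_star] using hu
  obtain ⟨T, hT⟩ := cauchySeq_tendsto_of_complete
    (show CauchySeq fun n => (u n).1 from Metric.cauchySeq_iff.2 fun ε hε =>
      Metric.cauchySeq_iff.1 hu ε hε)
  obtain ⟨S, hS⟩ := cauchySeq_tendsto_of_complete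
    (show CauchySeq fun n => (star (u n)).1 from Metric.cauchySeq_iff.2 fun ε hε =>
      Metric.cauchySeq_iff.1 hs ε hε)
  have hTa : ∀ a, Tendsto (fun n => (u n).1 a) atTop (𝓝 (T a)) := fun a =>
    ((ContinuousLinearMap.apply ℂ _ a).continuous.tendsto T).comp hT
  have hSa : ∀ a, Tendsto (fun n => (star (u n)).1 a) atTop (𝓝 (S a)) := fun a =>
    ((ContinuousLinearMap.apply ℂ _ a).continuous.tendsto S).comp hS
  have hTS : ∀ a b, inn (T a) b = inn a (S b) := fun a b => by
    refine tendsto_nhds_unique (tendsto_inn_left b (hTa a)) ?_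
    simp only [inn_apply]
    exact tendsto_inn_right a (hSa b)
  exact ⟨⟨T, S, hTS⟩, tendsto_subtype_rng.2 hT⟩

instance instCStarAlgebra : CStarAlgebra (Adjointable X A) where

end Adjointable
end HilbertModule

/-! ### The twisted uniform Roe algebras -/

section TwistedRoe

variable {X : Type u} [MetricSpace X]
variable {H : Type v} [NormedAddCommGroup H] [InnerProductSpace ℝ H] (f : X → H)

/-- The C⋆-algebra `𝒜(V)` for `V` the linear span of `f(X)`. -/
def TwistAlg : Type (v + 1) := limAlg (Submodule.span ℝ (range f))

instance instCStarTwistAlg : NonUnitalCStarAlgebra (TwistAlg f) :=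
  inferInstanceAs (NonUnitalCStarAlgebra (limAlg (Submodule.span ℝ (range f))))

variable {f} in
/-- The inclusion of `𝒜(V)` in the functions on `[0, ∞) × H`. -/
def TwistAlg.toFn (a : TwistAlg f) : BddFn H := a.1

/-- `W_n(x)`: the linear span of all `f y` with `d (x, y) ≤ n ^ 2`. -/
def W (n : ℕ) (x : X) : Submodule ℝ H := Submodule.span ℝ (f '' {y | dist x y ≤ (n : ℝ) ^ 2})

/-- The functions `T : X × X → 𝒜(V)` that make up the algebraic twisted uniform Roe algebra. In
`entry`, `T₁ x y` is the element of `𝒜(W_N(x))` whose image in `𝒜(V)` is `T x y`. -/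
structure IsTwisted (T : X → X → TwistAlg f) : Prop where
  entry : ∃ (N : ℕ) (T₁ : X → X → ℝ × H → Cl H),
    (∀ x y, IsTensorFn (W f N x).toAffineSubspace (T₁ x y) ∧
      ∀ u, (T x y).toFn u =
        bott (W f N x).toAffineSubspace (T₁ x y) u) ∧
    ∃ c : ℝ, 0 < c ∧ ∀ x y, ∀ q ∈ (univ : Set ℝ) ×ˢ (W f N x : Set H),
      ∀ Y ∈ (univ : Set ℝ) ×ˢ (W f N x : Set H), Y.1 ^ 2 + ‖Y.2‖ ^ 2 < 1 →
        LineDifferentiableAt ℝ (T₁ x y) q Y ∧ ‖lineDeriv ℝ (T₁ x y) q Y‖ ≤ c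
  bounded : ∃ M : ℝ, 0 < M ∧ ∀ x y, ‖T x y‖ ≤ M
  finite_propagation : ∃ r₁ : ℝ, 0 < r₁ ∧ ∀ x y, r₁ < dist x y → T x y = 0
  support_subset : ∃ r₂ : ℝ, 0 < r₂ ∧ ∀ x y,
    support (T x y).toFn ⊆ rayBall (f x) r₂

/-- The (right) Hilbert `𝒜(V)`-module `E_X`. -/
abbrev EX : Type (max u (v + 1)) := HilbertSum X (TwistAlg f)

/-- The adjointable operator `L` on `E_X` is matrix multiplication by `T`. -/
def ActsBy (L : Adjointable X (TwistAlg f)) (T : X → X → TwistAlg f) : Prop :=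
  ∀ (a : EX f) (x : X), HasSum (fun y => T x y * a y) ((L.1 a : EX f) x)

/-- The operators on `E_X` given by matrix multiplication by the functions in `IsTwisted`. -/
def twistedOps : Set (Adjointable X (TwistAlg f)) := {L | ∃ T, IsTwisted f T ∧ ActsBy f L T}

/-- The algebraic twisted uniform Roe algebra `ℂ[X, 𝒜]`, identified with its image under the
faithful representation on `E_X` by matrix multiplication. (The set `twistedOps` is a
`⋆`-algebra when `f` is a coarse embedding and `X` has bounded geometry.) -/
def algTwistedRoe : NonUnitalStarSubalgebra ℂ (Adjointable X (TwistAlg f)) :=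
  NonUnitalStarAlgebra.adjoin ℂ (twistedOps f)

/-- The twisted uniform Roe algebra: the norm closure of `ℂ[X, 𝒜]` in the adjointable operators
on `E_X`. -/
def redTwistedRoe : NonUnitalStarSubalgebra ℂ (Adjointable X (TwistAlg f)) :=
  (algTwistedRoe f).topologicalClosure

/-- A `⋆`-representation of `ℂ[X, 𝒜]` by bounded operators on a complex Hilbert space. -/
structure TwistedRep where
  K : Type (max u (v + 1))
  [grp : NormedAddCommGroup K]
  [ips : InnerProductSpace ℂ K]
  [cpl : CompleteSpace K]
  hom : algTwistedRoe f →⋆ₙₐ[ℂ] (K →L[ℂ] K)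

attribute [instance] TwistedRep.grp TwistedRep.ips TwistedRep.cpl

/-- The C⋆-algebra of all bounded families of operators, indexed by the representations of
`ℂ[X, 𝒜]`, with the supremum norm. -/
def RepProd : Type (max (u + 1) (v + 2)) := lp (fun π : TwistedRep f => π.K →L[ℂ] π.K) ∞

instance instCStarRepProd : NonUnitalCStarAlgebra (RepProd f) :=
  inferInstanceAs (NonUnitalCStarAlgebra (lp (fun π : TwistedRep f => π.K →L[ℂ] π.K) ∞))

/-- `b` is the family `(π T)`, where `π` ranges over all the `⋆`-representations of `ℂ[X, 𝒜]`. The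
norm of `b` is then `sup_π ‖π T‖`, the universal norm of `T`. -/
def IsUniversalImage (T : algTwistedRoe f) (b : RepProd f) : Prop := ∀ π, b.1 π = π.hom T

/-- The image of (the part with finite universal norm of) `ℂ[X, 𝒜]` under all its
representations. -/
def universalAlg : NonUnitalStarSubalgebra ℂ (RepProd f) where
  carrier := {b | ∃ T, IsUniversalImage f T b}
  zero_mem' := ⟨0, fun π => (map_zero π.hom).symm⟩
  add_mem' := by
    rintro b b' ⟨T, hT⟩ ⟨T', hT'⟩
    exact ⟨T + T', fun π => by
      change b.1 π + b'.1 π = π.hom (T + T')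
      rw [map_add, hT π, hT' π]⟩
  mul_mem' := by
    rintro b b' ⟨T, hT⟩ ⟨T', hT'⟩
    exact ⟨T * T', fun π => by
      change b.1 π * b'.1 π = π.hom (T * T')
      rw [map_mul, hT π, hT' π]⟩
  smul_mem' := by
    rintro z b ⟨T, hT⟩
    exact ⟨z • T, fun π => by
      change z • b.1 π = π.hom (z • T)
      rw [map_smul, hT π]⟩
  star_mem' := by
    rintro b ⟨T, hT⟩
    exact ⟨star T, fun π => by
      change star (b.1 π) = π.hom (star T)
      rw [map_star, hT π]⟩

/-- The maximal twisted uniform Roe algebra: the completion of `ℂ[X, 𝒜]` for the universal norm,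
that is, the closure of its image in the product of all its `⋆`-representations. -/
def maxTwistedRoe : NonUnitalStarSubalgebra ℂ (RepProd f) := (universalAlg f).topologicalClosure

/-- `φ` is the canonical map from the maximal to the reduced algebra: it is continuous, and it is
the identity on `ℂ[X, 𝒜]`. -/
def IsCanonicalQuotient (φ : maxTwistedRoe f →⋆ₙₐ[ℂ] redTwistedRoe f) : Prop :=
  Continuous φ ∧ ∀ (T : algTwistedRoe f) (b : maxTwistedRoe f), IsUniversalImage f T b →
    (φ b : Adjointable X (TwistAlg f)) = T

end TwistedRoe

end TwistedRoe

end

/-!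
The algebra `ℂ[X, 𝒜]` is inverse closed in the adjointable operators on `E_X`, in the following
sense: for `P` in it with `‖P‖ < 1` the quasi-inverse `Q = P + P ^ 2 + P ^ 3 + ⋯` belongs to it
again (`exists_quasiInverse`). This makes the universal norm equal to the reduced norm. On the one
hand, a `⋆`-representation `π` with `‖π T‖ > ‖T‖` would give an element `P = ‖π T‖⁻² T⋆ T` of norm
less than one such that `1 - π P` is not invertible, whereas `1 + π Q` is its inverse
(`norm_map_le_of_quasiInverse`). On the other hand, the adjointable operators are a C⋆-algebra, in
which each element attains its norm in a representation of Gelfand, Naimark and Segal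
(`exists_rep_norm_le`). So the inclusion in `C⋆_u(X, 𝒜)` and the map to the product of all the
representations give the same norm, and extend to an isometric isomorphism of the closures
(`exists_starIso`).

The reason that `Q` is in the algebra is that the supports force its matrix to have finite
propagation. At a point `z` the entry `P x y` vanishes unless `z` is close to both `f x` and `f y`,
and for a given `z` only boundedly many points of `X` are close to `z`, because `X` has bounded
geometry and `f` is a coarse embedding. Evaluated at `z`, the identities `Q = P + P Q = P + Q P` are
thus identities of finite matrices of bounded size. They show that `Q x y` is supported near `f x`
and `f y` as well; the resolvent identity `Q(z') - Q(z) = (1 + Q(z')) (P(z') - P(z)) (1 + Q(z))`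
bounds the derivatives of `Q` by those of `P` and shows that they exist; and the powers of `P` in
row `x` only involve rows `w` with `f w` near `f x`, so that their entries all come from one
finite-dimensional space `W_n(x)`.

For these arguments the conditions on the entries have to be intrinsic, that is, stated without the
functions `T₁ x y`. A function `a` on `[0, ∞) × H` is extended to the Hilbert space `ℝ ⊕ H` by means
of the reflection `(t, v) ↦ (-t, v)` and the automorphism of the Clifford algebra that it induces
(`extHom`). Then `a` comes from a function on `ℝ × W` with bounded directional derivatives if and
only if the extension is equivariant for the isometries of `ℝ ⊕ H` that fix `W`, maps `ℝ ⊕ W` to the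
Clifford algebra of `ℝ ⊕ W` (`basedAlg`), is Lipschitz, has directional derivatives and vanishes at
infinity (`IsSmooth`). The two directions are `isSmooth_of_bott` and `exists_tensorFn`; the
conditions are visibly preserved by sums, products and adjoints.
-/

noncomputable section

namespace TwistedRoe

universe u v

set_option linter.unusedSectionVars false

/-! ### Clifford algebras -/

section CliffordHull

variable {E : Type v} [NormedAddCommGroup E] [InnerProductSpace ℝ E]

lemma cliffordVec_add (w w' : E) : cliffordVec (w + w') = cliffordVec w + cliffordVec w' :=
  Subtype.ext (funext fun ρ => by
    change ρ.hom _ = ρ.hom _ + ρ.hom _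
    rw [map_add, map_add])

lemma cliffordVec_smul (s : ℝ) (w : E) : cliffordVec (s • w) = s • cliffordVec w :=
  Subtype.ext (funext fun ρ => by
    change ρ.hom _ = s • ρ.hom _
    rw [map_smul, map_smul])

/-- The vectors of `E`, as a linear map to the complex Clifford algebra. -/
def cliffordVecₗ : E →ₗ[ℝ] CliffordHull E where
  toFun := cliffordVec
  map_add' := cliffordVec_add
  map_smul' := cliffordVec_smul

lemma cliffordVec_neg (w : E) : cliffordVec (-w) = -cliffordVec w := map_neg cliffordVecₗ w

lemma cliffordVec_sub (w w' : E) : cliffordVec (w - w') = cliffordVec w - cliffordVec w' :=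
  map_sub cliffordVecₗ w w'

lemma cliffordVec_zero : cliffordVec (0 : E) = 0 := map_zero cliffordVecₗ

lemma isSelfAdjoint_cliffordVec (w : E) : IsSelfAdjoint (cliffordVec w) :=
  Subtype.ext (funext fun ρ => ρ.selfAdjoint _)

lemma cliffordVec_mul_self (w : E) :
    cliffordVec w * cliffordVec w = (‖w‖ ^ 2) • (1 : CliffordHull E) := by
  refine Subtype.ext (funext fun ρ => ?_)
  change ρ.hom _ * ρ.hom _ = (‖w‖ ^ 2) • (1 : ρ.K →L[ℂ] ρ.K)
  rw [← map_mul, CliffordAlgebra.ι_sq_scalar, normForm_apply, AlgHom.commutes,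
    Algebra.algebraMap_eq_smul_one]

lemma cliffordVec_mul_add_swap (w w' : E) :
    cliffordVec w * cliffordVec w' + cliffordVec w' * cliffordVec w =
      (2 * ⟪w, w'⟫_ℝ) • (1 : CliffordHull E) := by
  have h := cliffordVec_mul_self (w + w')
  rw [cliffordVec_add, add_mul, mul_add, mul_add, cliffordVec_mul_self, cliffordVec_mul_self,
    norm_add_sq_real, add_smul, add_smul] at h
  rw [← sub_eq_zero] at h ⊢
  rw [← h]
  abel

lemma norm_cliffordVec_le (w : E) : ‖cliffordVec w‖ ≤ ‖w‖ := by
  have h1 := CStarRing.norm_star_mul_self (x := cliffordVec w)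
  rw [(isSelfAdjoint_cliffordVec w).star_eq, cliffordVec_mul_self] at h1
  have h2 : ‖(‖w‖ ^ 2) • (1 : CliffordHull E)‖ ≤ ‖w‖ ^ 2 := by
    rw [norm_smul]
    have : ‖(1 : CliffordHull E)‖ ≤ 1 := by
      by_cases h : Nontrivial (CliffordHull E)
      · simp
      · rw [not_nontrivial_iff_subsingleton] at h
        simp [Subsingleton.elim (1 : CliffordHull E) 0]
    simp only [norm_pow, norm_norm]
    nlinarith [sq_nonneg ‖w‖]
  nlinarith [norm_nonneg w, norm_nonneg (cliffordVec w)]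

/-- The pull-back of a representation of the Clifford algebra along a linear isometry. -/
def CliffordRep.pull (S : E ≃ₗᵢ[ℝ] E) (ρ : CliffordRep E) : CliffordRep E where
  K := ρ.K
  hom := ρ.hom.comp (CliffordAlgebra.map
    { toLinearMap := S.toLinearEquiv.toLinearMap
      map_app' := fun m => by simp [normForm_apply] })
  selfAdjoint w := by
    have h := ρ.selfAdjoint (S w)
    rwa [AlgHom.comp_apply, CliffordAlgebra.map_apply_ι]

/-- The automorphism of the complex Clifford algebra induced by a linear isometry. -/
def cliffMap (S : E ≃ₗᵢ[ℝ] E) : CliffordHull E →⋆ₐ[ℂ] CliffordHull E where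
  toFun y := ⟨fun ρ => y.1 (ρ.pull S), memℓp_infty ⟨‖y‖, by
    rintro _ ⟨ρ, rfl⟩
    exact lp.norm_apply_le_norm ENNReal.top_ne_zero y (ρ.pull S)⟩⟩
  map_one' := rfl
  map_mul' _ _ := rfl
  map_zero' := rfl
  map_add' _ _ := rfl
  commutes' _ := rfl
  map_star' _ := rfl

lemma cliffMap_cliffordVec (S : E ≃ₗᵢ[ℝ] E) (w : E) :
    cliffMap S (cliffordVec w) = cliffordVec (S w) :=
  Subtype.ext (funext fun ρ => by
    change ρ.hom (CliffordAlgebra.map _ (CliffordAlgebra.ι _ w)) = ρ.hom _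
    rw [CliffordAlgebra.map_apply_ι]
    rfl)

lemma norm_cliffMap_le (S : E ≃ₗᵢ[ℝ] E) (y : CliffordHull E) : ‖cliffMap S y‖ ≤ ‖y‖ :=
  NonUnitalStarAlgHom.norm_apply_le (cliffMap S) y

lemma cliffMap_real_smul (S : E ≃ₗᵢ[ℝ] E) (s : ℝ) (y : CliffordHull E) :
    cliffMap S (s • y) = s • cliffMap S y := rfl

/-- The complex Clifford algebra of a subspace `U` of `E`. -/
def cliffordSub (U : Submodule ℝ E) : StarSubalgebra ℂ (CliffordHull E) :=
  StarAlgebra.adjoin ℂ (cliffordVec '' (U : Set E))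

lemma cliffordVec_mem {U : Submodule ℝ E} {w : E} (h : w ∈ U) : cliffordVec w ∈ cliffordSub U :=
  StarAlgebra.subset_adjoin ℂ _ ⟨w, h, rfl⟩

lemma cliffordSub_mono {U U' : Submodule ℝ E} (h : U ≤ U') : cliffordSub U ≤ cliffordSub U' :=
  (StarAlgebra.adjoin_mono (image_mono h) : StarAlgebra.adjoin ℂ _ ≤ StarAlgebra.adjoin ℂ _)

lemma real_smul_mem {A : Type*} [CStarAlgebra A] (B : StarSubalgebra ℂ A) (s : ℝ) {y : A}
    (h : y ∈ B) : s • y ∈ B := by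
  rw [← Complex.coe_smul]
  exact B.smul_mem h _

lemma cliffMap_mem {U U' : Submodule ℝ E} (S : E ≃ₗᵢ[ℝ] E) (hS : ∀ w ∈ U, S w ∈ U')
    {y : CliffordHull E} (hy : y ∈ cliffordSub U) : cliffMap S y ∈ cliffordSub U' := by
  have : cliffordSub U ≤ (cliffordSub U').comap (cliffMap S) := by
    refine StarAlgebra.adjoin_le ?_
    rintro _ ⟨w, hw, rfl⟩
    change cliffMap S _ ∈ cliffordSub U'
    rw [cliffMap_cliffordVec]
    exact cliffordVec_mem (hS w hw)
  exact this hy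

lemma cliffMap_eq_self {U : Submodule ℝ E} (S : E ≃ₗᵢ[ℝ] E) (hS : ∀ w ∈ U, S w = w)
    {y : CliffordHull E} (hy : y ∈ cliffordSub U) : cliffMap S y = y := by
  have : cliffordSub U ≤ StarAlgHom.equalizer (cliffMap S) (StarAlgHom.id ℂ _) := by
    refine StarAlgebra.adjoin_le ?_
    rintro _ ⟨w, hw, rfl⟩
    change cliffMap S _ = _
    rw [cliffMap_cliffordVec, hS w hw]
    rfl
  exact this hy

/-- The products of the vectors of a finite set span a finite-dimensional space, because these
vectors anticommute up to scalars. -/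
lemma exists_finite_left_stable (s : Finset E) : ∃ M : Submodule ℂ (CliffordHull E),
    M.FG ∧ 1 ∈ M ∧ ∀ e ∈ s, ∀ m ∈ M, cliffordVec e * m ∈ M := by
  classical
  induction s using Finset.induction_on with
  | empty => exact
    ⟨ℂ ∙ 1, Submodule.fg_span_singleton _, Submodule.mem_span_singleton_self _, by simp⟩
  | insert e s _ ih =>
    obtain ⟨M, hfg, h1, hM⟩ := ih
    let φ : CliffordHull E →ₗ[ℂ] CliffordHull E := LinearMap.mulLeft ℂ (cliffordVec e)
    refine ⟨M ⊔ M.map φ, hfg.sup (hfg.map φ), Submodule.mem_sup_left h1, ?_⟩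
    intro e' he' m hm
    obtain ⟨m₁, hm₁, _, ⟨m₂, hm₂, rfl⟩, rfl⟩ := Submodule.mem_sup.1 hm
    change cliffordVec e' * (m₁ + cliffordVec e * m₂) ∈ _
    rw [mul_add]
    have hr : ∀ (s : ℝ) {m}, m ∈ M → s • m ∈ M := fun s m h => by
      rw [← Complex.coe_smul]; exact M.smul_mem _ h
    rcases Finset.mem_insert.1 he' with rfl | he'
    · rw [← mul_assoc, cliffordVec_mul_self, smul_mul_assoc, one_mul, add_comm]
      exact Submodule.add_mem_sup (hr _ hm₂) ⟨m₁, hm₁, rfl⟩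
    · have h := cliffordVec_mul_add_swap e' e
      have h2 : cliffordVec e' * (cliffordVec e * m₂) =
          (2 * ⟪e', e⟫_ℝ) • m₂ - cliffordVec e * (cliffordVec e' * m₂) := by
        rw [← mul_assoc, ← mul_assoc, eq_sub_iff_add_eq, ← add_mul, h, smul_mul_assoc, one_mul]
      rw [h2, add_sub_assoc', sub_eq_add_neg, ← mul_neg]
      exact Submodule.add_mem_sup (M.add_mem (hM _ he' _ hm₁) (hr _ hm₂))
        ⟨_, M.neg_mem (hM _ he' _ hm₂), rfl⟩

lemma isClosed_cliffordSub (U : Submodule ℝ E) [FiniteDimensional ℝ U] :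
    IsClosed (cliffordSub U : Set (CliffordHull E)) := by
  obtain ⟨s, hs⟩ := (Submodule.fg_iff_finiteDimensional U).2 inferInstance
  obtain ⟨M, hfg, h1, hM⟩ := exists_finite_left_stable s
  have hU : ∀ e ∈ U, ∀ m ∈ M, cliffordVec e * m ∈ M := by
    intro e he m hm
    rw [← hs] at he
    induction he using Submodule.span_induction with
    | mem e he => exact hM e he m hm
    | zero => rw [cliffordVec_zero, zero_mul]; exact M.zero_mem
    | add e e' _ _ h h' => rw [cliffordVec_add, add_mul]; exact M.add_mem h h'
    | smul r e _ h =>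
      rw [cliffordVec_smul, smul_mul_assoc, ← Complex.coe_smul]
      exact M.smul_mem _ h
  have hle : Subalgebra.toSubmodule (cliffordSub U).toSubalgebra ≤ M := by
    intro y hy
    have key : ∀ m ∈ M, y * m ∈ M := by
      change y ∈ Algebra.adjoin ℂ _ at hy
      induction hy using Algebra.adjoin_induction with
      | mem y hy =>
        rcases hy with ⟨w, hw, rfl⟩ | ⟨w, hw, hwy⟩
        · exact hU w hw
        · rw [← star_star y, ← hwy, (isSelfAdjoint_cliffordVec w).star_eq]
          exact hU w hw
      | algebraMap z =>
        intro m hm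
        rw [← Algebra.smul_def]
        exact M.smul_mem _ hm
      | add y y' _ _ h h' => exact fun m hm => by rw [add_mul]; exact M.add_mem (h m hm) (h' m hm)
      | mul y y' _ _ h h' => exact fun m hm => by rw [mul_assoc]; exact h _ (h' m hm)
    simpa using key 1 h1
  have : FiniteDimensional ℂ M := Module.Finite.iff_fg.2 hfg
  have hfd : FiniteDimensional ℂ (Subalgebra.toSubmodule (cliffordSub U).toSubalgebra) :=
    Submodule.finiteDimensional_of_le hle
  exact Submodule.closed_of_finiteDimensional
    (Subalgebra.toSubmodule (cliffordSub U).toSubalgebra)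

end CliffordHull

/-! ### Functions on `[0, ∞) × H`, extended to `ℝ ⊕ H` -/

section Extension

variable {H : Type v} [NormedAddCommGroup H] [InnerProductSpace ℝ H]

variable (H) in
/-- The Hilbert sum `ℝ ⊕ H`. -/
abbrev RealSum : Type v := WithLp 2 (ℝ × H)

/-- The vector `(t, w)` of `ℝ ⊕ H`. -/
def pt (t : ℝ) (w : H) : RealSum H := WithLp.toLp 2 (t, w)

@[simp] lemma pt_fst (t : ℝ) (w : H) : (pt t w).fst = t := rfl
@[simp] lemma pt_snd (t : ℝ) (w : H) : (pt t w).snd = w := rfl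

lemma pt_eta (z : RealSum H) : pt z.fst z.snd = z := rfl

lemma pt_add (t t' : ℝ) (w w' : H) : pt t w + pt t' w' = pt (t + t') (w + w') := rfl

lemma pt_sub (t t' : ℝ) (w w' : H) : pt t w - pt t' w' = pt (t - t') (w - w') := rfl

lemma smul_pt (s t : ℝ) (w : H) : s • pt t w = pt (s * t) (s • w) := rfl

lemma realSum_ext {z z' : RealSum H} (h : z.fst = z'.fst) (h' : z.snd = z'.snd) : z = z' := by
  rw [← pt_eta z, ← pt_eta z', h, h']

lemma norm_pt_sq (t : ℝ) (w : H) : ‖pt t w‖ ^ 2 = t ^ 2 + ‖w‖ ^ 2 := by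
  rw [WithLp.prod_norm_sq_eq_of_L2]
  simp

lemma norm_pt (t : ℝ) (w : H) : ‖pt t w‖ = √(t ^ 2 + ‖w‖ ^ 2) := by
  rw [← norm_pt_sq, Real.sqrt_sq (norm_nonneg _)]

lemma norm_fst_le (z : RealSum H) : |z.fst| ≤ ‖z‖ := by
  refine abs_le_of_sq_le_sq ?_ (norm_nonneg _)
  rw [WithLp.prod_norm_sq_eq_of_L2 z, Real.norm_eq_abs, sq_abs]
  nlinarith [sq_nonneg ‖z.snd‖]

lemma norm_snd_le (z : RealSum H) : ‖z.snd‖ ≤ ‖z‖ := by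
  refine le_of_sq_le_sq ?_ (norm_nonneg _)
  rw [WithLp.prod_norm_sq_eq_of_L2 z]
  nlinarith [sq_nonneg ‖z.fst‖]

lemma norm_le_add (z : RealSum H) : ‖z‖ ≤ |z.fst| + ‖z.snd‖ := by
  refine le_of_sq_le_sq ?_ (by positivity)
  rw [WithLp.prod_norm_sq_eq_of_L2 z, Real.norm_eq_abs]
  nlinarith [norm_nonneg z.snd, abs_nonneg z.fst]

variable (H) in
/-- The reflection `(t, w) ↦ (-t, w)`. -/
def realFlip : RealSum H ≃ₗᵢ[ℝ] RealSum H where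
  toFun z := pt (-z.fst) z.snd
  invFun z := pt (-z.fst) z.snd
  left_inv z := realSum_ext (neg_neg _) rfl
  right_inv z := realSum_ext (neg_neg _) rfl
  map_add' z z' := realSum_ext (neg_add _ _) rfl
  map_smul' s z := realSum_ext (by simp) rfl
  norm_map' z := by
    change ‖pt (-z.fst) z.snd‖ = ‖pt z.fst z.snd‖
    rw [norm_pt, norm_pt, neg_sq]

/-- Evaluation at a point of `[0, ∞) × H`. -/
def evalHom (u : ℝ≥0 × H) : BddFn H →⋆ₙₐ[ℂ] Cl H where
  toFun a := a u
  map_smul' _ _ := rfl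
  map_zero' := rfl
  map_add' _ _ := rfl
  map_mul' _ _ := rfl
  map_star' _ := rfl

/-- The value at `z` of the extension of a function on `[0, ∞) × H` to `ℝ ⊕ H`. The values at
`(t, w)` and at `(-t, w)` correspond to each other under the automorphism of the Clifford algebra
that is induced by the reflection `realFlip`. -/
def extHom (z : RealSum H) : BddFn H →⋆ₙₐ[ℂ] Cl H :=
  if 0 ≤ z.fst then evalHom (z.fst.toNNReal, z.snd)
  else (cliffMap (realFlip H)).toNonUnitalStarAlgHom.comp (evalHom ((-z.fst).toNNReal, z.snd))

lemma ext_of_nonneg {z : RealSum H} (h : 0 ≤ z.fst) (a : BddFn H) :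
    extHom z a = a (z.fst.toNNReal, z.snd) := by
  rw [extHom, if_pos h]
  rfl

lemma ext_of_neg {z : RealSum H} (h : z.fst < 0) (a : BddFn H) :
    extHom z a = cliffMap (realFlip H) (a ((-z.fst).toNNReal, z.snd)) := by
  rw [extHom, if_neg h.not_ge]
  rfl

lemma ext_pt (a : BddFn H) (u : ℝ≥0 × H) : extHom (pt u.1 u.2) a = a u := by
  rw [ext_of_nonneg (z := pt u.1 u.2) u.1.2]
  exact congrArg (fun u : ℝ≥0 × H => (a u : Cl H)) (Prod.ext Real.toNNReal_coe rfl)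

lemma norm_ext_le (z : RealSum H) (a : BddFn H) : ‖extHom z a‖ ≤ ‖a‖ :=
  NonUnitalStarAlgHom.norm_apply_le (extHom z) a

lemma continuous_ext (z : RealSum H) : Continuous (extHom z : BddFn H → Cl H) :=
  AddMonoidHomClass.continuous_of_bound (extHom z) 1 fun a => by simpa using norm_ext_le z a

lemma bddFn_ext {a b : BddFn H} (h : ∀ z, extHom z a = extHom z b) : a = b :=
  Subtype.ext (funext fun u => by
    change a u = b u
    rw [← ext_pt, ← ext_pt, h])

/-! ### The elements that come from a given subspace -/

/-- The subspace `ℝ ⊕ W` of `ℝ ⊕ H`. -/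
def cyl (W : Submodule ℝ H) : Submodule ℝ (RealSum H) where
  carrier := {z | z.snd ∈ W}
  add_mem' h h' := W.add_mem h h'
  zero_mem' := W.zero_mem
  smul_mem' s _ h := W.smul_mem s h

@[simp] lemma mem_cyl {W : Submodule ℝ H} {z : RealSum H} : z ∈ cyl W ↔ z.snd ∈ W := Iff.rfl

lemma cyl_mono {W W' : Submodule ℝ H} (h : W ≤ W') : cyl W ≤ cyl W' := fun _ hz => h hz

instance finiteDimensional_cyl (W : Submodule ℝ H) [FiniteDimensional ℝ W] :
    FiniteDimensional ℝ (cyl W) := by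
  let g : cyl W →ₗ[ℝ] ℝ × W :=
    { toFun := fun z => (z.1.fst, ⟨z.1.snd, z.2⟩)
      map_add' := fun _ _ => rfl
      map_smul' := fun _ _ => rfl }
  refine FiniteDimensional.of_injective g fun z z' h => Subtype.ext (realSum_ext ?_ ?_)
  · exact congrArg (fun q : ℝ × W => q.1) h
  · exact congrArg (fun q : ℝ × W => (q.2 : H)) h

/-- The elements of the limit algebra that come from `W`. Their extension to `ℝ ⊕ H` is equivariant
for the isometries of `ℝ ⊕ H` that fix `W`, and it maps `ℝ ⊕ W` to the Clifford algebra of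
`ℝ ⊕ W`. -/
def basedAlg (W : Submodule ℝ H) : NonUnitalStarSubalgebra ℂ (BddFn H) where
  carrier := {a | (∀ S : RealSum H ≃ₗᵢ[ℝ] RealSum H, (∀ w ∈ W, S (pt 0 w) = pt 0 w) →
      ∀ z, extHom (S z) a = cliffMap S (extHom z a)) ∧
    ∀ z ∈ cyl W, extHom z a ∈ cliffordSub (cyl W)}
  zero_mem' := by
    refine ⟨fun S _ z => ?_, fun z _ => ?_⟩
    · simp only [map_zero]
    · rw [map_zero]
      exact zero_mem _
  add_mem' := by
    rintro a b ⟨h1, h2⟩ ⟨h1', h2'⟩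
    refine ⟨fun S hS z => ?_, fun z hz => ?_⟩
    · simp only [map_add, h1 S hS, h1' S hS]
    · rw [map_add]
      exact add_mem (h2 z hz) (h2' z hz)
  mul_mem' := by
    rintro a b ⟨h1, h2⟩ ⟨h1', h2'⟩
    refine ⟨fun S hS z => ?_, fun z hz => ?_⟩
    · simp only [map_mul, h1 S hS, h1' S hS]
    · rw [map_mul]
      exact mul_mem (h2 z hz) (h2' z hz)
  smul_mem' := by
    rintro c a ⟨h1, h2⟩
    refine ⟨fun S hS z => ?_, fun z hz => ?_⟩
    · simp only [map_smul, h1 S hS]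
    · rw [map_smul]
      exact (cliffordSub (cyl W)).smul_mem (h2 z hz) c
  star_mem' := by
    rintro a ⟨h1, h2⟩
    refine ⟨fun S hS z => ?_, fun z hz => ?_⟩
    · simp only [map_star, h1 S hS]
    · rw [map_star]
      exact star_mem (h2 z hz)

lemma continuous_cliffMap (S : RealSum H ≃ₗᵢ[ℝ] RealSum H) : Continuous (cliffMap S) :=
  AddMonoidHomClass.continuous_of_bound (cliffMap S) 1 fun a => by
    simpa using norm_cliffMap_le S a

lemma isClosed_basedAlg (W : Submodule ℝ H) [FiniteDimensional ℝ W] :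
    IsClosed (basedAlg W : Set (BddFn H)) := by
  have : (basedAlg W : Set (BddFn H)) =
      (⋂ S : RealSum H ≃ₗᵢ[ℝ] RealSum H, ⋂ _ : ∀ w ∈ W, S (pt 0 w) = pt 0 w, ⋂ z,
        {a | extHom (S z) a = cliffMap S (extHom z a)}) ∩
      ⋂ z ∈ cyl W, {a | extHom z a ∈ cliffordSub (cyl W)} := by
    ext a
    simp only [mem_inter_iff, mem_iInter]
    rfl
  rw [this]
  refine IsClosed.inter ?_ ?_
  · exact isClosed_iInter fun S => isClosed_iInter fun _ => isClosed_iInter fun z =>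
      isClosed_eq (continuous_ext _) ((continuous_cliffMap S).comp (continuous_ext z))
  · exact isClosed_biInter fun z _ =>
      (isClosed_cliffordSub (cyl W)).preimage (continuous_ext z)

/-- The reflection that takes `(r, p)` to `z`, for `p` the projection of `z` to `W` and `r` the
distance of `z` to `p`. -/
lemma exists_isometry (W : Submodule ℝ H) [W.HasOrthogonalProjection] (z : RealSum H) :
    ∃ S : RealSum H ≃ₗᵢ[ℝ] RealSum H, (∀ w ∈ W, S (pt 0 w) = pt 0 w) ∧
      S (pt ‖pt z.fst (z.snd - W.starProjection z.snd)‖ 0) =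
        pt z.fst (z.snd - W.starProjection z.snd) ∧
      S (pt ‖pt z.fst (z.snd - W.starProjection z.snd)‖ (W.starProjection z.snd)) = z ∧
      ∀ W' : Submodule ℝ H, W ≤ W' → z.snd ∈ W' → ∀ z' ∈ cyl W', S z' ∈ cyl W' := by
  set p := W.starProjection z.snd with hp
  set v := pt z.fst (z.snd - p) with hv
  have hnorm : ‖pt ‖v‖ (0 : H)‖ = ‖v‖ := by
    rw [norm_pt]; simp
  set S := Submodule.reflection (ℝ ∙ (pt ‖v‖ (0 : H) - v))ᗮ with hSdef
  have hfix : ∀ w ∈ W, S (pt 0 w) = pt 0 w := fun w hw => by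
    refine Submodule.reflection_mem_subspace_eq_self ?_
    rw [Submodule.mem_orthogonal_singleton_iff_inner_right, WithLp.prod_inner_apply]
    have : ⟪z.snd - p, w⟫_ℝ = 0 := Submodule.starProjection_inner_eq_zero _ _ hw
    simp [hv, pt, WithLp.ofLp_toLp, inner_sub_left] at this ⊢
    linarith
  have hv' : S (pt ‖v‖ 0) = v := Submodule.reflection_sub hnorm
  refine ⟨S, hfix, hv', ?_, ?_⟩
  · have : pt ‖v‖ p = pt ‖v‖ 0 + pt 0 p := by rw [pt_add]; simp
    rw [this, map_add, hv', hfix p (Submodule.starProjection_apply_mem _ _), hv, pt_add]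
    simp [pt_eta]
  · intro W' hW hz z' hz'
    have hu : (ℝ ∙ (pt ‖v‖ (0 : H) - v)) ≤ cyl W' := by
      rw [Submodule.span_singleton_le_iff_mem, mem_cyl, hv, pt_sub, pt_snd]
      refine W'.sub_mem W'.zero_mem (W'.sub_mem hz (hW ?_))
      exact Submodule.starProjection_apply_mem _ _
    rw [hSdef, Submodule.reflection_orthogonal_apply, Submodule.reflection_apply]
    refine (cyl W').neg_mem ((cyl W').sub_mem ?_ hz')
    rw [two_nsmul]
    have h := hu (Submodule.starProjection_apply_mem _ z')
    exact (cyl W').add_mem h h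

lemma basedAlg_mono {W W' : Submodule ℝ H} [W.HasOrthogonalProjection] (h : W ≤ W') :
    basedAlg W ≤ basedAlg W' := by
  rintro a ⟨h1, h2⟩
  refine ⟨fun S hS => h1 S fun w hw => hS w (h hw), fun z hz => ?_⟩
  obtain ⟨S, hfix, -, hS, hmap⟩ := exists_isometry W z
  have := h1 S hfix (pt ‖pt z.fst (z.snd - W.starProjection z.snd)‖ (W.starProjection z.snd))
  rw [hS] at this
  rw [this]
  refine cliffMap_mem S (hmap W' h hz) (cliffordSub_mono (cyl_mono h) (h2 _ ?_))
  exact Submodule.starProjection_apply_mem _ _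

/-! ### Lipschitz functions with directional derivatives -/

/-- The extension of `a` to `ℝ ⊕ H` is `L`-Lipschitz, has directional derivatives and vanishes at
infinity. -/
structure IsSmooth (L : ℝ) (a : BddFn H) : Prop where
  lip : ∀ z z', ‖extHom z a - extHom z' a‖ ≤ L * ‖z - z'‖
  lineDiff : ∀ z Y, LineDifferentiableAt ℝ (fun z => extHom z a) z Y
  tendsto_zero : Tendsto (fun z => extHom z a) (Bornology.cobounded (RealSum H)) (𝓝 0)

namespace IsSmooth

variable {L L' : ℝ} {a b : BddFn H}

lemma mono (h : IsSmooth L a) (hL : L ≤ L') : IsSmooth L' a where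
  lip z z' := (h.lip z z').trans (by gcongr)
  lineDiff := h.lineDiff
  tendsto_zero := h.tendsto_zero

protected lemma zero : IsSmooth 0 (0 : BddFn H) where
  lip z z' := by simp
  lineDiff z Y := by
    simp only [map_zero]
    exact differentiableAt_const _
  tendsto_zero := by
    simp only [map_zero]
    exact tendsto_const_nhds

protected lemma add (h : IsSmooth L a) (h' : IsSmooth L' b) : IsSmooth (L + L') (a + b) where
  lip z z' := by
    rw [map_add, map_add, add_sub_add_comm, add_mul]
    exact (norm_add_le _ _).trans (add_le_add (h.lip z z') (h'.lip z z'))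
  lineDiff z Y := by
    simp only [map_add]
    exact DifferentiableAt.add (h.lineDiff z Y) (h'.lineDiff z Y)
  tendsto_zero := by
    simpa only [map_add, add_zero] using h.tendsto_zero.add h'.tendsto_zero

protected lemma sum {ι : Type*} (s : Finset ι) {a : ι → BddFn H}
    (h : ∀ i ∈ s, IsSmooth L (a i)) : IsSmooth (s.card * L) (∑ i ∈ s, a i) := by
  classical
  induction s using Finset.induction_on with
  | empty => simpa using IsSmooth.zero
  | insert i s hi ih =>
    rw [Finset.sum_insert hi, Finset.card_insert_of_notMem hi]
    refine ((h i (by simp)).add (ih fun j hj => h j (by simp [hj]))).mono ?_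
    push_cast
    linarith

protected lemma smul (h : IsSmooth L a) (c : ℂ) : IsSmooth (‖c‖ * L) (c • a) where
  lip z z' := by
    rw [map_smul, map_smul, ← smul_sub, norm_smul, mul_assoc]
    exact mul_le_mul_of_nonneg_left (h.lip z z') (norm_nonneg c)
  lineDiff z Y := by
    simp only [map_smul]
    exact DifferentiableAt.const_smul (h.lineDiff z Y) c
  tendsto_zero := by
    simpa only [map_smul, smul_zero] using h.tendsto_zero.const_smul c

protected lemma star (h : IsSmooth L a) : IsSmooth L (star a) where
  lip z z' := by
    rw [map_star, map_star, ← star_sub, norm_star]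
    exact h.lip z z'
  lineDiff z Y := by
    simp only [map_star]
    exact DifferentiableAt.star (h.lineDiff z Y)
  tendsto_zero := by
    simpa only [map_star, star_zero] using h.tendsto_zero.star

protected lemma mul {M M' : ℝ} (h : IsSmooth L a) (h' : IsSmooth L' b) (hM : ‖a‖ ≤ M)
    (hM' : ‖b‖ ≤ M') : IsSmooth (L * M' + M * L') (a * b) where
  lip z z' := by
    have h0 : 0 ≤ L * ‖z - z'‖ := (norm_nonneg _).trans (h.lip z z')
    have h0' : 0 ≤ L' * ‖z - z'‖ := (norm_nonneg _).trans (h'.lip z z')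
    have hb : ‖extHom z b‖ ≤ M' := (norm_ext_le z b).trans hM'
    have ha : ‖extHom z' a‖ ≤ M := (norm_ext_le z' a).trans hM
    rw [map_mul, map_mul]
    calc ‖extHom z a * extHom z b - extHom z' a * extHom z' b‖
        = ‖(extHom z a - extHom z' a) * extHom z b + extHom z' a * (extHom z b - extHom z' b)‖ := by
          congr 1; noncomm_ring
      _ ≤ ‖extHom z a - extHom z' a‖ * ‖extHom z b‖ + ‖extHom z' a‖ * ‖extHom z b - extHom z' b‖ :=
          (norm_add_le _ _).trans (add_le_add (norm_mul_le _ _) (norm_mul_le _ _))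
      _ ≤ (L * ‖z - z'‖) * M' + M * (L' * ‖z - z'‖) :=
          add_le_add (mul_le_mul (h.lip z z') hb (norm_nonneg _) h0)
            (mul_le_mul ha (h'.lip z z') (norm_nonneg _) ((norm_nonneg _).trans ha))
      _ = _ := by ring
  lineDiff z Y := by
    simp only [map_mul]
    exact DifferentiableAt.mul (h.lineDiff z Y) (h'.lineDiff z Y)
  tendsto_zero := by
    simp only [map_mul]
    exact h.tendsto_zero.zero_mul_isBoundedUnder_le
      (isBoundedUnder_of ⟨‖b‖, fun z => norm_ext_le z b⟩)

end IsSmooth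

end Extension

/-! ### Regular functions on `ℝ × W` and their images in the limit algebra -/

section Tensor

variable {H : Type v} [NormedAddCommGroup H] [InnerProductSpace ℝ H]

lemma foot_toAffineSubspace (W : Submodule ℝ H) [W.HasOrthogonalProjection] (w : H) :
    foot W.toAffineSubspace w = W.starProjection w := by
  have h : ∃ p ∈ W.toAffineSubspace, w - p ∈ W.toAffineSubspace.directionᗮ := by
    refine ⟨W.starProjection w, Submodule.starProjection_apply_mem _ _, ?_⟩
    rw [Submodule.toAffineSubspace_direction]
    exact Submodule.sub_starProjection_mem_orthogonal w
  rw [foot, dif_pos h]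
  have h2 := h.choose_spec
  generalize h.choose = p at h2
  rw [Submodule.toAffineSubspace_direction] at h2
  exact (Submodule.eq_starProjection_of_mem_orthogonal h2.1 h2.2).symm

/-- The subspace `0 ⊕ W` of `ℝ ⊕ H`. -/
def base (W : Submodule ℝ H) : Submodule ℝ (RealSum H) where
  carrier := {z | z.fst = 0 ∧ z.snd ∈ W}
  add_mem' h h' := ⟨by rw [WithLp.add_fst, h.1, h'.1, add_zero], W.add_mem h.2 h'.2⟩
  zero_mem' := ⟨rfl, W.zero_mem⟩
  smul_mem' s _ h := ⟨by rw [WithLp.smul_fst, h.1, smul_zero], W.smul_mem s h.2⟩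

lemma cliff_eq (W : Submodule ℝ H) : cliff W = cliffordSub (base W) := by
  have : cvec 0 '' (W : Set H) = cliffordVec '' (base W : Set (RealSum H)) := by
    ext y
    constructor
    · rintro ⟨w, hw, rfl⟩
      exact ⟨pt 0 w, ⟨rfl, hw⟩, rfl⟩
    · rintro ⟨z, hz, rfl⟩
      refine ⟨z.snd, hz.2, ?_⟩
      change cliffordVec (pt 0 z.snd) = _
      rw [← hz.1, pt_eta]
  rw [cliff, cliffordSub, this]

lemma cliff_le (W : Submodule ℝ H) : cliff W ≤ cliffordSub (cyl W) := by
  rw [cliff_eq]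
  exact cliffordSub_mono fun z hz => hz.2

lemma cliffMap_cliff {W : Submodule ℝ H} {S : RealSum H ≃ₗᵢ[ℝ] RealSum H}
    (hS : ∀ w ∈ W, S (pt 0 w) = pt 0 w) {y : Cl H} (hy : y ∈ cliff W) : cliffMap S y = y := by
  rw [cliff_eq] at hy
  refine cliffMap_eq_self S (fun z hz => ?_) hy
  have := hS z.snd hz.2
  rwa [← hz.1, pt_eta] at this

/-- The component of `z` orthogonal to `0 ⊕ W`. -/
def perp (W : Submodule ℝ H) [W.HasOrthogonalProjection] : RealSum H →ₗ[ℝ] RealSum H where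
  toFun z := pt z.fst (z.snd - W.starProjection z.snd)
  map_add' z z' := by
    rw [pt_add, WithLp.add_fst, WithLp.add_snd, map_add, add_sub_add_comm]
  map_smul' s z := by
    rw [RingHom.id_apply, smul_pt, WithLp.smul_fst, WithLp.smul_snd, map_smul, smul_sub,
      smul_eq_mul]

lemma perp_apply (W : Submodule ℝ H) [W.HasOrthogonalProjection] (z : RealSum H) :
    perp W z = pt z.fst (z.snd - W.starProjection z.snd) := rfl

lemma perp_add_pt (W : Submodule ℝ H) [W.HasOrthogonalProjection] (z : RealSum H) :
    perp W z + pt 0 (W.starProjection z.snd) = z := by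
  rw [perp_apply, pt_add]
  exact realSum_ext (add_zero _) (sub_add_cancel _ _)

lemma norm_starProjection_snd_le (W : Submodule ℝ H) [W.HasOrthogonalProjection] (z : RealSum H) :
    ‖W.starProjection z.snd‖ ≤ ‖z‖ :=
  (Submodule.norm_starProjection_apply_le _ _).trans (norm_snd_le z)

lemma norm_pt_zero (w : H) : ‖pt 0 w‖ = ‖w‖ := by
  rw [norm_pt]; simp

lemma norm_perp_le (W : Submodule ℝ H) [W.HasOrthogonalProjection] (z : RealSum H) :
    ‖perp W z‖ ≤ 2 * ‖z‖ := by
  rw [eq_sub_of_add_eq (perp_add_pt W z)]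
  refine (norm_sub_le _ _).trans ?_
  rw [norm_pt_zero]
  linarith [norm_starProjection_snd_le W z]

lemma perp_isometry {W : Submodule ℝ H} [W.HasOrthogonalProjection]
    {S : RealSum H ≃ₗᵢ[ℝ] RealSum H} (hS : ∀ w ∈ W, S (pt 0 w) = pt 0 w) (z : RealSum H) :
    W.starProjection (S z).snd = W.starProjection z.snd ∧ perp W (S z) = S (perp W z) := by
  set p := W.starProjection z.snd with hp
  have hpW : p ∈ W := Submodule.starProjection_apply_mem _ _
  have hz : S z = S (perp W z) + pt 0 p := by
    rw [← hS p hpW, ← map_add, perp_add_pt]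
  have horth : (S (perp W z)).snd ∈ Wᗮ := by
    rw [Submodule.mem_orthogonal']
    intro w hw
    have h1 : ⟪S (perp W z), S (pt 0 w)⟫_ℝ = ⟪perp W z, pt 0 w⟫_ℝ := S.inner_map_map _ _
    rw [hS w hw, WithLp.prod_inner_apply, WithLp.prod_inner_apply] at h1
    have h2 : ⟪z.snd - p, w⟫_ℝ = 0 := Submodule.starProjection_inner_eq_zero _ _ hw
    have h3 : ⟪(perp W z).snd, w⟫_ℝ = 0 := h2
    simpa [pt, h3] using h1
  have hproj : W.starProjection (S z).snd = p := by
    refine Submodule.eq_starProjection_of_mem_orthogonal hpW ?_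
    rw [hz, WithLp.add_snd, pt_snd, add_sub_cancel_right]
    exact horth
  refine ⟨hproj, ?_⟩
  have h1 := perp_add_pt W (S z)
  rw [hproj, hz] at h1
  rw [hz]
  exact add_right_cancel h1

/-- The image of `G` in the limit algebra, as a function on `ℝ ⊕ H`. -/
def bottExt (W : Submodule ℝ H) [W.HasOrthogonalProjection] (G : ℝ × H → Cl H) (z : RealSum H) :
    Cl H :=
  evenPart G ‖perp W z‖ (W.starProjection z.snd) +
    (‖perp W z‖⁻¹ • cliffordVec (perp W z)) * oddPart G ‖perp W z‖ (W.starProjection z.snd)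

section Forward

variable {W : Submodule ℝ H} [W.HasOrthogonalProjection] {G : ℝ × H → Cl H}

lemma evenPart_mem (hG : IsTensorFn W.toAffineSubspace G) (t : ℝ) {p : H} (hp : p ∈ W) :
    evenPart G t p ∈ cliff W := by
  have h := fun t => hG.mem_cliff t p hp
  rw [Submodule.toAffineSubspace_direction] at h
  exact real_smul_mem _ _ (add_mem (h _) (h _))

lemma oddPart_mem (hG : IsTensorFn W.toAffineSubspace G) (t : ℝ) {p : H} (hp : p ∈ W) :
    oddPart G t p ∈ cliff W := by
  have h := fun t => hG.mem_cliff t p hp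
  rw [Submodule.toAffineSubspace_direction] at h
  exact real_smul_mem _ _ (sub_mem (h _) (h _))

lemma bottExt_isometry (hG : IsTensorFn W.toAffineSubspace G)
    {S : RealSum H ≃ₗᵢ[ℝ] RealSum H} (hS : ∀ w ∈ W, S (pt 0 w) = pt 0 w) (z : RealSum H) :
    bottExt W G (S z) = cliffMap S (bottExt W G z) := by
  have hpW : W.starProjection z.snd ∈ W := Submodule.starProjection_apply_mem _ _
  rw [bottExt, bottExt, (perp_isometry hS z).1, (perp_isometry hS z).2, S.norm_map, map_add,
    map_mul, cliffMap_real_smul, cliffMap_cliffordVec, cliffMap_cliff hS (evenPart_mem hG _ hpW),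
    cliffMap_cliff hS (oddPart_mem hG _ hpW)]

lemma bott_eq_bottExt (u : ℝ≥0 × H) :
    bott W.toAffineSubspace G u = bottExt W G (pt u.1 u.2) := by
  have h : √((u.1 : ℝ) ^ 2 + ‖u.2 - W.starProjection u.2‖ ^ 2) = ‖perp W (pt u.1 u.2)‖ := by
    rw [perp_apply, norm_pt]
    rfl
  rw [bott, bottExt, foot_toAffineSubspace, h]
  rfl

/-- The formula for the Bott map holds on all of `ℝ ⊕ H`, as both sides are equivariant for the
reflection `(t, w) ↦ (-t, w)`. -/
lemma extHom_eq_bottExt (hG : IsTensorFn W.toAffineSubspace G) {a : BddFn H}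
    (ha : ∀ u, a u = bott W.toAffineSubspace G u) (z : RealSum H) :
    extHom z a = bottExt W G z := by
  have key : ∀ z : RealSum H, 0 ≤ z.fst → extHom z a = bottExt W G z := fun z hz => by
    rw [ext_of_nonneg hz, ha, bott_eq_bottExt]
    congr 1
    exact realSum_ext (Real.coe_toNNReal _ hz) rfl
  rcases le_or_gt 0 z.fst with hz | hz
  · exact key z hz
  · have h1 := key (realFlip H z) (neg_nonneg.2 hz.le)
    have h2 : extHom (realFlip H z) a = a ((-z.fst).toNNReal, z.snd) :=
      ext_of_nonneg (z := realFlip H z) (neg_nonneg.2 hz.le) a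
    have h3 : realFlip H (realFlip H z) = z := realSum_ext (neg_neg _) rfl
    rw [ext_of_neg hz, ← h2, h1, ← bottExt_isometry hG, h3]
    exact fun w _ => realSum_ext neg_zero rfl

/-- The isometries fixing `W` act on the Bott element through their action on `perp W z`, and fix
the Clifford algebra of `W`. -/
lemma mem_basedAlg_of_bott (hG : IsTensorFn W.toAffineSubspace G) {a : BddFn H}
    (ha : ∀ u, a u = bott W.toAffineSubspace G u) : a ∈ basedAlg W := by
  refine ⟨fun S hS z => ?_, fun z hz => ?_⟩
  · rw [extHom_eq_bottExt hG ha, extHom_eq_bottExt hG ha, bottExt_isometry hG hS]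
  · rw [extHom_eq_bottExt hG ha]
    have hpW : W.starProjection z.snd ∈ W := Submodule.starProjection_apply_mem _ _
    refine add_mem (cliff_le W (evenPart_mem hG _ hpW))
      (mul_mem (real_smul_mem _ _ (cliffordVec_mem ?_)) (cliff_le W (oddPart_mem hG _ hpW)))
    exact W.sub_mem hz hpW

end Forward

/-! ### Smoothness of the image of a smooth function -/

lemma norm_mul_norm_inv_smul_sub_le {F : Type*} [NormedAddCommGroup F] [NormedSpace ℝ F]
    (v v' : F) : ‖v'‖ * ‖‖v‖⁻¹ • v - ‖v'‖⁻¹ • v'‖ ≤ 2 * ‖v - v'‖ := by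
  rcases eq_or_ne v' 0 with rfl | h'
  · simp
  rcases eq_or_ne v 0 with rfl | h
  · simp [norm_smul, h']
  have hv : ‖v‖ ≠ 0 := norm_ne_zero_iff.2 h
  have hv' : ‖v'‖ ≠ 0 := norm_ne_zero_iff.2 h'
  have e : ‖v'‖ • (‖v‖⁻¹ • v - ‖v'‖⁻¹ • v') = ((‖v'‖ - ‖v‖) * ‖v‖⁻¹) • v + (v - v') := by
    rw [smul_sub, smul_smul, smul_smul, mul_inv_cancel₀ hv', one_smul, sub_mul,
      mul_inv_cancel₀ hv, sub_smul, one_smul]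
    abel
  calc ‖v'‖ * ‖‖v‖⁻¹ • v - ‖v'‖⁻¹ • v'‖ = ‖‖v'‖ • (‖v‖⁻¹ • v - ‖v'‖⁻¹ • v')‖ := by
        rw [norm_smul, norm_norm]
    _ ≤ ‖((‖v'‖ - ‖v‖) * ‖v‖⁻¹) • v‖ + ‖v - v'‖ := by rw [e]; exact norm_add_le _ _
    _ = |‖v'‖ - ‖v‖| + ‖v - v'‖ := by
        rw [norm_smul, norm_mul, norm_inv, norm_norm, mul_assoc, inv_mul_cancel₀ hv, mul_one,
          Real.norm_eq_abs]
    _ ≤ _ := by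
        have := abs_norm_sub_norm_le v' v
        rw [norm_sub_rev] at this
        linarith

lemma eq_zero_of_eq_neg {A : Type*} [AddCommGroup A] [Module ℝ A] {x : A} (h : x = -x) : x = 0 := by
  have h2 : (2 : ℝ) • x = 0 := by
    rw [two_smul]
    nth_rewrite 1 [h]
    exact neg_add_cancel x
  simpa using h2

/-- A Lipschitz function with directional derivatives is differentiable along curves. -/
lemma differentiableAt_comp_curve {A : Type*} [NormedAddCommGroup A] [NormedSpace ℝ A]
    {F : ℝ → ℝ → A} {r : ℝ → ℝ} {ρ K : ℝ} (hr : HasDerivAt r ρ 0)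
    (hF : ∀ t t' h, ‖F t h - F t' h‖ ≤ K * |t - t'|)
    (hd : DifferentiableAt ℝ (fun h => F (r 0 + h * ρ) h) 0) :
    DifferentiableAt ℝ (fun h => F (r h) h) 0 := by
  have h1 : HasDerivAt (fun h => F (r h) h - F (r 0 + h * ρ) h) 0 0 := by
    rw [hasDerivAt_iff_isLittleO] at hr ⊢
    refine Asymptotics.IsBigO.trans_isLittleO ?_ hr
    refine Asymptotics.IsBigO.of_bound K (Eventually.of_forall fun h => ?_)
    simp only [zero_mul, add_zero, sub_self, sub_zero, smul_zero, smul_eq_mul, Real.norm_eq_abs]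
    rw [sub_sub]
    exact hF _ _ _
  have := h1.differentiableAt.add hd
  refine this.congr_of_eventuallyEq (Eventually.of_forall fun h => ?_)
  exact (sub_add_cancel _ _).symm

/-- A family of values on `ℝ × W` that is Lipschitz and has directional derivatives. -/
structure IsLipDiff (W : Submodule ℝ H) (K : ℝ) (e : ℝ → H → Cl H) : Prop where
  lip : ∀ t t', ∀ p ∈ W, ∀ p' ∈ W, ‖e t p - e t' p'‖ ≤ K * ‖pt t p - pt t' p'‖
  diff : ∀ t s, ∀ p ∈ W, ∀ y ∈ W, DifferentiableAt ℝ (fun h : ℝ => e (t + h * s) (p + h • y)) 0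

section Smooth

variable {W : Submodule ℝ H} [W.HasOrthogonalProjection] {K : ℝ} {e : ℝ → H → Cl H}

lemma IsLipDiff.lip_perp (h : IsLipDiff W K e) (hK : 0 ≤ K) (z z' : RealSum H) :
    ‖e ‖perp W z‖ (W.starProjection z.snd) - e ‖perp W z'‖ (W.starProjection z'.snd)‖ ≤
      3 * K * ‖z - z'‖ := by
  refine (h.lip _ _ _ (Submodule.starProjection_apply_mem _ _) _
    (Submodule.starProjection_apply_mem _ _)).trans ?_
  rw [mul_comm 3 K, mul_assoc]
  refine mul_le_mul_of_nonneg_left ?_ hK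
  refine (norm_le_add _).trans ?_
  rw [pt_sub, pt_fst, pt_snd, ← map_sub, ← WithLp.sub_snd]
  have h1 := norm_starProjection_snd_le W (z - z')
  have h2 := (abs_norm_sub_norm_le (perp W z) (perp W z')).trans
    ((congrArg norm (map_sub (perp W) z z').symm).le.trans (norm_perp_le W (z - z')))
  have h3 : ‖W.starProjection (z - z').snd‖ ≤ ‖z - z'‖ := h1
  linarith

lemma IsLipDiff.lip_left (h : IsLipDiff W K e) (t t' : ℝ) {p : H} (hp : p ∈ W) :
    ‖e t p - e t' p‖ ≤ K * |t - t'| := by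
  refine (h.lip t t' p hp p hp).trans_eq ?_
  rw [pt_sub, sub_self, norm_pt, norm_zero, zero_pow two_ne_zero, add_zero, Real.sqrt_sq_eq_abs]

/-- Away from `0 ⊕ W`, the radius is a differentiable function. -/
lemma IsLipDiff.diff_perp (h : IsLipDiff W K e) {z : RealSum H} (hz : perp W z ≠ 0)
    (Y : RealSum H) :
    DifferentiableAt ℝ (fun s : ℝ => e ‖perp W (z + s • Y)‖
      (W.starProjection (z + s • Y).snd)) 0 := by
  have hr : DifferentiableAt ℝ (fun s : ℝ => ‖perp W z + s • perp W Y‖) 0 := by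
    refine DifferentiableAt.norm ℝ (by fun_prop) ?_
    simpa using hz
  have hp : W.starProjection z.snd ∈ W := Submodule.starProjection_apply_mem _ _
  have hy : W.starProjection Y.snd ∈ W := Submodule.starProjection_apply_mem _ _
  have := differentiableAt_comp_curve (F := fun t s => e t
    (W.starProjection z.snd + s • W.starProjection Y.snd)) (K := K) hr.hasDerivAt
    (fun t t' s => h.lip_left t t' (W.add_mem hp (W.smul_mem s hy))) (h.diff _ _ _ hp _ hy)
  simpa only [map_add, map_smul, WithLp.add_snd, WithLp.smul_snd] using this

lemma abs_mul_even (he : ∀ t p, e (-t) p = e t p) (s k : ℝ) (p : H) :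
    e (|s| * k) p = e (s * k) p := by
  rcases abs_choice s with h | h <;> rw [h]
  rw [neg_mul, he]

lemma inv_mul_odd {A : Type*} [NormedRing A] [NormedAlgebra ℝ A] {o : ℝ → A}
    (ho : ∀ t, o (-t) = - o t) (s k : ℝ) :
    ((|s| * k)⁻¹ * s) • o (|s| * k) = k⁻¹ • o (s * k) := by
  have h0 : o 0 = 0 := by
    have := ho 0
    rw [neg_zero] at this
    exact eq_zero_of_eq_neg this
  rcases lt_trichotomy s 0 with h | rfl | h
  · rw [abs_of_neg h, neg_mul, ho, inv_neg, neg_mul, neg_smul_neg]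
    congr 1
    field_simp [h.ne]
  · simp [h0]
  · rw [abs_of_pos h]
    congr 1
    field_simp

end Smooth

/-- For `o` odd, `‖v‖⁻¹ v * o ‖v‖` is Lipschitz and has directional derivatives, also at `v = 0`,
although `‖v‖⁻¹ v` is singular there. -/
lemma isSmooth_bottExt {W : Submodule ℝ H} [W.HasOrthogonalProjection] {K : ℝ} (hK : 0 ≤ K)
    {e o : ℝ → H → Cl H} (he : IsLipDiff W K e) (ho : IsLipDiff W K o)
    (heven : ∀ t p, e (-t) p = e t p) (hodd : ∀ t p, o (-t) p = - o t p) :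
    let Φ : RealSum H → Cl H := fun z => e ‖perp W z‖ (W.starProjection z.snd) +
      (‖perp W z‖⁻¹ • cliffordVec (perp W z)) * o ‖perp W z‖ (W.starProjection z.snd)
    (∀ z z', ‖Φ z - Φ z'‖ ≤ 10 * K * ‖z - z'‖) ∧ ∀ z Y, LineDifferentiableAt ℝ Φ z Y := by
  intro Φ
  have hp : ∀ z : RealSum H, W.starProjection z.snd ∈ W :=
    fun z => Submodule.starProjection_apply_mem _ _
  have hunit : ∀ z : RealSum H, ‖‖perp W z‖⁻¹ • cliffordVec (perp W z)‖ ≤ 1 := fun z => by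
    rw [norm_smul, norm_inv, norm_norm]
    refine (mul_le_mul_of_nonneg_left (norm_cliffordVec_le _) (by positivity)).trans ?_
    exact inv_mul_le_one
  have ho0 : ∀ p, o 0 p = 0 := fun p => by
    have := hodd 0 p
    rw [neg_zero] at this
    exact eq_zero_of_eq_neg this
  constructor
  · intro z z'
    have h1 := he.lip_perp hK z z'
    have h2 := ho.lip_perp hK z z'
    have h3 : ‖o ‖perp W z'‖ (W.starProjection z'.snd)‖ ≤ K * ‖perp W z'‖ := by
      have := ho.lip_left ‖perp W z'‖ 0 (hp z')
      simpa [ho0] using this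
    have h4 : ‖‖perp W z‖⁻¹ • cliffordVec (perp W z) -
        ‖perp W z'‖⁻¹ • cliffordVec (perp W z')‖ ≤
        ‖‖perp W z‖⁻¹ • perp W z - ‖perp W z'‖⁻¹ • perp W z'‖ := by
      rw [← cliffordVec_smul, ← cliffordVec_smul, ← cliffordVec_sub]
      exact norm_cliffordVec_le _
    have h5 := norm_mul_norm_inv_smul_sub_le (perp W z) (perp W z')
    have h6 : ‖perp W z - perp W z'‖ ≤ 2 * ‖z - z'‖ := by
      rw [← map_sub]; exact norm_perp_le W _
    have e1 : Φ z - Φ z' = (e ‖perp W z‖ (W.starProjection z.snd) -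
          e ‖perp W z'‖ (W.starProjection z'.snd)) +
        ((‖perp W z‖⁻¹ • cliffordVec (perp W z)) * (o ‖perp W z‖ (W.starProjection z.snd) -
          o ‖perp W z'‖ (W.starProjection z'.snd)) +
        (‖perp W z‖⁻¹ • cliffordVec (perp W z) - ‖perp W z'‖⁻¹ • cliffordVec (perp W z')) *
          o ‖perp W z'‖ (W.starProjection z'.snd)) := by
      simp only [Φ, mul_sub, sub_mul]
      abel
    rw [e1]
    refine (norm_add_le _ _).trans ?_
    have h7 := norm_add_le ((‖perp W z‖⁻¹ • cliffordVec (perp W z)) *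
        (o ‖perp W z‖ (W.starProjection z.snd) - o ‖perp W z'‖ (W.starProjection z'.snd)))
      ((‖perp W z‖⁻¹ • cliffordVec (perp W z) - ‖perp W z'‖⁻¹ • cliffordVec (perp W z')) *
          o ‖perp W z'‖ (W.starProjection z'.snd))
    have h8 := (norm_mul_le (‖perp W z‖⁻¹ • cliffordVec (perp W z))
        (o ‖perp W z‖ (W.starProjection z.snd) - o ‖perp W z'‖ (W.starProjection z'.snd))).trans
        (mul_le_mul (hunit z) h2 (norm_nonneg _) zero_le_one)
    have h9 := (norm_mul_le (‖perp W z‖⁻¹ • cliffordVec (perp W z) -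
        ‖perp W z'‖⁻¹ • cliffordVec (perp W z')) (o ‖perp W z'‖ (W.starProjection z'.snd))).trans
        (mul_le_mul h4 h3 (norm_nonneg _) (norm_nonneg _))
    have h10 : ‖‖perp W z‖⁻¹ • perp W z - ‖perp W z'‖⁻¹ • perp W z'‖ * (K * ‖perp W z'‖) ≤
        K * (4 * ‖z - z'‖) := by
      rw [mul_comm, mul_assoc]
      refine mul_le_mul_of_nonneg_left ?_ hK
      linarith
    linarith
  · intro z Y
    rw [LineDifferentiableAt]
    by_cases hz : perp W z = 0
    · have hfun : (fun s : ℝ => Φ (z + s • Y)) = fun s =>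
          e (0 + s * ‖perp W Y‖) (W.starProjection z.snd + s • W.starProjection Y.snd) +
          cliffordVec (perp W Y) * (‖perp W Y‖⁻¹ •
            o (0 + s * ‖perp W Y‖) (W.starProjection z.snd + s • W.starProjection Y.snd)) := by
        funext s
        simp only [Φ, map_add, map_smul, WithLp.add_snd, WithLp.smul_snd, hz, zero_add,
          norm_smul, Real.norm_eq_abs]
        rw [abs_mul_even heven, cliffordVec_smul, smul_smul, smul_mul_assoc, ← mul_smul_comm,
          inv_mul_odd (o := fun t => o t _) (fun t => hodd t _)]
      rw [hfun]
      have h1 := he.diff 0 ‖perp W Y‖ _ (hp z) _ (hp Y)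
      have h2 := ho.diff 0 ‖perp W Y‖ _ (hp z) _ (hp Y)
      exact h1.add ((h2.const_smul ‖perp W Y‖⁻¹).const_mul (cliffordVec (perp W Y)))
    · have h1 := he.diff_perp hz Y
      have h2 := ho.diff_perp hz Y
      have h3 : DifferentiableAt ℝ (fun s : ℝ => ‖perp W (z + s • Y)‖⁻¹) 0 := by
        simp only [map_add, map_smul]
        refine DifferentiableAt.inv (DifferentiableAt.norm ℝ (by fun_prop) ?_) ?_
        · simpa using hz
        · simpa using hz
      have h4 : DifferentiableAt ℝ (fun s : ℝ => (cliffordVec (perp W (z + s • Y)) : Cl H)) 0 := by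
        simp only [map_add, map_smul, cliffordVec_add, cliffordVec_smul]
        fun_prop
      exact h1.add ((h3.smul h4).mul h2)

end Tensor

section Correspondence

variable {H : Type v} [NormedAddCommGroup H] [InnerProductSpace ℝ H]

/-- `G` has directional derivatives of norm at most `c` on `ℝ × W`, in the directions of the open
unit ball. -/
def HasDirDerivs (W : Submodule ℝ H) (c : ℝ) (G : ℝ × H → Cl H) : Prop :=
  ∀ q ∈ (univ : Set ℝ) ×ˢ (W : Set H), ∀ Y ∈ (univ : Set ℝ) ×ˢ (W : Set H),
    Y.1 ^ 2 + ‖Y.2‖ ^ 2 < 1 → LineDifferentiableAt ℝ G q Y ∧ ‖lineDeriv ℝ G q Y‖ ≤ c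

namespace HasDirDerivs

variable {W : Submodule ℝ H} {c : ℝ} {G : ℝ × H → Cl H}

lemma lip (h : HasDirDerivs W c G) (t t' : ℝ) {p p' : H} (hp : p ∈ W) (hp' : p' ∈ W) :
    ‖G (t, p) - G (t', p')‖ ≤ c * (2 * ‖pt t p - pt t' p'‖) := by
  rcases eq_or_ne (pt t p - pt t' p') 0 with h0 | h0
  · rw [pt_sub] at h0
    have h1 : t - t' = 0 := congrArg WithLp.fst h0
    have h2 : p - p' = 0 := congrArg WithLp.snd h0
    rw [sub_eq_zero] at h1 h2
    simp [h1, h2]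
  set n := ‖pt t p - pt t' p'‖ with hn
  have hn0 : 0 < n := norm_pos_iff.2 h0
  -- The increment, scaled to norm `1 / 2`.
  set D : ℝ × H := (2 * n)⁻¹ • (t - t', p - p') with hD
  have hDW : D ∈ (univ : Set ℝ) ×ˢ (W : Set H) := ⟨trivial, W.smul_mem _ (W.sub_mem hp hp')⟩
  have hD1 : D.1 ^ 2 + ‖D.2‖ ^ 2 < 1 := by
    have : D.1 ^ 2 + ‖D.2‖ ^ 2 = ‖(2 * n)⁻¹ • (pt t p - pt t' p')‖ ^ 2 := by
      rw [pt_sub, smul_pt, norm_pt_sq]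
      rfl
    rw [this, norm_smul, ← hn, Real.norm_of_nonneg (by positivity)]
    have : (2 * n)⁻¹ * n = 2⁻¹ := by field_simp
    rw [this]
    norm_num
  have hq : ∀ s : ℝ, (t', p') + s • D ∈ (univ : Set ℝ) ×ˢ (W : Set H) :=
    fun s => ⟨trivial, W.add_mem hp' (W.smul_mem s hDW.2)⟩
  have hder : ∀ s : ℝ, HasDerivAt (fun s : ℝ => G ((t', p') + s • D))
      (lineDeriv ℝ G ((t', p') + s • D) D) s := fun s => by
    have h1 := (h _ (hq s) D hDW hD1).1.hasLineDerivAt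
    rw [HasLineDerivAt] at h1
    rw [← sub_self s] at h1
    have h3 := h1.comp_sub_const s s
    refine h3.congr_of_eventuallyEq (Eventually.of_forall fun x => ?_)
    change _ = G ((t', p') + s • D + (x - s) • D)
    rw [add_assoc, ← add_smul, add_sub_cancel]
  have hmv := Convex.norm_image_sub_le_of_norm_hasDerivWithin_le (s := univ) (x := (0 : ℝ))
    (y := 2 * n) (C := c) (fun s _ => (hder s).hasDerivWithinAt)
    (fun s _ => (h _ (hq s) D hDW hD1).2) convex_univ trivial trivial
  have e : (t', p') + (2 * n) • D = (t, p) := by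
    rw [hD, smul_smul, mul_inv_cancel₀ (by positivity), one_smul]
    simp
  rw [e, zero_smul, add_zero, sub_zero, Real.norm_of_nonneg (by positivity)] at hmv
  exact hmv

lemma diff (h : HasDirDerivs W c G) (t s : ℝ) {p y : H} (hp : p ∈ W) (hy : y ∈ W) :
    DifferentiableAt ℝ (fun r : ℝ => G (t + r * s, p + r • y)) 0 := by
  set k := 1 + ‖pt s y‖ with hk
  have hk0 : 0 < k := by positivity
  have h1 := (h (t, p) ⟨trivial, hp⟩ (k⁻¹ • (s, y)) ⟨trivial, W.smul_mem _ hy⟩ (by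
    have : (k⁻¹ • (s, y)).1 ^ 2 + ‖(k⁻¹ • (s, y)).2‖ ^ 2 = ‖k⁻¹ • pt s y‖ ^ 2 := by
      rw [smul_pt, norm_pt_sq]
      rfl
    rw [this, norm_smul, Real.norm_of_nonneg (by positivity), sq_lt_one_iff₀ (by positivity),
      inv_mul_lt_iff₀ hk0]
    linarith)).1.hasLineDerivAt
  have h2 := (h1.smul k).lineDifferentiableAt
  rw [smul_smul, mul_inv_cancel₀ hk0.ne', one_smul] at h2
  exact h2

lemma comp_neg {t s : ℝ} {p y : H}
    (h : DifferentiableAt ℝ (fun r : ℝ => G (-t + r * -s, p + r • y)) 0) :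
    DifferentiableAt ℝ (fun r : ℝ => G (-(t + r * s), p + r • y)) 0 := by
  refine h.congr_of_eventuallyEq (Eventually.of_forall fun r => ?_)
  simp only [neg_add, mul_neg]

lemma isLipDiff (h : HasDirDerivs W c G) :
    IsLipDiff W (2 * c) (evenPart G) ∧ IsLipDiff W (2 * c) (oddPart G) := by
  have key : ∀ t t' : ℝ, ∀ p ∈ W, ∀ p' ∈ W, ∀ x : Cl H,
      ‖x‖ ≤ ‖G (t, p) - G (t', p')‖ + ‖G (-t, p) - G (-t', p')‖ →
      ‖(2⁻¹ : ℝ) • x‖ ≤ 2 * c * ‖pt t p - pt t' p'‖ := by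
    intro t t' p hp p' hp' x hx
    have h1 := h.lip t t' hp hp'
    have h2 := h.lip (-t) (-t') hp hp'
    have h3 : ‖pt (-t) p - pt (-t') p'‖ = ‖pt t p - pt t' p'‖ :=
      (congrArg norm (map_sub (realFlip H) (pt t p) (pt t' p')).symm).trans
        ((realFlip H).norm_map _)
    rw [h3] at h2
    rw [norm_smul]
    norm_num
    linarith
  constructor
  · refine ⟨fun t t' p hp p' hp' => ?_, fun t s p hp y hy => ?_⟩
    · rw [evenPart, evenPart, ← smul_sub]
      refine key t t' p hp p' hp' _ ?_
      rw [add_sub_add_comm]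
      exact norm_add_le _ _
    · exact ((h.diff t s hp hy).add (comp_neg (h.diff (-t) (-s) hp hy))).const_smul (2⁻¹ : ℝ)
  · refine ⟨fun t t' p hp p' hp' => ?_, fun t s p hp y hy => ?_⟩
    · rw [oddPart, oddPart, ← smul_sub]
      refine key t t' p hp p' hp' _ ?_
      rw [sub_sub_sub_comm]
      exact norm_sub_le _ _
    · exact ((h.diff t s hp hy).sub (comp_neg (h.diff (-t) (-s) hp hy))).const_smul (2⁻¹ : ℝ)

end HasDirDerivs

lemma tendsto_bottExt {W : Submodule ℝ H} [W.HasOrthogonalProjection] {G : ℝ × H → Cl H}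
    (hG : IsTensorFn W.toAffineSubspace G) :
    Tendsto (bottExt W G) (Bornology.cobounded (RealSum H)) (𝓝 0) := by
  have hp : ∀ z : RealSum H, W.starProjection z.snd ∈ W :=
    fun z => Submodule.starProjection_apply_mem _ _
  have hlim : ∀ σ : ℝ, |σ| = 1 → Tendsto (fun z => G (σ * ‖perp W z‖, W.starProjection z.snd))
      (Bornology.cobounded (RealSum H)) (𝓝 0) := by
    intro σ hσ
    refine hG.zero_at_infty.comp (f := fun z : RealSum H =>
      (σ * ‖perp W z‖, W.starProjection z.snd)) (tendsto_inf.2 ⟨?_, ?_⟩)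
    · rw [← tendsto_norm_atTop_iff_cobounded]
      have h2 : Tendsto (fun z : RealSum H => 2⁻¹ * ‖z‖) (Bornology.cobounded _) atTop :=
        tendsto_norm_cobounded_atTop.const_mul_atTop (by norm_num)
      refine tendsto_atTop_mono (fun z => ?_) h2
      have h3 : ‖z‖ ≤ ‖perp W z‖ + ‖W.starProjection z.snd‖ := by
        conv_lhs => rw [← perp_add_pt W z]
        refine (norm_add_le _ _).trans ?_
        rw [norm_pt_zero]
      have h4 : ‖perp W z‖ ≤ ‖(σ * ‖perp W z‖, W.starProjection z.snd)‖ := by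
        rw [Prod.norm_def]
        exact le_max_of_le_left (by simp [hσ])
      have h5 : ‖W.starProjection z.snd‖ ≤ ‖(σ * ‖perp W z‖, W.starProjection z.snd)‖ :=
        le_max_right _ _
      linarith
    · exact tendsto_principal.2 (Eventually.of_forall fun z => ⟨trivial, hp z⟩)
  have h1 := hlim 1 (by simp)
  have h2 := hlim (-1) (by simp)
  simp only [one_mul, neg_one_mul] at h1 h2
  have he : Tendsto (fun z => evenPart G ‖perp W z‖ (W.starProjection z.snd))
      (Bornology.cobounded (RealSum H)) (𝓝 0) := by
    have h := (h1.add h2).const_smul (2⁻¹ : ℝ)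
    rwa [add_zero, smul_zero] at h
  have ho : Tendsto (fun z => oddPart G ‖perp W z‖ (W.starProjection z.snd))
      (Bornology.cobounded (RealSum H)) (𝓝 0) := by
    have h := (h1.sub h2).const_smul (2⁻¹ : ℝ)
    rwa [sub_zero, smul_zero] at h
  have hb : IsBoundedUnder (· ≤ ·) (Bornology.cobounded (RealSum H))
      ((fun y => ‖y‖) ∘ fun z => ‖perp W z‖⁻¹ • cliffordVec (perp W z)) := by
    refine isBoundedUnder_of ⟨1, fun z => ?_⟩
    simp only [Function.comp]
    rw [norm_smul, norm_inv, norm_norm]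
    refine (mul_le_mul_of_nonneg_left (norm_cliffordVec_le _) (by positivity)).trans ?_
    exact inv_mul_le_one
  have h := he.add (isBoundedUnder_le_mul_tendsto_zero hb ho)
  rwa [add_zero] at h

/-- The image in the limit algebra of a function with bounded directional derivatives is smooth. -/
lemma isSmooth_of_bott {W : Submodule ℝ H} [W.HasOrthogonalProjection] {G : ℝ × H → Cl H}
    (hG : IsTensorFn W.toAffineSubspace G) {c : ℝ} (hc : 0 ≤ c) (hd : HasDirDerivs W c G)
    {a : BddFn H} (ha : ∀ u, a u = bott W.toAffineSubspace G u) : IsSmooth (20 * c) a := by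
  have hfun : (fun z => extHom z a) = bottExt W G := funext fun z => extHom_eq_bottExt hG ha z
  have h := isSmooth_bottExt (W := W) (K := 2 * c) (by positivity) hd.isLipDiff.1 hd.isLipDiff.2
    (fun t p => by simp only [evenPart, neg_neg, add_comm])
    (fun t p => by simp only [oddPart, neg_neg, ← smul_neg, neg_sub])
  refine ⟨fun z z' => ?_, fun z Y => ?_, ?_⟩
  · rw [extHom_eq_bottExt hG ha, extHom_eq_bottExt hG ha]
    exact (h.1 z z').trans_eq (by ring)
  · rw [hfun]
    exact h.2 z Y
  · rw [hfun]
    exact tendsto_bottExt hG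

/-! ### Recovering a function on `ℝ × W` from its image -/

variable (H) in
/-- The linear map that sends `y₀ + ε y₁` to `y₀ + y₁`, for `y₀` and `y₁` in the Clifford algebra
of `H` and `ε` the vector `(1, 0)` of `ℝ ⊕ H`. -/
def collapse : Cl H →L[ℝ] Cl H :=
  LinearMap.mkContinuous
    { toFun := fun y => (2⁻¹ : ℝ) • (y + cliffMap (realFlip H) y) +
        cliffordVec (pt 1 0) * ((2⁻¹ : ℝ) • (y - cliffMap (realFlip H) y))
      map_add' := fun y y' => by
        simp only [map_add, smul_add, mul_add, smul_sub, mul_sub]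
        abel
      map_smul' := fun s y => by
        simp only [cliffMap_real_smul, RingHom.id_apply, ← smul_add, ← smul_sub, mul_smul_comm,
          smul_comm s (2⁻¹ : ℝ)] } 2 fun y => by
    have h1 := norm_cliffMap_le (realFlip H) y
    have h2 : ‖(cliffordVec (pt 1 0) : Cl H)‖ ≤ 1 := by
      refine (norm_cliffordVec_le _).trans_eq ?_
      rw [norm_pt]; simp
    refine (norm_add_le _ _).trans ?_
    have h3 : ‖(2⁻¹ : ℝ) • (y + cliffMap (realFlip H) y)‖ ≤ ‖y‖ := by
      rw [norm_smul]
      have := norm_add_le y (cliffMap (realFlip H) y)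
      norm_num
      linarith
    have h4 : ‖(2⁻¹ : ℝ) • (y - cliffMap (realFlip H) y)‖ ≤ ‖y‖ := by
      rw [norm_smul]
      have := norm_sub_le y (cliffMap (realFlip H) y)
      norm_num
      linarith
    have h5 := (norm_mul_le (cliffordVec (pt 1 0))
      ((2⁻¹ : ℝ) • (y - cliffMap (realFlip H) y))).trans
      (mul_le_mul h2 h4 (norm_nonneg _) zero_le_one)
    linarith

lemma collapse_apply (y : Cl H) : collapse H y = (2⁻¹ : ℝ) • (y + cliffMap (realFlip H) y) +
    cliffordVec (pt 1 0) * ((2⁻¹ : ℝ) • (y - cliffMap (realFlip H) y)) := rfl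

lemma norm_collapse_le (y : Cl H) : ‖collapse H y‖ ≤ 2 * ‖y‖ :=
  (collapse H).le_of_opNorm_le (LinearMap.mkContinuous_norm_le _ (by norm_num) _) y

lemma eps_mul_self : (cliffordVec (pt 1 0) * cliffordVec (pt 1 0) : Cl H) = 1 := by
  rw [cliffordVec_mul_self, norm_pt]
  simp

lemma realFlip_fix (w : H) : realFlip H (pt 0 w) = pt 0 w := realSum_ext neg_zero rfl

lemma cliffMap_realFlip {W : Submodule ℝ H} {y₀ y₁ : Cl H} (h₀ : y₀ ∈ cliff W) (h₁ : y₁ ∈ cliff W) :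
    cliffMap (realFlip H) (y₀ + cliffordVec (pt 1 0) * y₁) =
      y₀ - cliffordVec (pt 1 0) * y₁ := by
  have : realFlip H (pt 1 0) = - pt 1 0 := realSum_ext rfl neg_zero.symm
  rw [map_add, map_mul, cliffMap_cliff (fun w _ => realFlip_fix w) h₀,
    cliffMap_cliff (fun w _ => realFlip_fix w) h₁, cliffMap_cliffordVec, this, cliffordVec_neg,
    neg_mul, sub_eq_add_neg]

lemma two_inv_smul_add_self {A : Type*} [AddCommGroup A] [Module ℝ A] (x : A) :
    (2⁻¹ : ℝ) • (x + x) = x := by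
  rw [← two_smul ℝ x, smul_smul]
  norm_num

lemma collapse_add {W : Submodule ℝ H} {y₀ y₁ : Cl H} (h₀ : y₀ ∈ cliff W) (h₁ : y₁ ∈ cliff W) :
    collapse H (y₀ + cliffordVec (pt 1 0) * y₁) = y₀ + y₁ := by
  rw [collapse_apply, cliffMap_realFlip h₀ h₁]
  set x := cliffordVec (pt 1 0) * y₁ with hx
  have e1 : y₀ + x + (y₀ - x) = y₀ + y₀ := by abel
  have e2 : y₀ + x - (y₀ - x) = x + x := by abel
  rw [e1, e2, two_inv_smul_add_self, two_inv_smul_add_self, hx, ← mul_assoc, eps_mul_self, one_mul]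

/-- The Clifford algebra of `ℝ ⊕ W` is the sum of the one of `W` and of its product with the vector
`(1, 0)`. -/
lemma exists_eq_add {W : Submodule ℝ H} {y : Cl H} (hy : y ∈ cliffordSub (cyl W)) :
    ∃ y₀ ∈ cliff W, ∃ y₁ ∈ cliff W, y = y₀ + cliffordVec (pt 1 0) * y₁ := by
  set ε : Cl H := cliffordVec (pt 1 0) with hε
  let P : Cl H → Prop := fun y => ∃ y₀ ∈ cliff W, ∃ y₁ ∈ cliff W, y = y₀ + ε * y₁
  -- Left multiplication by a vector `t ε + w` preserves the elements of this form.
  have hvec : ∀ z ∈ cyl W, ∀ m, P m → P (cliffordVec z * m) := by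
    rintro z hz _ ⟨y₀, h₀, y₁, h₁, rfl⟩
    have hz' : z = z.fst • pt 1 0 + pt 0 z.snd := by
      rw [smul_pt, pt_add]
      exact realSum_ext (by simp) (by simp)
    have hw : cliffordVec (pt 0 z.snd) ∈ cliff W := by
      rw [cliff_eq]
      exact cliffordVec_mem ⟨rfl, hz⟩
    have hanti : cliffordVec (pt 0 z.snd) * ε = -(ε * cliffordVec (pt 0 z.snd)) := by
      have h := cliffordVec_mul_add_swap (pt 0 z.snd) (pt 1 0)
      rw [WithLp.prod_inner_apply] at h
      simp only [pt, WithLp.ofLp_toLp, inner_zero_right, inner_zero_left, add_zero, mul_zero,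
        zero_smul] at h
      exact eq_neg_of_add_eq_zero_left h
    refine ⟨z.fst • y₁ + cliffordVec (pt 0 z.snd) * y₀,
      add_mem (real_smul_mem _ _ h₁) (mul_mem hw h₀),
      z.fst • y₀ - cliffordVec (pt 0 z.snd) * y₁,
      sub_mem (real_smul_mem _ _ h₀) (mul_mem hw h₁), ?_⟩
    conv_lhs => rw [hz']
    have hee : ε * (ε * y₁) = y₁ := by rw [← mul_assoc, eps_mul_self, one_mul]
    have hwe : cliffordVec (pt 0 z.snd) * (ε * y₁) = -(ε * (cliffordVec (pt 0 z.snd) * y₁)) := by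
      rw [← mul_assoc, hanti, neg_mul, mul_assoc]
    rw [cliffordVec_add, cliffordVec_smul, ← hε, add_mul, mul_add, mul_add, smul_mul_assoc,
      smul_mul_assoc, hee, hwe, mul_sub, mul_smul_comm]
    abel
  have key : ∀ m, P m → P (y * m) := by
    change y ∈ Algebra.adjoin ℂ _ at hy
    induction hy using Algebra.adjoin_induction with
    | mem y hy =>
      rcases hy with ⟨w, hw, rfl⟩ | ⟨w, hw, hwy⟩
      · exact hvec w hw
      · rw [← star_star y, ← hwy, (isSelfAdjoint_cliffordVec w).star_eq]
        exact hvec w hw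
    | algebraMap c =>
      rintro _ ⟨y₀, h₀, y₁, h₁, rfl⟩
      refine ⟨c • y₀, (cliff W).smul_mem h₀ c, c • y₁, (cliff W).smul_mem h₁ c, ?_⟩
      rw [← Algebra.smul_def, smul_add, mul_smul_comm]
    | add y y' _ _ h h' =>
      intro m hm
      obtain ⟨y₀, h₀, y₁, h₁, e⟩ := h m hm
      obtain ⟨y₀', h₀', y₁', h₁', e'⟩ := h' m hm
      refine ⟨y₀ + y₀', add_mem h₀ h₀', y₁ + y₁', add_mem h₁ h₁', ?_⟩
      rw [add_mul, e, e', mul_add]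
      abel
    | mul y y' _ _ h h' => exact fun m hm => by rw [mul_assoc]; exact h _ (h' m hm)
  simpa using key 1 ⟨1, one_mem _, 0, zero_mem _, by simp⟩

/-- A smooth element of the limit algebra that comes from `W` is the image of a function on
`ℝ × W` with bounded directional derivatives. -/
lemma exists_tensorFn {W : Submodule ℝ H} [W.HasOrthogonalProjection] {a : BddFn H}
    (ha : a ∈ basedAlg W) {L : ℝ} (hL : 0 ≤ L) (hs : IsSmooth L a) :
    ∃ G : ℝ × H → Cl H, IsTensorFn W.toAffineSubspace G ∧ HasDirDerivs W (2 * L) G ∧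
      ∀ u, a u = bott W.toAffineSubspace G u := by
  let G : ℝ × H → Cl H := fun q => collapse H (extHom (pt q.1 q.2) a)
  have hpt : Continuous fun q : ℝ × H => pt q.1 q.2 := WithLp.prod_continuous_toLp 2 ℝ H
  have hcont : Continuous fun z => extHom z a := by
    refine LipschitzWith.continuous (K := ⟨L, hL⟩) (LipschitzWith.of_dist_le_mul fun z z' => ?_)
    rw [dist_eq_norm, dist_eq_norm]
    exact hs.lip z z'
  have hmem : ∀ t, ∀ p ∈ W, ∃ y₀ ∈ cliff W, ∃ y₁ ∈ cliff W,
      extHom (pt t p) a = y₀ + cliffordVec (pt 1 0) * y₁ :=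
    fun t p hp => exists_eq_add (ha.2 _ hp)
  refine ⟨G, ⟨?_, ?_, ?_⟩, ?_, ?_⟩
  · exact ((collapse H).continuous.comp (hcont.comp hpt)).continuousOn
  · refine Tendsto.mono_left ?_ inf_le_left
    have h1 : Tendsto (fun q : ℝ × H => pt q.1 q.2) (Bornology.cobounded (ℝ × H))
        (Bornology.cobounded (RealSum H)) := by
      rw [← tendsto_norm_atTop_iff_cobounded]
      refine tendsto_atTop_mono (fun q => ?_) tendsto_norm_cobounded_atTop
      exact max_le (norm_fst_le (pt q.1 q.2)) (norm_snd_le (pt q.1 q.2))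
    have h2 := ((collapse H).continuous.tendsto 0).comp (hs.tendsto_zero.comp h1)
    rwa [map_zero] at h2
  · intro t p hp
    obtain ⟨y₀, h₀, y₁, h₁, e⟩ := hmem t p hp
    rw [Submodule.toAffineSubspace_direction]
    change collapse H (extHom (pt t p) a) ∈ _
    rw [e, collapse_add h₀ h₁]
    exact add_mem h₀ h₁
  · intro q _ Y _ hY
    have hd : LineDifferentiableAt ℝ G q Y :=
      (collapse H).differentiableAt.comp (0 : ℝ) (hs.lineDiff (pt q.1 q.2) (pt Y.1 Y.2))
    refine ⟨hd, ?_⟩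
    refine HasDerivAt.le_of_lip' hd.hasLineDerivAt (by positivity)
      (Eventually.of_forall fun s => ?_)
    rw [zero_smul, add_zero, sub_zero]
    have h1 : G (q + s • Y) - G q =
        collapse H (extHom (pt q.1 q.2 + s • pt Y.1 Y.2) a - extHom (pt q.1 q.2) a) := by
      rw [map_sub]; rfl
    rw [h1]
    refine (norm_collapse_le _).trans ?_
    have h2 := hs.lip (pt q.1 q.2 + s • pt Y.1 Y.2) (pt q.1 q.2)
    rw [add_sub_cancel_left, norm_smul] at h2
    have h3 : ‖pt Y.1 Y.2‖ ≤ 1 := by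
      rw [norm_pt]
      exact Real.sqrt_le_one.2 hY.le
    have h4 : L * (‖s‖ * ‖pt Y.1 Y.2‖) ≤ L * ‖s‖ :=
      mul_le_mul_of_nonneg_left (mul_le_of_le_one_right (norm_nonneg _) h3) hL
    linarith
  · intro u
    set z := pt (u.1 : ℝ) u.2 with hz
    set p := W.starProjection u.2 with hp
    have hpW : p ∈ W := Submodule.starProjection_apply_mem _ _
    obtain ⟨S, hfix, hSv, hSz, -⟩ := exists_isometry W z
    change S (pt ‖perp W z‖ 0) = perp W z at hSv
    change S (pt ‖perp W z‖ p) = z at hSz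
    set r := ‖perp W z‖ with hr
    obtain ⟨y₀, h₀, y₁, h₁, e⟩ := hmem r p hpW
    have hflip : extHom (pt (-r) p) a = y₀ - cliffordVec (pt 1 0) * y₁ := by
      rw [← cliffMap_realFlip h₀ h₁, ← e, ← ha.1 (realFlip H) (fun w _ => realFlip_fix w)]
      rfl
    have hG1 : G (r, p) = y₀ + y₁ := by
      change collapse H (extHom (pt r p) a) = _
      rw [e, collapse_add h₀ h₁]
    have hG2 : G (-r, p) = y₀ - y₁ := by
      change collapse H (extHom (pt (-r) p) a) = _
      rw [hflip, sub_eq_add_neg, ← mul_neg, collapse_add h₀ (neg_mem h₁), sub_eq_add_neg]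
    have hev : evenPart G r p = y₀ := by
      rw [evenPart, hG1, hG2]
      convert two_inv_smul_add_self y₀ using 2
      abel
    have hod : oddPart G r p = y₁ := by
      rw [oddPart, hG1, hG2]
      convert two_inv_smul_add_self y₁ using 2
      abel
    rw [bott_eq_bottExt, ← ext_pt]
    change extHom z a = evenPart G r p + (r⁻¹ • cliffordVec (perp W z)) * oddPart G r p
    rw [hev, hod, ← hSz, ha.1 S hfix, e, map_add, map_mul, cliffMap_cliff hfix h₀,
      cliffMap_cliff hfix h₁, hSz]
    congr 1
    rcases eq_or_ne r 0 with h0 | h0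
    · have : y₁ = 0 := by
        rw [h0] at e hflip
        rw [neg_zero, e] at hflip
        have h2 : cliffordVec (pt 1 0) * y₁ = 0 := by
          refine eq_zero_of_eq_neg (add_left_cancel (a := y₀) ?_)
          rw [hflip, sub_eq_add_neg]
        calc y₁ = cliffordVec (pt 1 0) * (cliffordVec (pt 1 0) * y₁) := by
              rw [← mul_assoc, eps_mul_self, one_mul]
          _ = 0 := by rw [h2, mul_zero]
      rw [this, mul_zero, mul_zero]
    · have h2 : S (pt 1 0) = r⁻¹ • perp W z := by
        rw [← hSv, ← map_smul, smul_pt, inv_mul_cancel₀ h0, smul_zero]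
      rw [cliffMap_cliffordVec, h2, cliffordVec_smul]

end Correspondence

/-! ### Supports -/

section Support

variable {H : Type v} [NormedAddCommGroup H] [InnerProductSpace ℝ H]

/-- A point of `[0, ∞) × H`, as a vector of `ℝ ⊕ H`. -/
def RayProd.toPt (u : RayProd H) : RealSum H :=
  let u' : ℝ≥0 × H := u
  pt u'.1 u'.2

/-- The map that defines the topology of `[0, ∞) × H`. -/
def rayEmb (u : RayProd H) : (H → ℝ) × ℝ := (fun w => ⟪w, u.toPt.snd⟫_ℝ, ‖u.toPt‖ ^ 2)

lemma isInducing_rayEmb : IsInducing (rayEmb : RayProd H → (H → ℝ) × ℝ) := by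
  refine ⟨?_⟩
  have : (rayEmb : RayProd H → (H → ℝ) × ℝ) =
      fun u : ℝ≥0 × H => ((fun w : H => ⟪w, u.2⟫_ℝ), (u.1 : ℝ) ^ 2 + ‖u.2‖ ^ 2) := by
    funext u
    rw [rayEmb, RayProd.toPt, norm_pt_sq]
    rfl
  rw [this]
  rfl

/-- By the Riesz representation theorem and Tychonoff's theorem, closed balls are compact. -/
lemma isCompact_rayBall [CompleteSpace H] (s : ℝ) :
    IsCompact {u : RayProd H | ‖RayProd.toPt (H := H) u‖ ^ 2 ≤ s} := by
  rw [isInducing_rayEmb.isCompact_iff]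
  have himg : rayEmb '' {u : RayProd H | ‖u.toPt‖ ^ 2 ≤ s} =
      {q : (H → ℝ) × ℝ | (∀ x y, q.1 (x + y) = q.1 x + q.1 y) ∧
        (∀ (c : ℝ) x, q.1 (c • x) = c * q.1 x) ∧
        (∀ x, q.1 x ^ 2 ≤ q.2 * ‖x‖ ^ 2) ∧ 0 ≤ q.2 ∧ q.2 ≤ s} := by
    ext ⟨l, r⟩
    constructor
    · rintro ⟨u, hu, h⟩
      obtain ⟨rfl, rfl⟩ := Prod.ext_iff.1 h
      refine ⟨fun x y => inner_add_left _ _ _, fun c x => ?_, fun x => ?_, sq_nonneg _, hu⟩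
      · simp [rayEmb, inner_smul_left]
      · have h1 : |⟪x, u.toPt.snd⟫_ℝ| ≤ ‖u.toPt‖ * ‖x‖ := by
          refine (abs_real_inner_le_norm _ _).trans ?_
          rw [mul_comm]
          exact mul_le_mul_of_nonneg_right (norm_snd_le _) (norm_nonneg _)
        change ⟪x, u.toPt.snd⟫_ℝ ^ 2 ≤ ‖u.toPt‖ ^ 2 * ‖x‖ ^ 2
        rw [← mul_pow]
        exact sq_le_sq' (abs_le.1 h1).1 (abs_le.1 h1).2
    · rintro ⟨hadd, hsmul, hb, h0, hs⟩
      simp only at hadd hsmul hb h0 hs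
      let L : H →L[ℝ] ℝ := LinearMap.mkContinuous
        { toFun := l, map_add' := hadd, map_smul' := hsmul } (√r) fun x => by
          refine abs_le_of_sq_le_sq ?_ (by positivity)
          rw [mul_pow, Real.sq_sqrt h0]
          exact hb x
      set w := (InnerProductSpace.toDual ℝ H).symm L with hw
      have hL : ∀ x, ⟪x, w⟫_ℝ = l x := fun x => by
        rw [real_inner_comm, hw, InnerProductSpace.toDual_symm_apply]
        rfl
      have hwr : ‖w‖ ^ 2 ≤ r := by
        rw [hw, LinearIsometryEquiv.norm_map]
        have := LinearMap.mkContinuous_norm_le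
          { toFun := l, map_add' := hadd, map_smul' := hsmul : H →ₗ[ℝ] ℝ } (Real.sqrt_nonneg r)
            (fun x => by
              refine abs_le_of_sq_le_sq ?_ (by positivity)
              rw [mul_pow, Real.sq_sqrt h0]
              exact hb x)
        calc ‖L‖ ^ 2 ≤ √r ^ 2 := by gcongr
          _ = r := Real.sq_sqrt h0
      let u : RayProd H := ((⟨√(r - ‖w‖ ^ 2), Real.sqrt_nonneg _⟩ : ℝ≥0), w)
      have hu : ‖u.toPt‖ ^ 2 = r := by
        change ‖pt (√(r - ‖w‖ ^ 2)) w‖ ^ 2 = r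
        rw [norm_pt_sq, Real.sq_sqrt (sub_nonneg.2 hwr), sub_add_cancel]
      refine ⟨u, hu.le.trans hs, Prod.ext (funext hL) hu⟩
  rw [himg]
  refine IsCompact.of_isClosed_subset
    (s := (univ.pi fun x : H => Icc (-(√s * ‖x‖)) (√s * ‖x‖)) ×ˢ Icc 0 s)
    ((isCompact_univ_pi fun x => isCompact_Icc).prod isCompact_Icc) ?_ ?_
  · simp only [ofPred_and, ofPred_forall]
    refine IsClosed.inter ?_ (IsClosed.inter ?_ (IsClosed.inter ?_ (IsClosed.inter ?_ ?_)))
    · exact isClosed_iInter fun x => isClosed_iInter fun y =>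
        isClosed_eq (by fun_prop) (by fun_prop)
    · exact isClosed_iInter fun x => isClosed_iInter fun y =>
        isClosed_eq (by fun_prop) (by fun_prop)
    · exact isClosed_iInter fun x => isClosed_le (by fun_prop) (by fun_prop)
    · exact isClosed_le (by fun_prop) (by fun_prop)
    · exact isClosed_le (by fun_prop) (by fun_prop)
  · rintro ⟨l, r⟩ ⟨-, -, hb, h0, hs⟩
    refine ⟨fun x _ => ?_, h0, hs⟩
    have h1 : |l x| ≤ √s * ‖x‖ := by
      refine abs_le_of_sq_le_sq ?_ (by positivity)
      rw [mul_pow, Real.sq_sqrt (h0.trans hs)]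
      exact (hb x).trans (mul_le_mul_of_nonneg_right hs (sq_nonneg _))
    exact ⟨(abs_le.1 h1).1, (abs_le.1 h1).2⟩

lemma mem_support_of_ne_zero {a : BddFn H} {u : ℝ≥0 × H} (h : a u ≠ 0) : u ∈ support a := by
  rintro ⟨g, hg, hga⟩
  exact (smul_ne_zero hg h) (hga u)

lemma mem_rayBall {v : H} {r : ℝ} (hr : 0 ≤ r) {u : ℝ≥0 × H} :
    u ∈ rayBall v r ↔ ‖pt (u.1 : ℝ) u.2 - pt 0 v‖ < r := by
  rw [pt_sub, sub_zero, ← sq_lt_sq₀ (norm_nonneg _) hr, norm_pt_sq]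
  rfl

/-- The support may exceed the set of points where `a` is nonzero, as it is closed in the topology
of `[0, ∞) × H`; a bump function of the distance to `(0, v)` shows that it stays in a larger
ball. -/
lemma support_subset_rayBall [CompleteSpace H] {a : BddFn H} {v : H} {r : ℝ} (hr : 0 ≤ r)
    (h : ∀ u, a u ≠ 0 → u ∈ rayBall v r) : support a ⊆ rayBall v (r + 1) := by
  intro u hu
  by_contra hur
  refine hu ?_
  -- A bump function of the distance to `(0, v)`.
  let d : RayProd H → ℝ := fun x => ‖x.toPt‖ ^ 2 - 2 * ⟪v, x.toPt.snd⟫_ℝ + ‖v‖ ^ 2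
  have hd : ∀ x, d x = ‖x.toPt - pt 0 v‖ ^ 2 := fun x => by
    have e1 : ‖x.toPt - pt 0 v‖ ^ 2 = x.toPt.fst ^ 2 + ‖x.toPt.snd - v‖ ^ 2 := by
      rw [← norm_pt_sq, ← pt_eta x.toPt, pt_sub, sub_zero]
      rfl
    have e2 : ‖x.toPt‖ ^ 2 = x.toPt.fst ^ 2 + ‖x.toPt.snd‖ ^ 2 := by
      rw [← norm_pt_sq, pt_eta]
    simp only [d]
    rw [e1, e2, norm_sub_sq_real, real_inner_comm]
    ring
  have hcont : Continuous d := by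
    have h1 : Continuous fun x : RayProd H => (rayEmb x).2 :=
      continuous_snd.comp isInducing_rayEmb.continuous
    have h2 : Continuous fun x : RayProd H => (rayEmb x).1 v :=
      (continuous_apply v).comp (continuous_fst.comp isInducing_rayEmb.continuous)
    exact (h1.sub (h2.const_mul 2)).add_const _
  let u' : RayProd H := u
  have hu' : (r + 1) ^ 2 ≤ d u' := by
    rw [mem_rayBall (by positivity), not_lt] at hur
    rw [hd]
    exact pow_le_pow_left₀ (by positivity) hur 2
  let k : RayProd H → ℝ := fun x => max 0 (1 - |d x - d u'|)
  have hk : Continuous k := by fun_prop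
  let g : ZeroAtInftyContinuousMap (RayProd H) ℂ :=
    { toFun := fun x => (k x : ℂ)
      continuous_toFun := Complex.continuous_ofReal.comp hk
      zero_at_infty' := by
        refine tendsto_const_nhds.congr' ?_
        filter_upwards [(isCompact_rayBall (H := H) ((√(d u' + 1) + ‖v‖) ^ 2)).compl_mem_cocompact]
          with x hx
        have hx' : (√(d u' + 1) + ‖v‖) ^ 2 < ‖x.toPt‖ ^ 2 := not_le.1 hx
        have h1 : √(d u' + 1) + ‖v‖ < ‖x.toPt‖ := lt_of_pow_lt_pow_left₀ 2 (norm_nonneg _) hx'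
        have h2 : ‖x.toPt‖ ≤ ‖x.toPt - pt 0 v‖ + ‖v‖ := by
          rw [← norm_pt_zero v]
          simpa using norm_add_le (x.toPt - pt 0 v) (pt 0 v)
        have h3 : √(d u' + 1) < ‖x.toPt - pt 0 v‖ := by linarith
        have h4 : d u' + 1 < d x := by
          rw [hd x]
          exact (Real.sqrt_lt' ((Real.sqrt_nonneg _).trans_lt h3)).1 h3
        have h5 : k x = 0 := by
          refine max_eq_left ?_
          linarith [le_abs_self (d x - d u')]
        rw [h5, Complex.ofReal_zero] }
  refine ⟨g, ?_, fun w => ?_⟩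
  · change ((k u' : ℝ) : ℂ) ≠ 0
    simp [k]
  · by_cases hw : a w = 0
    · rw [hw, smul_zero]
    · have h1 := h w hw
      rw [mem_rayBall hr] at h1
      let w' : RayProd H := w
      have h2 : d w' < r ^ 2 := by
        rw [hd]
        exact pow_lt_pow_left₀ h1 (norm_nonneg _) two_ne_zero
      have h5 : k w' = 0 := by
        refine max_eq_left ?_
        have := neg_abs_le (d w' - d u')
        nlinarith
      change ((k w' : ℝ) : ℂ) • a w = 0
      rw [h5, Complex.ofReal_zero, zero_smul]

/-- The extension of `a` to `ℝ ⊕ H` vanishes outside a ball if `a` does. -/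
lemma norm_sub_lt_of_extHom_ne_zero {a : BddFn H} {v : H} {r : ℝ} (hr : 0 ≤ r)
    (h : ∀ u, a u ≠ 0 → u ∈ rayBall v r) {z : RealSum H} (hz : extHom z a ≠ 0) :
    ‖z - pt 0 v‖ < r := by
  rcases le_or_gt 0 z.fst with h0 | h0
  · rw [ext_of_nonneg h0] at hz
    have := (mem_rayBall hr).1 (h _ hz)
    simpa [Real.coe_toNNReal _ h0, pt_eta] using this
  · rw [ext_of_neg h0] at hz
    have h1 : a ((-z.fst).toNNReal, z.snd) ≠ 0 := fun h' => hz (by rw [h', map_zero])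
    have h2 := (mem_rayBall hr).1 (h _ h1)
    simp only [Real.coe_toNNReal _ (neg_nonneg.2 h0.le)] at h2
    rw [← (realFlip H).norm_map, map_sub, realFlip_fix]
    exact h2

end Support

/-! ### Matrices of adjointable operators -/

section Matrix

variable {X : Type u} {A : Type v} [NonUnitalCStarAlgebra A]

open Classical in
/-- The family with a single nonzero entry `c`, in position `y`. -/
def single (y : X) (c : A) : HilbertSum X A :=
  ⟨Pi.single y c, summable_of_ne_finset_zero (s := {y}) fun x hx => by
    rw [Pi.single_eq_of_ne (by simpa using hx), mul_zero]⟩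

open Classical in
lemma single_apply (y : X) (c : A) (x : X) : single y c x = if x = y then c else 0 :=
  Pi.single_apply y c x

@[simp] lemma single_same (y : X) (c : A) : single y c y = c := by
  rw [single_apply, if_pos rfl]

lemma single_of_ne {x y : X} (h : x ≠ y) (c : A) : single y c x = 0 := by
  rw [single_apply, if_neg h]

lemma inn_single_left (y : X) (c : A) (b : HilbertSum X A) :
    HilbertSum.inn (single y c) b = star c * b y := by
  rw [HilbertSum.inn, tsum_eq_single y fun x hx => by rw [single_of_ne hx, star_zero, zero_mul],
    single_same]

lemma norm_single (y : X) (c : A) : ‖single y c‖ = ‖c‖ := by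
  rw [HilbertSum.norm_def, inn_single_left, single_same, CStarRing.norm_star_mul_self,
    Real.sqrt_mul_self (norm_nonneg c)]

/-- Evaluation at `x`, as a continuous linear map. -/
def evalL (x : X) : HilbertSum X A →L[ℂ] A :=
  LinearMap.mkContinuous
    { toFun := fun a => a x
      map_add' := fun _ _ => rfl
      map_smul' := fun _ _ => rfl } 1 fun a => by
    rw [one_mul]; exact HilbertSum.norm_apply_le a x

@[simp] lemma evalL_apply (x : X) (a : HilbertSum X A) : evalL x a = a x := rfl

lemma hasSum_single_family (a : HilbertSum X A) : HasSum (fun y => single y (a y)) a := by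
  classical
  rw [HasSum, SummationFilter.unconditional_filter, Metric.tendsto_atTop]
  intro ε hε
  obtain ⟨s, hs⟩ := (summable_iff_partNorm _).1 a.2 (ε / 2) (by positivity)
  refine ⟨s, fun F hF => ?_⟩
  have hval : ∀ x, (a - ∑ y ∈ F, single y (a y)) x = if x ∈ F then 0 else a x := fun x => by
    rw [← evalL_apply, map_sub, map_sum]
    simp only [evalL_apply, single_apply, Finset.sum_ite_eq]
    split_ifs <;> simp
  rw [dist_comm, dist_eq_norm]
  refine lt_of_le_of_lt ?_ (half_lt_self hε)
  refine le_of_tendsto' (HilbertSum.tendsto_partNorm _) fun t => ?_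
  have h1 : partNorm t (a - ∑ y ∈ F, single y (a y) : HilbertSum X A) = partNorm (t \ F) a := by
    have e : ∀ x, star ((a - ∑ y ∈ F, single y (a y) : HilbertSum X A) x) *
        (a - ∑ y ∈ F, single y (a y) : HilbertSum X A) x =
        if x ∈ F then 0 else star (a x) * a x := fun x => by
      rw [hval]
      split_ifs <;> simp
    rw [partNorm, partNorm]
    congr 2
    rw [Finset.sum_congr rfl fun x _ => e x, Finset.sdiff_eq_filter, Finset.sum_filter]
    exact Finset.sum_congr rfl fun x _ => by split_ifs <;> simp_all
  rw [h1]
  exact (hs _ (Finset.sdiff_disjoint.mono_right hF)).le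

lemma eq_of_forall_mul_right {b b' : A} (h : ∀ c, b * c = b' * c) : b = b' := by
  rw [← sub_eq_zero, ← CStarRing.mul_star_self_eq_zero_iff, sub_mul, h, sub_self]

lemma eq_of_forall_mul_left {b b' : A} (h : ∀ c, c * b = c * b') : b = b' := by
  rw [← sub_eq_zero, ← CStarRing.star_mul_self_eq_zero_iff, mul_sub, h, sub_self]

/-- The matrix of the adjointable operator `L` is `T`. -/
def IsMatrix (L : Adjointable X A) (T : X → X → A) : Prop :=
  ∀ x y c, (L.1 (single y c)) x = T x y * c

namespace IsMatrix

variable {L L' : Adjointable X A} {T T' : X → X → A}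

lemma hasSum (h : IsMatrix L T) (a : HilbertSum X A) (x : X) :
    HasSum (fun y => T x y * a y) ((L.1 a) x) := by
  have := ((hasSum_single_family a).mapL L.1).mapL (evalL x)
  simpa only [evalL_apply, h x] using this

lemma unique (h : IsMatrix L T) (h' : IsMatrix L T') (x y : X) : T x y = T' x y :=
  eq_of_forall_mul_right fun c => by rw [← h, ← h']

lemma norm_entry_le (h : IsMatrix L T) (x y : X) : ‖T x y‖ ≤ ‖L‖ := by
  rcases eq_or_ne (T x y) 0 with h0 | h0
  · rw [h0, norm_zero]
    exact norm_nonneg L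
  have h1 : ‖T x y‖ * ‖T x y‖ ≤ ‖L‖ * ‖T x y‖ := by
    rw [← CStarRing.norm_self_mul_star, ← h]
    refine (HilbertSum.norm_apply_le _ _).trans ((L.1.le_opNorm _).trans_eq ?_)
    rw [norm_single, norm_star]
    rfl
  exact le_of_mul_le_mul_right h1 (norm_pos_iff.2 h0)

protected lemma zero : IsMatrix (0 : Adjointable X A) fun _ _ => 0 := fun x y c => by
  rw [zero_mul]; rfl

protected lemma add (h : IsMatrix L T) (h' : IsMatrix L' T') :
    IsMatrix (L + L') fun x y => T x y + T' x y := fun x y c => by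
  rw [add_mul, ← h, ← h']; rfl

protected lemma smul (h : IsMatrix L T) (k : ℂ) : IsMatrix (k • L) fun x y => k • T x y :=
  fun x y c => by
    rw [smul_mul_assoc, ← h]; rfl

protected lemma star (h : IsMatrix L T) : IsMatrix (star L) fun x y => star (T y x) :=
  fun x y c => eq_of_forall_mul_left fun b => by
    have h1 := Adjointable.inn_apply L (single x (star b)) (single y c)
    rw [inn_single_left, star_star] at h1
    rw [← h1, ← HilbertSum.star_inn, inn_single_left, h, star_mul, star_mul, star_star, star_star,
      mul_assoc]

/-- The entries of a product are finite sums if the rows of the first factor are finite. -/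
lemma mul_hasSum (h : IsMatrix L T) (h' : IsMatrix L' T') (x y : X) (c : A) :
    HasSum (fun z => T x z * T' z y * c) (((L * L').1 (single y c)) x) := by
  have := h.hasSum (L'.1 (single y c)) x
  simp only [h' _ y c, ← mul_assoc] at this
  exact this

lemma mul_apply {T'' : X → X → A} (h : IsMatrix L T) (h' : IsMatrix L' T')
    (h'' : IsMatrix (L * L') T'') (x y : X) (s : Finset X)
    (hs : ∀ z ∉ s, T x z * T' z y = 0) : T'' x y = ∑ z ∈ s, T x z * T' z y :=
  eq_of_forall_mul_right fun c => by
    rw [← h'', Finset.sum_mul]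
    exact (mul_hasSum h h' x y c).unique
      (hasSum_sum_of_ne_finset_zero fun z hz => by rw [hs z hz, zero_mul])

protected lemma mul (h : IsMatrix L T) (h' : IsMatrix L' T') (s : X → Finset X)
    (hs : ∀ x, ∀ z ∉ s x, T x z = 0) :
    IsMatrix (L * L') fun x y => ∑ z ∈ s x, T x z * T' z y := fun x y c => by
  rw [Finset.sum_mul]
  exact (mul_hasSum h h' x y c).unique
    (hasSum_sum_of_ne_finset_zero fun z hz => by rw [hs x z hz, zero_mul, zero_mul])

/-- The matrix of a convergent series of operators. -/
lemma tsum {L : ℕ → Adjointable X A} {T : ℕ → X → X → A} (h : ∀ n, IsMatrix (L n) (T n))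
    (hL : Summable fun n => ‖L n‖) : IsMatrix (∑' n, L n) fun x y => ∑' n, T n x y := by
  intro x y c
  have h1 : Summable fun n => T n x y :=
    hL.of_norm_bounded fun n => (h n).norm_entry_le x y
  have h2 := hL.of_norm.hasSum
  let φ : Adjointable X A →L[ℂ] A := LinearMap.mkContinuous
    { toFun := fun S => (S.1 (single y c)) x
      map_add' := fun _ _ => rfl
      map_smul' := fun _ _ => rfl } ‖c‖ fun S => by
    refine (HilbertSum.norm_apply_le _ _).trans ((S.1.le_opNorm _).trans_eq ?_)
    rw [norm_single, mul_comm]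
    rfl
  have h3 : HasSum (fun n => T n x y * c) (((∑' n, L n : Adjointable X A).1 (single y c)) x) := by
    have := h2.mapL φ
    have e : (fun n => φ (L n)) = fun n => T n x y * c := funext fun n => h n x y c
    rwa [e] at this
  exact h3.unique (h1.hasSum.mul_right c)

end IsMatrix

/-! ### Bounded matrices of finite propagation -/

section order
attribute [local instance] CStarAlgebra.spectralOrder CStarAlgebra.spectralOrderedRing

/-- The Cauchy–Schwarz inequality for a finite sum in a C⋆-algebra. -/
lemma star_sum_mul_sum_le {ι : Type*} (F : Finset ι) (b : ι → A) :
    star (∑ i ∈ F, b i) * ∑ i ∈ F, b i + star (∑ i ∈ F, b i) * ∑ i ∈ F, b i ≤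
      (2 * F.card) • ∑ i ∈ F, star (b i) * b i := by
  have h : 0 ≤ ∑ i ∈ F, ∑ j ∈ F, star (b i - b j) * (b i - b j) :=
    Finset.sum_nonneg fun i _ => Finset.sum_nonneg fun j _ => star_mul_self_nonneg _
  have e : ∑ i ∈ F, ∑ j ∈ F, star (b i - b j) * (b i - b j) =
      (2 * F.card) • ∑ i ∈ F, star (b i) * b i -
        (star (∑ i ∈ F, b i) * ∑ i ∈ F, b i + star (∑ i ∈ F, b i) * ∑ i ∈ F, b i) := by
    rw [mul_smul, two_smul ℕ (F.card • _)]
    simp only [star_sub, sub_mul, mul_sub, Finset.sum_sub_distrib, Finset.sum_const,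
      ← Finset.sum_mul, ← Finset.mul_sum, star_sum, Finset.smul_sum]
    abel
  rw [e] at h
  exact sub_nonneg.1 h

lemma partNorm_sum_le {B : X → Finset X} {K : ℕ} {M : ℝ} {T : X → X → A}
    (hB : ∀ x y, y ∈ B x ↔ x ∈ B y) (hK : ∀ x, (B x).card ≤ K) (hM0 : 0 ≤ M)
    (hM : ∀ x y, ‖T x y‖ ≤ M) (a : X → A) (s : Finset X) [DecidableEq X] :
    partNorm s (fun x => ∑ y ∈ B x, T x y * a y) ≤ K * M * partNorm (s.biUnion B) a := by
  have hterm : ∀ x y, star (T x y * a y) * (T x y * a y) ≤ (M ^ 2) • (star (a y) * a y) := by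
    intro x y
    have h1 : star (a y) * (star (T x y) * T x y) * a y ≤
        ‖star (T x y) * T x y‖ • (star (a y) * a y) :=
      CStarAlgebra.star_left_conjugate_le_norm_smul
    rw [star_mul, mul_assoc, ← mul_assoc (star (T x y)), ← mul_assoc]
    refine h1.trans (smul_le_smul_of_nonneg_right ?_ (star_mul_self_nonneg _))
    rw [CStarRing.norm_star_mul_self, pow_two]
    exact mul_self_le_mul_self (norm_nonneg _) (hM x y)
  have hrow : ∀ x, star (∑ y ∈ B x, T x y * a y) * (∑ y ∈ B x, T x y * a y) +
      star (∑ y ∈ B x, T x y * a y) * (∑ y ∈ B x, T x y * a y) ≤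
      (2 * K * M ^ 2) • ∑ y ∈ B x, star (a y) * a y := by
    intro x
    refine (star_sum_mul_sum_le (B x) _).trans ?_
    rw [← Nat.cast_smul_eq_nsmul ℝ, mul_smul, Finset.smul_sum (r := M ^ 2)]
    refine (smul_le_smul_of_nonneg_right (a₂ := (2 * K : ℝ)) ?_
      (Finset.sum_nonneg fun y _ => star_mul_self_nonneg _)).trans
      (smul_le_smul_of_nonneg_left (Finset.sum_le_sum fun y _ => hterm x y) (by positivity))
    have : ((B x).card : ℝ) ≤ K := by exact_mod_cast hK x
    push_cast
    linarith
  set P := ∑ x ∈ s, star (∑ y ∈ B x, T x y * a y) * (∑ y ∈ B x, T x y * a y) with hP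
  set Q := ∑ y ∈ s.biUnion B, star (a y) * a y with hQ
  have hcount : ∑ x ∈ s, ∑ y ∈ B x, star (a y) * a y ≤ (K : ℝ) • Q := by
    have e : ∑ x ∈ s, ∑ y ∈ B x, star (a y) * a y =
        ∑ y ∈ s.biUnion B, ∑ x ∈ s.filter (fun x => y ∈ B x), star (a y) * a y := by
      refine Finset.sum_comm' fun x y => ?_
      simp only [Finset.mem_filter, Finset.mem_biUnion]
      exact ⟨fun h => ⟨h, x, h⟩, fun h => h.1⟩
    rw [e, hQ, Finset.smul_sum]
    refine Finset.sum_le_sum fun y _ => ?_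
    rw [Finset.sum_const, ← Nat.cast_smul_eq_nsmul ℝ]
    refine smul_le_smul_of_nonneg_right ?_ (star_mul_self_nonneg _)
    have : (s.filter fun x => y ∈ B x).card ≤ (B y).card :=
      Finset.card_le_card fun x hx => (hB x y).1 (Finset.mem_filter.1 hx).2
    exact_mod_cast this.trans (hK y)
  have hPQ : P + P ≤ (2 * K * M ^ 2) • ((K : ℝ) • Q) := by
    rw [hP, ← Finset.sum_add_distrib]
    refine (Finset.sum_le_sum fun x _ => hrow x).trans ?_
    rw [← Finset.smul_sum]
    exact smul_le_smul_of_nonneg_left hcount (by positivity)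
  have hP0 : 0 ≤ P := Finset.sum_nonneg fun x _ => star_mul_self_nonneg _
  have hnorm := CStarAlgebra.norm_le_norm_of_nonneg_of_le (add_nonneg hP0 hP0) hPQ
  rw [← two_smul ℝ P, norm_smul, norm_smul, norm_smul, Real.norm_of_nonneg (by positivity),
    Real.norm_of_nonneg (by positivity), Real.norm_of_nonneg (by positivity)] at hnorm
  rw [partNorm, partNorm]
  refine Real.sqrt_le_iff.2 ⟨by positivity, ?_⟩
  rw [mul_pow, Real.sq_sqrt (norm_nonneg _), ← hP, ← hQ]
  nlinarith

end order

/-- A matrix of finite propagation with bounded entries acts by a bounded operator. -/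
lemma exists_bounded {B : X → Finset X} {K : ℕ} {M : ℝ} {T : X → X → A}
    (hB : ∀ x y, y ∈ B x ↔ x ∈ B y) (hK : ∀ x, (B x).card ≤ K) (hM : ∀ x y, ‖T x y‖ ≤ M) :
    ∃ L : HilbertSum X A →L[ℂ] HilbertSum X A, ∀ a x, (L a) x = ∑ y ∈ B x, T x y * a y := by
  classical
  rcases isEmpty_or_nonempty X with hX | ⟨⟨x₀⟩⟩
  · exact ⟨0, fun a x => hX.elim x⟩
  have hM0 : 0 ≤ M := (norm_nonneg _).trans (hM x₀ x₀)
  have hle := fun (a : X → A) => partNorm_sum_le hB hK hM0 hM a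
  have hmem : ∀ a : HilbertSum X A, (fun x => ∑ y ∈ B x, T x y * a y) ∈ l2Submodule X A := by
    intro a
    refine (summable_iff_partNorm _).2 fun ε hε => ?_
    obtain ⟨s, hs⟩ := (summable_iff_partNorm _).1 a.2 (ε / (K * M + 1)) (by positivity)
    refine ⟨s.biUnion B, fun t ht => ?_⟩
    have hd : Disjoint (t.biUnion B) s := by
      rw [Finset.disjoint_left]
      intro y hy hys
      obtain ⟨x, hx, hxy⟩ := Finset.mem_biUnion.1 hy
      exact Finset.disjoint_left.1 ht hx (Finset.mem_biUnion.2 ⟨y, hys, (hB x y).1 hxy⟩)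
    have h1 := hs _ hd
    rw [lt_div_iff₀ (by positivity)] at h1
    refine (hle a t).trans_lt ?_
    nlinarith [partNorm_nonneg (t.biUnion B) (a : X → A)]
  let L : HilbertSum X A →ₗ[ℂ] HilbertSum X A :=
    { toFun := fun a => ⟨fun x => ∑ y ∈ B x, T x y * a y, hmem a⟩
      map_add' := fun a b => HilbertSum.ext fun x => by
        change ∑ y ∈ B x, T x y * (a y + b y) = _ + _
        simp only [mul_add, Finset.sum_add_distrib]
      map_smul' := fun k a => HilbertSum.ext fun x => by
        change ∑ y ∈ B x, T x y * (k • a y) = k • ∑ y ∈ B x, T x y * a y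
        rw [Finset.smul_sum]
        exact Finset.sum_congr rfl fun y _ => mul_smul_comm _ _ _ }
  refine ⟨L.mkContinuous (K * M) fun a => ?_, fun a x => rfl⟩
  refine le_of_tendsto' (HilbertSum.tendsto_partNorm (L a)) fun s => (hle a s).trans ?_
  exact mul_le_mul_of_nonneg_left (HilbertSum.partNorm_le a _) (by positivity)

/-- A matrix of finite propagation with bounded entries is adjointable. -/
lemma exists_isMatrix {B : X → Finset X} {K : ℕ} {M : ℝ} {T : X → X → A}
    (hB : ∀ x y, y ∈ B x ↔ x ∈ B y) (hK : ∀ x, (B x).card ≤ K) (hM : ∀ x y, ‖T x y‖ ≤ M)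
    (hT : ∀ x, ∀ y ∉ B x, T x y = 0) : ∃ L : Adjointable X A, IsMatrix L T := by
  classical
  obtain ⟨L, hL⟩ := exists_bounded hB hK hM
  obtain ⟨L', hL'⟩ := exists_bounded (T := fun x y => star (T y x)) hB hK
    (fun x y => by rw [norm_star]; exact hM y x)
  have hLs : ∀ x y c, (L (single y c)) x = T x y * c := fun x y c => by
    rw [hL]
    simp only [single_apply, mul_ite, mul_zero, Finset.sum_ite_eq']
    split_ifs with h
    · rfl
    · rw [hT x y h, zero_mul]
  have hadj : ∀ a b, HilbertSum.inn (L a) b = HilbertSum.inn a (L' b) := by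
    intro a b
    have key : ∀ y c, HilbertSum.inn (L (single y c)) b = HilbertSum.inn (single y c) (L' b) := by
      intro y c
      rw [inn_single_left, hL', HilbertSum.inn, tsum_eq_sum (s := B y), Finset.mul_sum]
      · exact Finset.sum_congr rfl fun x _ => by rw [hLs, star_mul, mul_assoc]
      · intro x hx
        rw [hLs, hT x y fun h => hx ((hB x y).1 h), zero_mul, star_zero, zero_mul]
    have hinn : ∀ (s : Finset X) (g : X → HilbertSum X A) (b : HilbertSum X A),
        HilbertSum.inn (∑ y ∈ s, g y) b = ∑ y ∈ s, HilbertSum.inn (g y) b := by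
      intro s g b
      let ψ : HilbertSum X A →+ A :=
        { toFun := fun a => HilbertSum.inn a b
          map_zero' := by simp [HilbertSum.inn]
          map_add' := fun a a' => HilbertSum.inn_add_left a a' b }
      exact map_sum ψ g s
    have h1 := HilbertSum.tendsto_inn_left b ((hasSum_single_family a).mapL L)
    have h2 := HilbertSum.tendsto_inn_left (L' b) (hasSum_single_family a)
    simp only [hinn, key] at h1 h2
    exact tendsto_nhds_unique h1 h2
  exact ⟨⟨L, L', hadj⟩, hLs⟩

end Matrix

/-! ### States and representations of C⋆-algebras -/

section States

open scoped ComplexStarModule ComplexOrder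

attribute [local instance] CStarAlgebra.spectralOrder CStarAlgebra.spectralOrderedRing

variable {A : Type v} [CStarAlgebra A]

lemma add_smul_nonneg [Nontrivial A] {a : A} (ha : 0 ≤ a) {s t : ℝ}
    (h : 0 ≤ s • (1 : A) + t • a) : 0 ≤ s + t * ‖a‖ := by
  have h1 : ‖a‖ ∈ spectrum ℝ a := CStarAlgebra.norm_mem_spectrum_of_nonneg ha
  have h2 : s + t * ‖a‖ ∈ spectrum ℝ (s • (1 : A) + t • a) := by
    rw [← Algebra.algebraMap_eq_smul_one]
    rw [add_comm s, spectrum.add_mem_add_iff]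
    rcases eq_or_ne t 0 with rfl | ht
    · simp
    · have := (spectrum.smul_mem_smul_iff (r := Units.mk0 t ht)).2 h1
      simpa [Units.smul_def] using this
  exact spectrum_nonneg_of_nonneg h h2

/-- A positive element attains its norm on some state, by the extension theorem of M. Riesz for the
cone of all elements with a positive real part. The functional `s + t a ↦ s + t ‖a‖` on the
span of `1` and `a` is extended; the scalars `s` and `t` are kept as separate coordinates, so
that it need not be checked that this is well defined. -/
lemma exists_state [Nontrivial A] {a : A} (ha : 0 ≤ a) :
    ∃ f : A →ₚ[ℂ] ℂ, f 1 = 1 ∧ f a = ‖a‖ := by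
  let ψ : A × ℝ × ℝ →ₗ[ℝ] A :=
    { toFun := fun q => (ℜ q.1 : A) + (q.2.1 • (1 : A) + q.2.2 • a)
      map_add' := fun q q' => by
        simp only [Prod.fst_add, Prod.snd_add, map_add, AddSubgroup.coe_add, add_smul]
        abel
      map_smul' := fun r q => by
        simp only [Prod.smul_fst, Prod.smul_snd, map_smul, selfAdjoint.val_smul, smul_eq_mul,
          RingHom.id_apply, smul_add, smul_smul] }
  let C : PointedCone ℝ (A × ℝ × ℝ) :=
    { carrier := {q | 0 ≤ ψ q}
      zero_mem' := by simp
      add_mem' := fun {q q'} h h' => by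
        rw [mem_ofPred_eq, map_add]
        exact add_nonneg h h'
      smul_mem' := fun r q h => by
        change 0 ≤ ψ ((r : ℝ) • q)
        rw [map_smul]
        exact smul_nonneg r.2 h }
  let F : A × ℝ × ℝ →ₗ[ℝ] ℝ :=
    { toFun := fun q => q.2.1 + q.2.2 * ‖a‖
      map_add' := fun q q' => by
        change (q.2.1 + q'.2.1) + (q.2.2 + q'.2.2) * ‖a‖ = _
        ring
      map_smul' := fun r q => by
        change r * q.2.1 + r * q.2.2 * ‖a‖ = r * (q.2.1 + q.2.2 * ‖a‖)
        ring }
  let p : Submodule ℝ (A × ℝ × ℝ) := (⊥ : Submodule ℝ A).prod ⊤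
  obtain ⟨g, hg, hpos⟩ := riesz_extension C (F.toPMap p) (by
    rintro ⟨⟨y, s, t⟩, hy, ht⟩ h
    obtain rfl : y = 0 := hy
    have h' : 0 ≤ ψ (0, s, t) := h
    simp only [ψ, LinearMap.coe_mk, AddHom.coe_mk, map_zero, ZeroMemClass.coe_zero, zero_add] at h'
    exact add_smul_nonneg ha h') (by
    rintro ⟨y, s, t⟩
    refine ⟨⟨(0, ‖(ℜ y : A)‖ - s, -t), ⟨rfl, trivial⟩⟩, ?_⟩
    change 0 ≤ ψ ((0, ‖(ℜ y : A)‖ - s, -t) + (y, s, t))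
    simp only [ψ, LinearMap.coe_mk, AddHom.coe_mk, Prod.mk_add_mk, zero_add, sub_add_cancel,
      neg_add_cancel, zero_smul, add_zero]
    have h1 := IsSelfAdjoint.neg_algebraMap_norm_le_self (ℜ y).2
    rw [Algebra.algebraMap_eq_smul_one] at h1
    have h2 := add_le_add_left h1 (‖(ℜ y : A)‖ • (1 : A))
    simpa using h2)
  have hgp : ∀ s t : ℝ, g (0, s, t) = s + t * ‖a‖ := fun s t =>
    hg ⟨(0, s, t), ⟨rfl, trivial⟩⟩
  -- Elements on which the cone condition holds with equality.
  have hg0 : ∀ q, ψ q = 0 → g q = 0 := fun q hq => by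
    refine le_antisymm ?_ (hpos q (show 0 ≤ ψ q from hq.ge))
    have := hpos (-q) (show 0 ≤ ψ (-q) by rw [map_neg, hq, neg_zero])
    rw [map_neg] at this
    linarith
  let k : Module.Dual ℝ A := g.comp (LinearMap.inl ℝ A (ℝ × ℝ))
  have hk : ∀ y, k y = g (y, 0, 0) := fun y => rfl
  have hkx : ∀ x : A, 0 ≤ x → 0 ≤ k x := fun x hx => by
    refine hpos _ ?_
    change 0 ≤ ψ (x, 0, 0)
    simp only [ψ, LinearMap.coe_mk, AddHom.coe_mk, zero_smul, add_zero]
    rwa [(IsSelfAdjoint.of_nonneg hx).coe_realPart]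
  have hkI : ∀ x : A, IsSelfAdjoint x → k (Complex.I • x) = 0 := fun x hx => by
    refine hg0 _ ?_
    simp only [ψ, LinearMap.coe_mk, AddHom.coe_mk, zero_smul, add_zero, LinearMap.inl_apply,
      Prod.fst_zero, Prod.snd_zero]
    rw [realPart_I_smul, hx.imaginaryPart]
    simp
  have hkst : ∀ x : A, IsSelfAdjoint x → ∀ s t : ℝ, x = s • (1 : A) + t • a →
      k x = s + t * ‖a‖ := fun x hx s t hst => by
    have h1 := hg0 (x, -s, -t) (by
      simp only [ψ, LinearMap.coe_mk, AddHom.coe_mk]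
      rw [hx.coe_realPart, hst]
      simp only [neg_smul]
      abel)
    have h2 : ((x, -s, -t) : A × ℝ × ℝ) = (x, 0, 0) + (0, -s, -t) := by simp
    rw [h2, map_add, hgp, ← hk] at h1
    linarith
  have hval : ∀ x : A, IsSelfAdjoint x → (k.extendRCLike : Module.Dual ℂ A) x = (k x : ℂ) :=
    fun x hx => by
      rw [Module.Dual.extendRCLike_apply]
      change (k x : ℂ) - Complex.I * (k (Complex.I • x) : ℂ) = _
      rw [hkI x hx]
      simp
  let f : A →ₚ[ℂ] ℂ := PositiveLinearMap.mk₀ (k.extendRCLike : Module.Dual ℂ A) fun x hx => by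
    rw [hval x (IsSelfAdjoint.of_nonneg hx)]
    exact_mod_cast hkx x hx
  refine ⟨f, ?_, ?_⟩
  · change (k.extendRCLike : Module.Dual ℂ A) 1 = 1
    rw [hval 1 (IsSelfAdjoint.one A), hkst 1 (IsSelfAdjoint.one A) 1 0 (by simp)]
    simp
  · change (k.extendRCLike : Module.Dual ℂ A) a = ‖a‖
    rw [hval a (IsSelfAdjoint.of_nonneg ha), hkst a (IsSelfAdjoint.of_nonneg ha) 0 1 (by simp)]
    simp

/-- The norm of an element of a C⋆-algebra is attained in some representation, by the construction
of Gelfand, Naimark and Segal. -/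
lemma exists_rep_norm_le (T : A) (hT : T ≠ 0) :
    ∃ f : A →ₚ[ℂ] ℂ, ‖T‖ ≤ ‖f.gnsNonUnitalStarAlgHom T‖ := by
  have : Nontrivial A := ⟨T, 0, hT⟩
  obtain ⟨f, hf1, hfT⟩ := exists_state (star_mul_self_nonneg T)
  refine ⟨f, ?_⟩
  have hnorm : ∀ x : A, ‖((f.toPreGNS x : f.PreGNS) : f.GNS)‖ ^ 2 = (f (star x * x)).re := by
    intro x
    rw [UniformSpace.Completion.norm_coe]
    have := f.preGNS_norm_sq (f.toPreGNS x)
    rw [PositiveLinearMap.ofPreGNS_toPreGNS] at this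
    rw [← this, ← Complex.ofReal_pow, Complex.ofReal_re]
  have h1 : ‖((f.toPreGNS 1 : f.PreGNS) : f.GNS)‖ = 1 := by
    have := hnorm 1
    rw [star_one, one_mul, hf1, Complex.one_re] at this
    exact (pow_eq_one_iff_of_nonneg (norm_nonneg _) two_ne_zero).1 this
  have h2 : ‖((f.toPreGNS T : f.PreGNS) : f.GNS)‖ = ‖T‖ := by
    have := hnorm T
    rw [hfT, Complex.ofReal_re, CStarRing.norm_star_mul_self, ← pow_two] at this
    exact (sq_eq_sq₀ (norm_nonneg _) (norm_nonneg _)).1 this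
  have h3 := (f.gnsNonUnitalStarAlgHom T).le_opNorm ((f.toPreGNS 1 : f.PreGNS) : f.GNS)
  rw [h1, mul_one, PositiveLinearMap.gnsNonUnitalStarAlgHom_apply_coe] at h3
  rw [← h2]
  refine le_trans (le_of_eq ?_) h3
  congr 2
  simp

end States

/-! ### Coarse geometry of the embedding -/

section Coarse

variable {X : Type u} [MetricSpace X]

lemma BoundedGeometry.exists_balls (hX : BoundedGeometry X) (r : ℝ) :
    ∃ (B : X → Finset X) (K : ℕ), (∀ x y, y ∈ B x ↔ dist x y ≤ r) ∧ ∀ x, (B x).card ≤ K := by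
  obtain ⟨K, hK⟩ := hX (|r| + 1) (by positivity)
  have hsub : ∀ x : X, {y : X | dist x y ≤ r} ⊆ Metric.ball x (|r| + 1) := fun x y hy => by
    rw [Metric.mem_ball, dist_comm]
    have : dist x y ≤ r := hy
    linarith [le_abs_self r]
  have hcard : ∀ x : X, {y : X | dist x y ≤ r}.encard ≤ K :=
    fun x => (encard_le_encard (hsub x)).trans (hK x)
  have hfin : ∀ x : X, {y : X | dist x y ≤ r}.Finite := fun x => finite_of_encard_le_coe (hcard x)
  refine ⟨fun x => (hfin x).toFinset, K, fun x y => by simp, fun x => ?_⟩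
  have := hcard x
  rw [(hfin x).encard_eq_coe_toFinset_card] at this
  exact_mod_cast this

variable {H : Type v} [NormedAddCommGroup H] {f : X → H}

lemma IsCoarseEmbedding.exists_norm_le (hf : IsCoarseEmbedding f) (r : ℝ) :
    ∃ ρ : ℝ, 0 ≤ ρ ∧ ∀ x y, dist x y ≤ r → ‖f x - f y‖ ≤ ρ := by
  obtain ⟨ρm, ρp, -, hp, -, h⟩ := hf
  refine ⟨ρp r.toNNReal, NNReal.coe_nonneg _, fun x y hxy => ?_⟩
  have h1 : nndist x y ≤ r.toNNReal := by
    rw [← Real.toNNReal_coe (r := nndist x y), coe_nndist]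
    exact Real.toNNReal_le_toNNReal hxy
  exact_mod_cast (h x y).2.trans (hp h1)

lemma IsCoarseEmbedding.exists_dist_le (hf : IsCoarseEmbedding f) (ρ : ℝ) :
    ∃ r : ℝ, 0 ≤ r ∧ ∀ x y, ‖f x - f y‖ ≤ ρ → dist x y ≤ r := by
  obtain ⟨ρm, ρp, hm, -, hlim, h⟩ := hf
  obtain ⟨r, hr⟩ := (hlim.eventually_gt_atTop ρ.toNNReal).exists
  refine ⟨r, r.2, fun x y hxy => ?_⟩
  by_contra hlt
  rw [not_le, ← coe_nndist, NNReal.coe_lt_coe] at hlt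
  have h1 := (hr.trans_le (hm hlt.le)).trans_le (h x y).1
  rw [← NNReal.coe_lt_coe, coe_nnnorm] at h1
  exact (h1.trans_le hxy).not_ge (Real.le_coe_toNNReal ρ)

end Coarse

/-! ### The algebra of twisted matrices -/

section Twisted

variable {X : Type u} [MetricSpace X]
variable {H : Type v} [NormedAddCommGroup H] [InnerProductSpace ℝ H] {f : X → H}

lemma finiteDimensional_W (hX : BoundedGeometry X) (f : X → H) (n : ℕ) (x : X) :
    FiniteDimensional ℝ (W f n x) := by
  obtain ⟨B, K, hB, -⟩ := hX.exists_balls ((n : ℝ) ^ 2)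
  refine FiniteDimensional.span_of_finite ℝ (Set.Finite.image f ?_)
  refine (B x).finite_toSet.subset fun y hy => ?_
  exact (hB x y).2 hy

lemma W_le {n n' : ℕ} {x y : X} (h : (n : ℝ) ^ 2 + dist x y ≤ (n' : ℝ) ^ 2) :
    W f n y ≤ W f n' x := by
  refine Submodule.span_mono (image_mono fun w hw => ?_)
  have h1 : dist y w ≤ (n : ℝ) ^ 2 := hw
  change dist x w ≤ (n' : ℝ) ^ 2
  linarith [dist_triangle x y w]

lemma sq_add_le {n k : ℕ} {r : ℝ} (h : r ≤ k) : (n : ℝ) ^ 2 + r ≤ ((n + k : ℕ) : ℝ) ^ 2 := by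
  have h1 : (k : ℝ) ≤ (k : ℝ) ^ 2 := by exact_mod_cast Nat.le_self_pow two_ne_zero k
  have h2 : (0 : ℝ) ≤ (n : ℝ) * k := by positivity
  push_cast
  nlinarith

variable (f) in
/-- The inclusion of the limit algebra in the bounded functions on `[0, ∞) × H`. -/
def toFnHom : TwistAlg f →⋆ₙₐ[ℂ] BddFn H where
  toFun a := a.toFn
  map_smul' _ _ := rfl
  map_zero' := rfl
  map_add' _ _ := rfl
  map_mul' _ _ := rfl
  map_star' _ := rfl

lemma norm_toFnHom (a : TwistAlg f) : ‖toFnHom f a‖ = ‖a‖ := rfl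

lemma continuous_toFnHom : Continuous (toFnHom f) :=
  AddMonoidHomClass.continuous_of_bound (toFnHom f) 1 fun a => by
    rw [one_mul, norm_toFnHom]

variable (f) in
/-- The value at a point of `ℝ ⊕ H` of an element of the limit algebra. -/
def val (z : RealSum H) : TwistAlg f →⋆ₙₐ[ℂ] Cl H := (extHom z).comp (toFnHom f)

lemma val_apply (z : RealSum H) (a : TwistAlg f) : val f z a = extHom z (toFnHom f a) := rfl

lemma twistAlg_ext {a b : TwistAlg f} (h : ∀ z, val f z a = val f z b) : a = b :=
  Subtype.ext (bddFn_ext h)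

lemma norm_val_le (z : RealSum H) (a : TwistAlg f) : ‖val f z a‖ ≤ ‖a‖ :=
  norm_ext_le z (toFnHom f a)

variable (f) in
/-- The conditions on the matrices in the algebraic twisted Roe algebra, in terms of the extensions
of the entries to `ℝ ⊕ H`, with explicit bounds. -/
structure IsTwistedWith (N : ℕ) (R : ℝ) (T : X → X → TwistAlg f) : Prop where
  nonneg : 0 ≤ R
  based : ∀ x y, toFnHom f (T x y) ∈ basedAlg (W f N x)
  smooth : ∀ x y, IsSmooth R (toFnHom f (T x y))
  bound : ∀ x y, ‖T x y‖ ≤ R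
  prop : ∀ x y, R < dist x y → T x y = 0
  supp : ∀ x y z, val f z (T x y) ≠ 0 → ‖z - pt 0 (f x)‖ < R

/-- The conditions in `IsTwisted` are intrinsic conditions on the entries. The constant `20` is the
one in `isSmooth_of_bott`, and the summands `1` make room for strict inequalities and for the
boundary of the support. -/
theorem isTwisted_iff [CompleteSpace H] (hX : BoundedGeometry X) {T : X → X → TwistAlg f} :
    IsTwisted f T ↔ ∃ N R, IsTwistedWith f N R T := by
  have hfd := finiteDimensional_W hX f
  constructor
  · rintro ⟨⟨N, T₁, hT₁, c, hc, hd⟩, ⟨M, hM, hbd⟩, ⟨r₁, hr₁, hprop⟩, ⟨r₂, hr₂, hsupp⟩⟩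
    refine ⟨N, 20 * c + M + r₁ + r₂, by positivity, fun x y => ?_, fun x y => ?_, fun x y => ?_,
      fun x y h => ?_, fun x y z hz => ?_⟩
    · exact mem_basedAlg_of_bott (hT₁ x y).1 (hT₁ x y).2
    · exact (isSmooth_of_bott (hT₁ x y).1 hc.le (hd x y) (hT₁ x y).2).mono (by linarith)
    · exact (hbd x y).trans (by linarith)
    · exact hprop x y (by linarith)
    · have := norm_sub_lt_of_extHom_ne_zero hr₂.le
        (fun u hu => hsupp x y (mem_support_of_ne_zero hu)) hz
      linarith
  · rintro ⟨N, R, h⟩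
    have hG := fun x y => exists_tensorFn (h.based x y) h.nonneg (h.smooth x y)
    choose G hG1 hG2 hG3 using hG
    have h0 := h.nonneg
    refine ⟨⟨N, G, fun x y => ⟨hG1 x y, hG3 x y⟩, 2 * R + 1, by positivity,
        fun x y q hq Y hY h1 => ?_⟩,
      ⟨R + 1, by positivity, fun x y => (h.bound x y).trans (by linarith)⟩,
      ⟨R + 1, by positivity, fun x y hxy => h.prop x y (by linarith)⟩,
      ⟨R + 1, by positivity, fun x y => ?_⟩⟩
    · have := hG2 x y q hq Y hY h1
      exact ⟨this.1, this.2.trans (by linarith)⟩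
    · refine support_subset_rayBall h0 fun u hu => (mem_rayBall h0).2 (h.supp x y _ ?_)
      rw [val_apply, ext_pt]
      exact hu

namespace IsTwistedWith

variable {N N' : ℕ} {R R' : ℝ} {T T' : X → X → TwistAlg f}

lemma mono (hX : BoundedGeometry X) (h : IsTwistedWith f N R T) (hN : N ≤ N') (hR : R ≤ R') :
    IsTwistedWith f N' R' T := by
  have hfd := finiteDimensional_W hX f
  refine ⟨h.nonneg.trans hR, fun x y => basedAlg_mono (W_le ?_) (h.based x y),
    fun x y => (h.smooth x y).mono hR, fun x y => (h.bound x y).trans hR,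
    fun x y hxy => h.prop x y (hR.trans_lt hxy), fun x y z hz => (h.supp x y z hz).trans_le hR⟩
  rw [dist_self, add_zero]
  exact_mod_cast Nat.pow_le_pow_left hN 2

protected lemma zero : IsTwistedWith f 0 0 (fun _ _ => 0) := by
  refine ⟨le_rfl, fun x y => ?_, fun x y => ?_, fun x y => ?_, fun x y _ => rfl, fun x y z hz => ?_⟩
  · rw [map_zero]; exact zero_mem _
  · rw [map_zero]; exact IsSmooth.zero
  · rw [norm_zero]
  · rw [map_zero] at hz; exact absurd rfl hz

protected lemma add (hX : BoundedGeometry X) (h : IsTwistedWith f N R T)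
    (h' : IsTwistedWith f N' R' T') :
    IsTwistedWith f (max N N') (R + R') fun x y => T x y + T' x y := by
  have h0 := h.nonneg
  have h0' := h'.nonneg
  have g := h.mono hX (le_max_left N N') (le_add_of_nonneg_right h0' : R ≤ R + R')
  have g' := h'.mono hX (le_max_right N N') (le_add_of_nonneg_left h0 : R' ≤ R + R')
  refine ⟨g.nonneg, fun x y => ?_, fun x y => ?_, fun x y => ?_, fun x y hxy => ?_,
    fun x y z hz => ?_⟩
  · rw [map_add]; exact add_mem (g.based x y) (g'.based x y)
  · rw [map_add]; exact (h.smooth x y).add (h'.smooth x y)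
  · exact (norm_add_le _ _).trans (add_le_add (h.bound x y) (h'.bound x y))
  · rw [g.prop x y hxy, g'.prop x y hxy, add_zero]
  · by_cases h1 : val f z (T x y) = 0
    · refine g'.supp x y z fun h2 => hz ?_
      rw [map_add, h1, h2, add_zero]
    · exact g.supp x y z h1

protected lemma smul (h : IsTwistedWith f N R T) (c : ℂ) :
    IsTwistedWith f N (‖c‖ * R + R) fun x y => c • T x y := by
  have h0 := h.nonneg
  have h1 : 0 ≤ ‖c‖ * R := by positivity
  refine ⟨by positivity, fun x y => ?_, fun x y => ?_, fun x y => ?_, fun x y hxy => ?_,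
    fun x y z hz => ?_⟩
  · rw [map_smul]; exact (basedAlg _).smul_mem c (h.based x y)
  · rw [map_smul]; exact ((h.smooth x y).smul c).mono (by linarith)
  · rw [norm_smul]
    have := mul_le_mul_of_nonneg_left (h.bound x y) (norm_nonneg c)
    linarith
  · rw [h.prop x y (by linarith), smul_zero]
  · have := h.supp x y z fun h2 => hz (by rw [map_smul, h2, smul_zero])
    linarith

/-- An entry is also supported near the point of its column. -/
lemma norm_sub_lt_right (hf : IsCoarseEmbedding f) (h : IsTwistedWith f N R T) :
    ∃ R', R ≤ R' ∧ ∀ x y z, val f z (T x y) ≠ 0 → ‖z - pt 0 (f y)‖ < R' := by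
  obtain ⟨ρ, hρ, hfρ⟩ := hf.exists_norm_le R
  refine ⟨R + ρ, by linarith, fun x y z hz => ?_⟩
  have hxy : dist x y ≤ R := not_lt.1 fun hlt => hz (by rw [h.prop x y hlt, map_zero])
  have h1 := h.supp x y z hz
  have h2 : ‖pt 0 (f x) - pt 0 (f y)‖ ≤ ρ := by
    rw [pt_sub, sub_zero, norm_pt_zero]
    exact hfρ x y hxy
  have h3 := norm_sub_le_norm_sub_add_norm_sub z (pt 0 (f x)) (pt 0 (f y))
  linarith

protected lemma star (hX : BoundedGeometry X) (hf : IsCoarseEmbedding f)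
    (h : IsTwistedWith f N R T) : ∃ N' R', IsTwistedWith f N' R' fun x y => star (T y x) := by
  have hfd := finiteDimensional_W hX f
  obtain ⟨R', hR', hsupp⟩ := h.norm_sub_lt_right hf
  refine ⟨N + ⌈R⌉₊, R', h.nonneg.trans hR', fun x y => ?_, fun x y => ?_, fun x y => ?_,
    fun x y hxy => ?_, fun x y z hz => ?_⟩
  · rw [map_star]
    refine star_mem ?_
    by_cases hxy : R < dist y x
    · rw [h.prop y x hxy, map_zero]
      exact zero_mem _
    · refine basedAlg_mono (W_le (sq_add_le ?_)) (h.based y x)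
      rw [dist_comm]
      exact (not_lt.1 hxy).trans (Nat.le_ceil R)
  · rw [map_star]
    exact ((h.smooth y x).mono hR').star
  · rw [norm_star]
    exact (h.bound y x).trans hR'
  · rw [h.prop y x (by rw [dist_comm]; exact hR'.trans_lt hxy), star_zero]
  · exact hsupp y x z fun h2 => hz (by rw [map_star, h2, star_zero])

protected lemma mul (hX : BoundedGeometry X) {B : X → Finset X} {K : ℕ}
    (hB : ∀ x y, y ∈ B x ↔ dist x y ≤ R) (hK : ∀ x, (B x).card ≤ K)
    (h : IsTwistedWith f N R T) (h' : IsTwistedWith f N' R' T') :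
    ∃ N'' R'', IsTwistedWith f N'' R'' fun x y => ∑ z ∈ B x, T x z * T' z y := by
  have hfd := finiteDimensional_W hX f
  have h0 := h.nonneg
  have h0' := h'.nonneg
  have hRR : 0 ≤ R * R' := by positivity
  have hKR : 0 ≤ K * (R * R' + R * R') := by positivity
  refine ⟨max N (N' + ⌈R⌉₊), K * (R * R' + R * R') + R + R', by positivity, fun x y => ?_,
    fun x y => ?_, fun x y => ?_, fun x y hxy => ?_, fun x y z hz => ?_⟩
  · rw [map_sum]
    refine sum_mem fun z hz => ?_
    rw [map_mul]
    refine mul_mem ((h.mono hX (le_max_left _ _) le_rfl).based x z) ?_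
    refine basedAlg_mono (W_le ?_) (h'.based z y)
    refine (sq_add_le (((hB x z).1 hz).trans (Nat.le_ceil R))).trans ?_
    exact pow_le_pow_left₀ (by positivity) (by exact_mod_cast le_max_right _ _) 2
  · rw [map_sum]
    refine (IsSmooth.sum (B x) (L := R * R' + R * R') fun z _ => ?_).mono ?_
    · rw [map_mul]
      exact (h.smooth x z).mul (h'.smooth z y) (h.bound x z) (h'.bound z y)
    · have h1 : ((B x).card : ℝ) * (R * R' + R * R') ≤ K * (R * R' + R * R') :=
        mul_le_mul_of_nonneg_right (by exact_mod_cast hK x) (by positivity)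
      linarith
  · have h1 : ‖∑ z ∈ B x, T x z * T' z y‖ ≤ (B x).card • (R * R') := by
      refine Finset.sum_const (R * R') (s := B x) ▸ norm_sum_le_of_le (B x) fun z _ => ?_
      exact (norm_mul_le _ _).trans (mul_le_mul (h.bound x z) (h'.bound z y) (norm_nonneg _) h0)
    have h2 : ((B x).card : ℝ) * (R * R') ≤ K * (R * R') :=
      mul_le_mul_of_nonneg_right (by exact_mod_cast hK x) hRR
    have h3 : 0 ≤ (K : ℝ) * (R * R') := by positivity
    rw [nsmul_eq_mul] at h1
    linarith
  · refine Finset.sum_eq_zero fun z hz => ?_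
    have h1 := (hB x z).1 hz
    rw [h'.prop z y (by linarith [dist_triangle x z y]), mul_zero]
  · rw [map_sum] at hz
    obtain ⟨w, -, hw⟩ := Finset.exists_ne_zero_of_sum_ne_zero hz
    have := h.supp x w z fun h2 => hw (by rw [map_mul, h2, zero_mul])
    linarith

lemma exists_isMatrix (hX : BoundedGeometry X) (h : IsTwistedWith f N R T) :
    ∃ L : Adjointable X (TwistAlg f), IsMatrix L T := by
  obtain ⟨B, K, hB, hK⟩ := hX.exists_balls R
  refine TwistedRoe.exists_isMatrix (B := B) (fun x y => ?_) hK h.bound fun x y hy => ?_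
  · rw [hB, hB, dist_comm]
  · rw [hB, not_le] at hy
    exact h.prop x y hy

end IsTwistedWith

lemma actsBy_iff {L : Adjointable X (TwistAlg f)} {T : X → X → TwistAlg f} :
    ActsBy f L T ↔ IsMatrix L T := by
  constructor
  · intro h x y c
    have h1 := hasSum_single (f := fun y' => T x y' * single y c y') y fun y' hy' => by
      rw [single_of_ne hy', mul_zero]
    rw [single_same] at h1
    exact (h (single y c) x).unique h1
  · exact fun h a x => h.hasSum a x

variable [CompleteSpace H]

lemma mem_twistedOps_iff (hX : BoundedGeometry X) {L : Adjointable X (TwistAlg f)} :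
    L ∈ twistedOps f ↔ ∃ T N R, IsTwistedWith f N R T ∧ IsMatrix L T := by
  change (∃ T, IsTwisted f T ∧ ActsBy f L T) ↔ _
  simp only [isTwisted_iff hX, actsBy_iff]
  exact ⟨fun ⟨T, ⟨N, R, h⟩, h'⟩ => ⟨T, N, R, h, h'⟩, fun ⟨T, N, R, h, h'⟩ => ⟨T, ⟨N, R, h⟩, h'⟩⟩

/-- The `⋆`-algebra of the operators in `twistedOps`. -/
def twistedSubalgebra (hX : BoundedGeometry X) (hf : IsCoarseEmbedding f) :
    NonUnitalStarSubalgebra ℂ (Adjointable X (TwistAlg f)) where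
  carrier := twistedOps f
  zero_mem' := (mem_twistedOps_iff hX).2 ⟨_, _, _, IsTwistedWith.zero, IsMatrix.zero⟩
  add_mem' := by
    intro L L' hL hL'
    rw [mem_twistedOps_iff hX] at hL hL' ⊢
    obtain ⟨T, N, R, h, hm⟩ := hL
    obtain ⟨T', N', R', h', hm'⟩ := hL'
    exact ⟨_, _, _, h.add hX h', hm.add hm'⟩
  smul_mem' := by
    intro c L hL
    rw [mem_twistedOps_iff hX] at hL ⊢
    obtain ⟨T, N, R, h, hm⟩ := hL
    exact ⟨_, _, _, h.smul c, hm.smul c⟩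
  mul_mem' := by
    intro L L' hL hL'
    rw [mem_twistedOps_iff hX] at hL hL' ⊢
    obtain ⟨T, N, R, h, hm⟩ := hL
    obtain ⟨T', N', R', h', hm'⟩ := hL'
    obtain ⟨B, K, hB, hK⟩ := hX.exists_balls R
    obtain ⟨N'', R'', h''⟩ := h.mul hX hB hK h'
    refine ⟨_, _, _, h'', hm.mul hm' B fun x z hz => h.prop x z ?_⟩
    rwa [hB, not_le] at hz
  star_mem' := by
    intro L hL
    rw [mem_twistedOps_iff hX] at hL ⊢
    obtain ⟨T, N, R, h, hm⟩ := hL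
    obtain ⟨N', R', h'⟩ := h.star hX hf
    exact ⟨_, _, _, h', hm.star⟩

/-- The operators in `twistedOps` form a `⋆`-algebra. -/
theorem algTwistedRoe_eq (hX : BoundedGeometry X) (hf : IsCoarseEmbedding f) :
    (algTwistedRoe f : Set (Adjointable X (TwistAlg f))) = twistedOps f := by
  refine Subset.antisymm ?_ (NonUnitalStarAlgebra.subset_adjoin ℂ _)
  exact NonUnitalStarAlgebra.adjoin_le (S := twistedSubalgebra hX hf) Subset.rfl

end Twisted

/-! ### Quasi-inverses -/

section Calculus

/-- The product of a continuous function and of a differentiable function that vanishes at the point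
is differentiable. -/
lemma differentiableAt_mul_of_eq_zero {A : Type*} [NormedRing A] [NormedAlgebra ℝ A]
    {g k : ℝ → A} (hg : ContinuousAt g 0) (hk : DifferentiableAt ℝ k 0) (h0 : k 0 = 0) :
    DifferentiableAt ℝ (fun s => g s * k s) 0 := by
  refine HasDerivAt.differentiableAt (f' := g 0 * deriv k 0) ?_
  have hk' := hk.hasDerivAt
  rw [hasDerivAt_iff_tendsto_slope] at hk' ⊢
  have h1 := (hg.tendsto.mono_left nhdsWithin_le_nhds).mul hk'
  refine h1.congr fun s => ?_
  simp only [slope_def_module, h0, mul_zero, sub_zero, mul_smul_comm]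

end Calculus

section QuasiInverse

variable {X : Type u} [MetricSpace X]
variable {H : Type v} [NormedAddCommGroup H] [InnerProductSpace ℝ H] {f : X → H}

/-- Only a bounded number of points of `f(X)` lies in a ball of radius `r`. -/
lemma exists_near (hX : BoundedGeometry X) (hf : IsCoarseEmbedding f) (r : ℝ) :
    ∃ (F : RealSum H → Finset X) (K : ℕ), (∀ z x, x ∈ F z ↔ ‖z - pt 0 (f x)‖ < r) ∧
      ∀ z, (F z).card ≤ K := by
  classical
  obtain ⟨ρ, -, hρ⟩ := hf.exists_dist_le (2 * r)
  obtain ⟨B, K, hB, hK⟩ := hX.exists_balls ρ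
  have key : ∀ z : RealSum H, ∃ F : Finset X, (∀ x, x ∈ F ↔ ‖z - pt 0 (f x)‖ < r) ∧ F.card ≤ K := by
    intro z
    by_cases h : ∃ x₀, ‖z - pt 0 (f x₀)‖ < r
    · obtain ⟨x₀, hx₀⟩ := h
      refine ⟨(B x₀).filter fun x => ‖z - pt 0 (f x)‖ < r, fun x => ?_,
        (Finset.card_filter_le _ _).trans (hK x₀)⟩
      rw [Finset.mem_filter, and_iff_right_iff_imp]
      intro hx
      refine (hB x₀ x).2 (hρ x₀ x ?_)
      have h1 := norm_sub_le_norm_sub_add_norm_sub (pt 0 (f x₀)) z (pt 0 (f x))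
      rw [pt_sub, sub_zero, norm_pt_zero, norm_sub_rev _ z] at h1
      linarith
    · push Not at h
      exact ⟨∅, fun x => by simpa using h x, by simp⟩
  choose F h1 h2 using key
  exact ⟨F, K, h1, h2⟩

/-- The entries in position `(x, y)` vanish outside the balls of radius `r` about `f x` and
`f y`. -/
structure IsLocal (f : X → H) (r : ℝ) (p : X → X → TwistAlg f) : Prop where
  left : ∀ x y z, val f z (p x y) ≠ 0 → ‖z - pt 0 (f x)‖ < r
  right : ∀ x y z, val f z (p x y) ≠ 0 → ‖z - pt 0 (f y)‖ < r

lemma IsLocal.dist_le {r ρ : ℝ} {p : X → X → TwistAlg f} (h : IsLocal f r p)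
    (hρ : ∀ x y, ‖f x - f y‖ ≤ 2 * r → dist x y ≤ ρ) {x y : X} (hxy : p x y ≠ 0) :
    dist x y ≤ ρ := by
  have : ∃ z, val f z (p x y) ≠ 0 := by
    by_contra hz
    push Not at hz
    exact hxy (twistAlg_ext fun z => by rw [hz z, map_zero])
  obtain ⟨z, hz⟩ := this
  refine hρ x y ?_
  have h1 := norm_sub_le_norm_sub_add_norm_sub (pt 0 (f x)) z (pt 0 (f y))
  rw [pt_sub, sub_zero, norm_pt_zero, norm_sub_rev _ z] at h1
  linarith [h.left x y z hz, h.right x y z hz]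

/-- The matrix `q` is a quasi-inverse of `p`: `q = p + p q = p + q p`, where the products are finite
sums by the finite propagation of `p`. -/
structure IsQuasiInv (B : X → Finset X) (p q : X → X → TwistAlg f) : Prop where
  symm : ∀ x y, y ∈ B x ↔ x ∈ B y
  banded : ∀ x, ∀ y ∉ B x, p x y = 0
  left : ∀ x y, q x y = p x y + ∑ w ∈ B x, p x w * q w y
  right : ∀ x y, q x y = p x y + ∑ w ∈ B y, q x w * p w y

namespace IsQuasiInv

variable {B : X → Finset X} {p q : X → X → TwistAlg f} {r : ℝ}

lemma isLocal (h : IsQuasiInv B p q) (hp : IsLocal f r p) : IsLocal f r q := by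
  constructor
  · intro x y z hz
    by_contra hlt
    have h0 : ∀ w, val f z (p x w) = 0 := fun w => by
      by_contra h1
      exact hlt (hp.left x w z h1)
    refine hz ?_
    rw [h.left, map_add, h0, zero_add, map_sum]
    exact Finset.sum_eq_zero fun w _ => by rw [map_mul, h0, zero_mul]
  · intro x y z hz
    by_contra hlt
    have h0 : ∀ w, val f z (p w y) = 0 := fun w => by
      by_contra h1
      exact hlt (hp.right w y z h1)
    refine hz ?_
    rw [h.right, map_add, h0, zero_add, map_sum]
    exact Finset.sum_eq_zero fun w _ => by rw [map_mul, h0, mul_zero]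

lemma val_left (h : IsQuasiInv B p q) (hp : IsLocal f r p) {z : RealSum H} {J : Finset X}
    (hJ : ∀ x, ‖z - pt 0 (f x)‖ < r → x ∈ J) (x y : X) :
    val f z (q x y) = val f z (p x y) + ∑ w ∈ J, val f z (p x w) * val f z (q w y) := by
  classical
  have e : ∑ w ∈ B x, val f z (p x w) * val f z (q w y) =
      ∑ w ∈ J, val f z (p x w) * val f z (q w y) := by
    rw [Finset.sum_subset (Finset.subset_union_left (s₁ := B x) (s₂ := J)),
      Finset.sum_subset (Finset.subset_union_right (s₁ := B x) (s₂ := J))]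
    · intro w _ hw
      have : val f z (p x w) = 0 := by
        by_contra h1
        exact hw (hJ w (hp.right x w z h1))
      rw [this, zero_mul]
    · intro w _ hw
      rw [h.banded x w hw, map_zero, zero_mul]
  conv_lhs => rw [h.left]
  rw [map_add, map_sum, ← e]
  simp only [map_mul]

lemma val_right (h : IsQuasiInv B p q) (hp : IsLocal f r p) {z : RealSum H} {J : Finset X}
    (hJ : ∀ x, ‖z - pt 0 (f x)‖ < r → x ∈ J) (x y : X) :
    val f z (q x y) = val f z (p x y) + ∑ w ∈ J, val f z (q x w) * val f z (p w y) := by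
  classical
  have e : ∑ w ∈ B y, val f z (q x w) * val f z (p w y) =
      ∑ w ∈ J, val f z (q x w) * val f z (p w y) := by
    rw [Finset.sum_subset (Finset.subset_union_left (s₁ := B y) (s₂ := J)),
      Finset.sum_subset (Finset.subset_union_right (s₁ := B y) (s₂ := J))]
    · intro w _ hw
      have : val f z (p w y) = 0 := by
        by_contra h1
        exact hw (hJ w (hp.left w y z h1))
      rw [this, mul_zero]
    · intro w _ hw
      rw [h.banded w y fun h' => hw ((h.symm w y).1 h'), map_zero, mul_zero]
  conv_lhs => rw [h.right]
  rw [map_add, map_sum, ← e]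
  simp only [map_mul]

open Classical in
/-- The entries of `1 + q` at `z`. -/
def onePlus (q : X → X → TwistAlg f) (z : RealSum H) (x y : X) : Cl H :=
  (if x = y then 1 else 0) + val f z (q x y)

lemma norm_onePlus_le {C : ℝ} (hq : ∀ x y, ‖q x y‖ ≤ C) (z : RealSum H) (x y : X) :
    ‖onePlus q z x y‖ ≤ 1 + C := by
  have h1 : ‖(1 : Cl H)‖ ≤ 1 := by
    by_cases h : Nontrivial (Cl H)
    · simp
    · rw [not_nontrivial_iff_subsingleton] at h
      simp [Subsingleton.elim (1 : Cl H) 0]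
  refine (norm_add_le _ _).trans (add_le_add ?_ ((norm_val_le z _).trans (hq x y)))
  split_ifs
  · exact h1
  · simp

/-- The resolvent identity `q' - q = (1 + q') (p' - p) (1 + q)` for the values at two points. -/
lemma val_sub_val (h : IsQuasiInv B p q) (hp : IsLocal f r p) {z z' : RealSum H} {J : Finset X}
    (hJ : ∀ x, ‖z - pt 0 (f x)‖ < r → x ∈ J) (hJ' : ∀ x, ‖z' - pt 0 (f x)‖ < r → x ∈ J)
    {x y : X} (hx : x ∈ J) (hy : y ∈ J) :
    val f z' (q x y) - val f z (q x y) = ∑ w ∈ J, ∑ w' ∈ J,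
      onePlus q z' x w * (val f z' (p w w') - val f z (p w w')) * onePlus q z w' y := by
  classical
  let P : RealSum H → Matrix J J (Cl H) := fun z => Matrix.of fun i j => val f z (p i j)
  let Q : RealSum H → Matrix J J (Cl H) := fun z => Matrix.of fun i j => val f z (q i j)
  have h1 : Q z = P z + P z * Q z := by
    ext i j
    rw [Matrix.add_apply, Matrix.mul_apply]
    refine (h.val_left hp hJ i j).trans ?_
    rw [← Finset.sum_coe_sort J]
    rfl
  have h2 : Q z' = P z' + Q z' * P z' := by
    ext i j
    rw [Matrix.add_apply, Matrix.mul_apply]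
    refine (h.val_right hp hJ' i j).trans ?_
    rw [← Finset.sum_coe_sort J]
    rfl
  have h3 : Q z' - Q z = (1 + Q z') * (P z' - P z) * (1 + Q z) := by
    have e1 : (1 + Q z') * P z' = Q z' := by rw [add_mul, one_mul, ← h2]
    have e2 : P z * (1 + Q z) = Q z := by rw [mul_add, mul_one, ← h1]
    calc Q z' - Q z = Q z' * (1 + Q z) - (1 + Q z') * Q z := by noncomm_ring
      _ = ((1 + Q z') * P z') * (1 + Q z) - (1 + Q z') * (P z * (1 + Q z)) := by rw [e1, e2]
      _ = _ := by noncomm_ring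
  have hone : ∀ z, ∀ i j : J, (1 + Q z) i j = onePlus q z i j := fun z i j => by
    rw [Matrix.add_apply, Matrix.one_apply, onePlus]
    simp only [Subtype.ext_iff]
    rfl
  have h4 := congrFun (congrFun h3 ⟨x, hx⟩) ⟨y, hy⟩
  rw [mul_assoc, Matrix.mul_apply] at h4
  refine h4.trans ?_
  rw [← Finset.sum_coe_sort J]
  refine Finset.sum_congr rfl fun i _ => ?_
  rw [Matrix.mul_apply, Finset.mul_sum, ← Finset.sum_coe_sort J]
  refine Finset.sum_congr rfl fun j _ => ?_
  rw [hone, hone, mul_assoc]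
  rfl

/-- A resolvent that is a matrix with a bounded number of relevant rows and columns at each point is
Lipschitz if the matrix itself is. -/
lemma lip (hX : BoundedGeometry X) (hf : IsCoarseEmbedding f) (h : IsQuasiInv B p q)
    (hp : IsLocal f r p) {L C : ℝ} (hL : 0 ≤ L) (hC : 0 ≤ C) (hq : ∀ x y, ‖q x y‖ ≤ C)
    (hs : ∀ x y, IsSmooth L (toFnHom f (p x y))) :
    ∃ L', 0 ≤ L' ∧ ∀ x y z z', ‖val f z (q x y) - val f z' (q x y)‖ ≤ L' * ‖z - z'‖ := by
  classical
  obtain ⟨F, K, hF, hK⟩ := exists_near hX hf r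
  refine ⟨(2 * K + 2) * ((2 * K + 2) * ((1 + C) * L * (1 + C))), by positivity,
    fun x y z' z => ?_⟩
  set J := F z ∪ F z' ∪ {x, y} with hJ
  have hcard : (J.card : ℝ) ≤ 2 * K + 2 := by
    have h1 : J.card ≤ (F z).card + (F z').card + 2 :=
      (Finset.card_union_le _ _).trans (add_le_add (Finset.card_union_le _ _) Finset.card_le_two)
    have h2 := hK z
    have h3 := hK z'
    have : J.card ≤ 2 * K + 2 := by omega
    exact_mod_cast this
  rw [h.val_sub_val hp (J := J) (fun w hw => by simp [hJ, (hF z w).2 hw])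
    (fun w hw => by simp [hJ, (hF z' w).2 hw]) (by simp [hJ]) (by simp [hJ])]
  have hterm : ∀ w w', ‖onePlus q z' x w * (val f z' (p w w') - val f z (p w w')) *
      onePlus q z w' y‖ ≤ (1 + C) * L * (1 + C) * ‖z' - z‖ := by
    intro w w'
    have h1 : ‖val f z' (p w w') - val f z (p w w')‖ ≤ L * ‖z' - z‖ := (hs w w').lip z' z
    have h2 := norm_onePlus_le hq z' x w
    have h3 := norm_onePlus_le hq z w' y
    calc _ ≤ ‖onePlus q z' x w‖ * ‖val f z' (p w w') - val f z (p w w')‖ * ‖onePlus q z w' y‖ :=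
          (norm_mul_le _ _).trans (mul_le_mul_of_nonneg_right (norm_mul_le _ _) (norm_nonneg _))
      _ ≤ (1 + C) * (L * ‖z' - z‖) * (1 + C) := by gcongr
      _ = _ := by ring
  have hsum : ‖∑ w ∈ J, ∑ w' ∈ J, onePlus q z' x w * (val f z' (p w w') - val f z (p w w')) *
      onePlus q z w' y‖ ≤ J.card * (J.card * ((1 + C) * L * (1 + C) * ‖z' - z‖)) := by
    rw [← nsmul_eq_mul, ← nsmul_eq_mul, ← Finset.sum_const, ← Finset.sum_const]
    exact norm_sum_le_of_le J fun w _ => norm_sum_le_of_le J fun w' _ => hterm w w'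
  refine hsum.trans ?_
  calc _ ≤ (2 * K + 2) * ((2 * K + 2) * ((1 + C) * L * (1 + C) * ‖z' - z‖)) := by gcongr
    _ = _ := by ring

/-- In the resolvent identity the difference of the values of `p` vanishes at `z`, so that the
continuity of the other factors suffices for the derivative to exist. -/
lemma lineDiff (hX : BoundedGeometry X) (hf : IsCoarseEmbedding f) (h : IsQuasiInv B p q)
    (hp : IsLocal f r p) {L' : ℝ}
    (hlip : ∀ x y z z', ‖val f z (q x y) - val f z' (q x y)‖ ≤ L' * ‖z - z'‖)
    (hd : ∀ x y z Y, LineDifferentiableAt ℝ (fun z => val f z (p x y)) z Y) (x y : X)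
    (z Y : RealSum H) : LineDifferentiableAt ℝ (fun z => val f z (q x y)) z Y := by
  classical
  obtain ⟨F, K, hF, -⟩ := exists_near hX hf (r + ‖Y‖)
  set J := F z ∪ {x, y} with hJ
  have hnear : ∀ s : ℝ, |s| < 1 → ∀ w, ‖z + s • Y - pt 0 (f w)‖ < r → w ∈ J := by
    intro s hs w hw
    refine Finset.mem_union_left _ ((hF z w).2 ?_)
    have e : z - pt 0 (f w) = (z + s • Y - pt 0 (f w)) - s • Y := by abel
    rw [e]
    refine (norm_sub_le _ _).trans_lt ?_
    rw [norm_smul, Real.norm_eq_abs]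
    nlinarith [norm_nonneg Y]
  have hcont : ∀ x y, ContinuousAt (fun s : ℝ => onePlus q (z + s • Y) x y) 0 := by
    intro x y
    refine ContinuousAt.add continuousAt_const ?_
    refine tendsto_iff_norm_sub_tendsto_zero.2 ?_
    refine squeeze_zero (fun s => norm_nonneg _) (fun s => hlip x y _ _) ?_
    have : Continuous fun s : ℝ => L' * ‖z + s • Y - (z + (0 : ℝ) • Y)‖ := by fun_prop
    simpa using this.tendsto 0
  have hfun : (fun s : ℝ => val f (z + s • Y) (q x y)) =ᶠ[𝓝 0] fun s =>
      (∑ w ∈ J, ∑ w' ∈ J, onePlus q (z + s • Y) x w *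
        (val f (z + s • Y) (p w w') - val f z (p w w')) * onePlus q z w' y) + val f z (q x y) := by
    filter_upwards [Metric.ball_mem_nhds (0 : ℝ) one_pos] with s hs
    rw [mem_ball_zero_iff, Real.norm_eq_abs] at hs
    rw [← h.val_sub_val hp (J := J) (fun w hw => hnear 0 (by simp) w (by simpa using hw))
      (hnear s hs) (by simp [hJ]) (by simp [hJ]), sub_add_cancel]
  refine DifferentiableAt.congr_of_eventuallyEq ?_ hfun
  refine DifferentiableAt.add_const _ (DifferentiableAt.fun_sum fun w _ =>
    DifferentiableAt.fun_sum fun w' _ => DifferentiableAt.mul_const ?_ _)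
  refine differentiableAt_mul_of_eq_zero (hcont x w) ?_ (by simp)
  exact DifferentiableAt.sub_const (hd w w' z Y) _

lemma tendsto_zero (h : IsQuasiInv B p q)
    (hp : ∀ x y, Tendsto (fun z => val f z (p x y)) (Bornology.cobounded _) (𝓝 0)) (x y : X) :
    Tendsto (fun z => val f z (q x y)) (Bornology.cobounded _) (𝓝 0) := by
  rw [h.left]
  simp only [map_add, map_sum, map_mul]
  rw [show (0 : Cl H) = 0 + ∑ w ∈ B x, 0 by simp]
  refine (hp x y).add (tendsto_finsetSum _ fun w _ => ?_)
  exact (hp x w).zero_mul_isBoundedUnder_le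
    (isBoundedUnder_of ⟨‖q w y‖, fun z => norm_val_le z _⟩)

end IsQuasiInv

/-- The matrix of `P ^ (n + 1)`, for `p` the matrix of `P`. -/
def powMatrix (B : X → Finset X) (p : X → X → TwistAlg f) : ℕ → X → X → TwistAlg f
  | 0 => p
  | n + 1 => fun x y => ∑ w ∈ B x, p x w * powMatrix B p n w y

open Classical in
/-- The matrix of the `(n + 1)`-st power of the restriction of `p` to the rows in `s`. -/
def locMatrix (s : Finset X) (p : X → X → TwistAlg f) : ℕ → X → X → TwistAlg f
  | 0 => fun x y => if x ∈ s then p x y else 0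
  | n + 1 => fun x y => ∑ w ∈ s, (if x ∈ s then p x w else 0) * locMatrix s p n w y

lemma locMatrix_mem {s : Finset X} {p : X → X → TwistAlg f} {V : Submodule ℝ H}
    (hV : ∀ x ∈ s, ∀ y, toFnHom f (p x y) ∈ basedAlg V) (n : ℕ) (x y : X) :
    toFnHom f (locMatrix s p n x y) ∈ basedAlg V := by
  have h0 : ∀ x y, toFnHom f (locMatrix s p 0 x y) ∈ basedAlg V := fun x y => by
    rw [locMatrix]
    beta_reduce
    split_ifs with h
    · exact hV x h y
    · rw [map_zero]; exact zero_mem _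
  induction n generalizing x y with
  | zero => exact h0 x y
  | succ n ih =>
    rw [locMatrix, map_sum]
    refine sum_mem fun w _ => ?_
    rw [map_mul]
    exact mul_mem (h0 x w) (ih w y)

/-- The powers of a local matrix only involve the rows of nearby points. -/
lemma powMatrix_eq_locMatrix {B : X → Finset X} {p : X → X → TwistAlg f} {r : ℝ}
    (hp : IsLocal f r p) (hB : ∀ x, ∀ y ∉ B x, p x y = 0) {x : X} {s : Finset X}
    (hs : ∀ w, ‖f x - f w‖ ≤ 2 * r → w ∈ s) (n : ℕ) (y : X) :
    powMatrix B p n x y = locMatrix s p n x y := by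
  classical
  have hnear : ∀ z, ‖z - pt 0 (f x)‖ < r → ∀ w, ‖z - pt 0 (f w)‖ < r → w ∈ s := by
    intro z hz w hw
    refine hs w ?_
    have h1 := norm_sub_le_norm_sub_add_norm_sub (pt 0 (f x)) z (pt 0 (f w))
    rw [pt_sub, sub_zero, norm_pt_zero, norm_sub_rev _ z] at h1
    linarith
  have h0 : ∀ z, ‖z - pt 0 (f x)‖ < r → ∀ w y,
      val f z (p w y) = val f z (if w ∈ s then p w y else 0) := by
    intro z hz w y
    split_ifs with hw
    · rfl
    · rw [map_zero]
      by_contra h1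
      exact hw (hnear z hz w (hp.left w y z h1))
  have key : ∀ z, ‖z - pt 0 (f x)‖ < r → ∀ n w y,
      val f z (powMatrix B p n w y) = val f z (locMatrix s p n w y) := by
    intro z hz n
    induction n with
    | zero => exact h0 z hz
    | succ n ih =>
      intro w y
      rw [powMatrix, locMatrix, map_sum, map_sum]
      have e : ∑ w' ∈ B w, val f z (p w w' * powMatrix B p n w' y) =
          ∑ w' ∈ s, val f z (p w w' * powMatrix B p n w' y) := by
        rw [Finset.sum_subset (Finset.subset_union_left (s₁ := B w) (s₂ := s)),
          Finset.sum_subset (Finset.subset_union_right (s₁ := B w) (s₂ := s))]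
        · intro w' _ hw
          have : val f z (p w w') = 0 := by
            by_contra h1
            exact hw (hnear z hz w' (hp.right w w' z h1))
          rw [map_mul, this, zero_mul]
        · intro w' _ hw
          rw [hB w w' hw, zero_mul, map_zero]
      rw [e]
      exact Finset.sum_congr rfl fun w' _ => by rw [map_mul, map_mul, ih, h0 z hz]
  refine twistAlg_ext fun z => ?_
  by_cases hz : ‖z - pt 0 (f x)‖ < r
  · exact key z hz n x y
  · have h1 : ∀ w, val f z (p x w) = 0 := fun w => by
      by_contra h1
      exact hz (hp.left x w z h1)
    have h2 : ∀ w, val f z (if x ∈ s then p x w else 0) = 0 := fun w => by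
      split_ifs
      · exact h1 w
      · exact map_zero _
    cases n with
    | zero => rw [powMatrix, locMatrix, h1, h2]
    | succ n =>
      rw [powMatrix, locMatrix, map_sum, map_sum, Finset.sum_eq_zero, Finset.sum_eq_zero]
      · exact fun w _ => by rw [map_mul, h2, zero_mul]
      · exact fun w _ => by rw [map_mul, h1, zero_mul]

/-- The twisted matrices are closed under the quasi-inverse of elements of norm less than one. -/
theorem exists_quasiInverse [CompleteSpace H] (hX : BoundedGeometry X) (hf : IsCoarseEmbedding f)
    {P : Adjointable X (TwistAlg f)} (hP : P ∈ twistedOps f) (hn : ‖P‖ < 1) :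
    ∃ Q ∈ twistedOps f, Q = P + P * Q ∧ Q = P + Q * P := by
  obtain ⟨p, N, R₀, h₀, hm⟩ := (mem_twistedOps_iff hX).1 hP
  obtain ⟨r, hr, hright⟩ := h₀.norm_sub_lt_right hf
  have h := h₀.mono hX (le_refl N) hr
  have hp : IsLocal f r p := ⟨h.supp, hright⟩
  have hfd := finiteDimensional_W hX f
  obtain ⟨B, K, hB, hK⟩ := hX.exists_balls r
  have hBs : ∀ x y, y ∈ B x ↔ x ∈ B y := fun x y => by rw [hB, hB, dist_comm]
  have hB0 : ∀ x, ∀ y ∉ B x, p x y = 0 := fun x y hy => by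
    rw [hB, not_le] at hy
    exact h.prop x y hy
  -- The geometric series.
  have hsum : Summable fun n : ℕ => ‖P ^ (n + 1)‖ := by
    refine Summable.of_nonneg_of_le (fun n => norm_nonneg _) (fun n => norm_pow_le' P n.succ_pos) ?_
    exact (summable_nat_add_iff 1).2 (summable_geometric_of_lt_one (norm_nonneg P) hn)
  set Q := ∑' n : ℕ, P ^ (n + 1) with hQ
  have hPQ : Q = P + P * Q := by
    rw [hQ, ← hsum.of_norm.tsum_mul_left]
    simp only [← pow_succ']
    rw [hsum.of_norm.tsum_eq_zero_add]
    simp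
  have hQP : Q = P + Q * P := by
    rw [hQ, ← hsum.of_norm.tsum_mul_right]
    simp only [← pow_succ]
    rw [hsum.of_norm.tsum_eq_zero_add]
    simp
  have hpow : ∀ n, IsMatrix (P ^ (n + 1)) (powMatrix B p n) := by
    intro n
    induction n with
    | zero => rw [zero_add, pow_one]; exact hm
    | succ n ih =>
      rw [pow_succ']
      exact hm.mul ih B hB0
  set q : X → X → TwistAlg f := fun x y => ∑' n, powMatrix B p n x y with hq
  have hmq : IsMatrix Q q := IsMatrix.tsum hpow hsum
  have hmPQ := hm.mul hmq B hB0
  have hleft : ∀ x y, q x y = p x y + ∑ w ∈ B x, p x w * q w y := fun x y => by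
    have := hm.add hmPQ
    rw [← hPQ] at this
    exact hmq.unique this x y
  have hquasi : IsQuasiInv B p q := by
    refine ⟨hBs, hB0, hleft, fun x y => ?_⟩
    have hcomm : Q * P = P * Q := (add_left_cancel (hPQ.symm.trans hQP)).symm
    have h1 := hmq.mul_apply hm (hcomm ▸ hmPQ) x y (B y) fun w hw => by
      rw [hB0 w y fun h' => hw ((hBs w y).1 h'), mul_zero]
    rw [← h1]
    exact hleft x y
  have hqle : ∀ x y, ‖q x y‖ ≤ ‖Q‖ := hmq.norm_entry_le
  have hql := hquasi.isLocal hp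
  obtain ⟨ρ, hρ0, hρ⟩ := hf.exists_dist_le (2 * r)
  obtain ⟨L', hL', hlip⟩ := hquasi.lip hX hf hp h.nonneg (norm_nonneg Q) hqle h.smooth
  have h0 := h.nonneg
  have hQ0 := norm_nonneg Q
  refine ⟨Q, (mem_twistedOps_iff hX).2 ⟨q, N + ⌈ρ⌉₊, L' + ‖Q‖ + ρ + r, ⟨by positivity,
    fun x y => ?_, fun x y => ?_, fun x y => ?_, fun x y hxy => ?_, fun x y z hz => ?_⟩, hmq⟩,
    hPQ, hQP⟩
  · obtain ⟨D, -, hD, -⟩ := hX.exists_balls ρ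
    have hmem : ∀ n, toFnHom f (powMatrix B p n x y) ∈ basedAlg (W f (N + ⌈ρ⌉₊) x) := fun n => by
      rw [powMatrix_eq_locMatrix hp hB0 (s := D x) fun w hw => (hD x w).2 (hρ x w hw)]
      refine locMatrix_mem (fun w hw y => basedAlg_mono (W_le (sq_add_le ?_)) (h.based w y)) n x y
      exact ((hD x w).1 hw).trans (Nat.le_ceil ρ)
    have hs : Summable fun n => powMatrix B p n x y :=
      hsum.of_norm_bounded fun n => (hpow n).norm_entry_le x y
    have hs' := hs.hasSum.map (toFnHom f) continuous_toFnHom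
    exact (isClosed_basedAlg _).mem_of_tendsto hs'
      (Eventually.of_forall fun s => sum_mem fun n _ => hmem n)
  · refine IsSmooth.mono (L := L') ⟨hlip x y, ?_, ?_⟩ (by linarith)
    · exact hquasi.lineDiff hX hf hp hlip (fun x y => (h.smooth x y).lineDiff) x y
    · exact hquasi.tendsto_zero (fun x y => (h.smooth x y).tendsto_zero) x y
  · exact (hqle x y).trans (by linarith)
  · by_contra hne
    have := hql.dist_le hρ hne
    linarith
  · have := hql.left x y z hz
    linarith

end QuasiInverse

/-! ### Representations and the universal norm -/

section Contractive

/-- A `⋆`-representation of a `⋆`-subalgebra of a C⋆-algebra is contractive as soon as the elements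
of norm less than one have a quasi-inverse in the subalgebra: if `π T` were longer than `T`, then
`1 - ‖π T‖⁻² π (T⋆ T)` would be invertible, although `‖π T‖²` is in the spectrum of `π (T⋆ T)`. -/
theorem norm_map_le_of_quasiInverse {A B : Type*} [NonUnitalNormedRing A] [StarRing A]
    [CStarRing A] [NormedSpace ℂ A] [IsScalarTower ℂ A A] [SMulCommClass ℂ A A] [StarModule ℂ A]
    [CStarAlgebra B] (S : NonUnitalStarSubalgebra ℂ A)
    (hS : ∀ P ∈ S, ‖P‖ < 1 → ∃ Q ∈ S, Q = P + P * Q ∧ Q = P + Q * P)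
    (π : S →⋆ₙₐ[ℂ] B) (T : S) : ‖π T‖ ≤ ‖(T : A)‖ := by
  let _ := CStarAlgebra.spectralOrder B
  have _ := CStarAlgebra.spectralOrderedRing B
  by_contra! hlt
  have hpos : 0 < ‖π T‖ := (norm_nonneg _).trans_lt hlt
  have : Nontrivial B := ⟨π T, 0, norm_pos_iff.1 hpos⟩
  set c : ℂ := (((‖π T‖ ^ 2)⁻¹ : ℝ) : ℂ) with hc
  have hcn : ‖c‖ = (‖π T‖ ^ 2)⁻¹ := by
    rw [hc, Complex.norm_real, Real.norm_of_nonneg (by positivity)]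
  set P : S := c • (star T * T) with hP
  have hPn : ‖(P : A)‖ < 1 := by
    change ‖c • (star (T : A) * (T : A))‖ < 1
    rw [norm_smul, hcn, CStarRing.norm_star_mul_self, inv_mul_lt_iff₀ (by positivity), mul_one,
      ← pow_two]
    exact pow_lt_pow_left₀ hlt (norm_nonneg _) two_ne_zero
  obtain ⟨Q₀, hQ₀, h1, h2⟩ := hS P P.2 hPn
  set Q : S := ⟨Q₀, hQ₀⟩
  have h1' : Q = P + P * Q := Subtype.ext h1
  have h2' : Q = P + Q * P := Subtype.ext h2
  have e1 : π Q = π P + π P * π Q := by rw [← map_mul, ← map_add, ← h1']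
  have e2 : π Q = π P + π Q * π P := by rw [← map_mul, ← map_add, ← h2']
  have hunit : IsUnit (1 - π P) := by
    refine ⟨⟨1 - π P, 1 + π Q, ?_, ?_⟩, rfl⟩
    · rw [sub_mul, one_mul, mul_add, mul_one, ← e1, add_sub_cancel_right]
    · rw [mul_sub, mul_one, add_mul, one_mul, ← e2, add_sub_cancel_right]
  have hPb : π P = (‖π T‖ ^ 2)⁻¹ • (star (π T) * π T) := by
    rw [hP, map_smul, map_mul, map_star, hc, Complex.coe_smul]
  have hP0 : 0 ≤ π P := by
    rw [hPb]
    exact smul_nonneg (by positivity) (star_mul_self_nonneg _)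
  have hP1 : ‖π P‖ = 1 := by
    rw [hPb, norm_smul, Real.norm_of_nonneg (by positivity), CStarRing.norm_star_mul_self,
      ← pow_two, inv_mul_cancel₀ (by positivity)]
  have hmem := CStarAlgebra.norm_mem_spectrum_of_nonneg hP0
  rw [hP1, spectrum.mem_iff, map_one] at hmem
  exact hmem hunit

end Contractive

section Extension

/-- Two `⋆`-homomorphisms from a `⋆`-algebra to the dense subalgebras of two C⋆-algebras that give
the same norm induce an isometric `⋆`-isomorphism. -/
lemma exists_starIso {A M R : Type*} [NonUnitalRing A] [StarRing A] [Module ℂ A]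
    [NonUnitalCStarAlgebra M] [NonUnitalCStarAlgebra R]
    (i : A →⋆ₙₐ[ℂ] M) (j : A →⋆ₙₐ[ℂ] R) (hi : DenseRange i) (hj : DenseRange j)
    (hn : ∀ a, ‖j a‖ = ‖i a‖) :
    ∃ φ : M →⋆ₙₐ[ℂ] R, (∀ a, φ (i a) = j a) ∧ Function.Bijective φ ∧ Isometry φ := by
  let il : A →ₗ[ℂ] M := (i : A →ₗ[ℂ] M)
  let jl : A →ₗ[ℂ] R := (j : A →ₗ[ℂ] R)
  let e : M ≃ₗᵢ[ℂ] R := (LinearEquiv.refl ℂ A).extendOfIsometry il jl hi hj hn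
  have he : ∀ a, e (i a) = j a := fun a =>
    LinearEquiv.extendOfIsometry_eq (LinearEquiv.refl ℂ A) il jl hi hj hn a
  have hmul : ∀ x y, e (x * y) = e x * e y := fun x y => by
    refine hi.induction_on₂ (p := fun x y => e (x * y) = e x * e y) ?_ (fun a b => ?_) x y
    · exact isClosed_eq (by fun_prop) (by fun_prop)
    · rw [← map_mul, he, he, he, map_mul]
  have hstar : ∀ x, e (star x) = star (e x) := fun x => by
    refine hi.induction_on (p := fun x => e (star x) = star (e x)) x ?_ (fun a => ?_)
    · exact isClosed_eq (by fun_prop) (by fun_prop)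
    · rw [← map_star, he, he, map_star]
  refine ⟨⟨⟨⟨⟨e, map_smul e⟩, map_zero e, map_add e⟩, hmul⟩, hstar⟩, he, e.bijective, e.isometry⟩

end Extension

section Universal

variable {X : Type u} [MetricSpace X]
variable {H : Type v} [NormedAddCommGroup H] [InnerProductSpace ℝ H] {f : X → H}

/-- The algebraic twisted Roe algebra is closed under quasi-inverses, so that all its
representations are contractive for the reduced norm. -/
theorem norm_rep_le [CompleteSpace H] (hX : BoundedGeometry X) (hf : IsCoarseEmbedding f)
    (π : TwistedRep f) (T : algTwistedRoe f) :
    ‖π.hom T‖ ≤ ‖(T : Adjointable X (TwistAlg f))‖ := by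
  refine norm_map_le_of_quasiInverse (algTwistedRoe f) (fun P hP hn => ?_) π.hom T
  have hm : ∀ Q, Q ∈ algTwistedRoe f ↔ Q ∈ twistedOps f := fun Q => by
    rw [← algTwistedRoe_eq hX hf, SetLike.mem_coe]
  obtain ⟨Q, hQ, h⟩ := exists_quasiInverse hX hf ((hm P).1 hP) hn
  exact ⟨Q, (hm Q).2 hQ, h⟩

variable (f) in
/-- Every element of the algebraic twisted Roe algebra attains its norm in some representation,
since the adjointable operators are a C⋆-algebra. -/
lemma exists_twistedRep (T : algTwistedRoe f) :
    ∃ π : TwistedRep f, ‖(T : Adjointable X (TwistAlg f))‖ ≤ ‖π.hom T‖ := by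
  by_cases hT : (T : Adjointable X (TwistAlg f)) = 0
  · let π : TwistedRep f := { K := EuclideanSpace ℂ PEmpty, hom := 0 }
    exact ⟨π, (norm_eq_zero.2 hT).trans_le (norm_nonneg (π.hom T))⟩
  let _ := CStarAlgebra.spectralOrder (Adjointable X (TwistAlg f))
  have _ := CStarAlgebra.spectralOrderedRing (Adjointable X (TwistAlg f))
  obtain ⟨φ, hφ⟩ := exists_rep_norm_le (T : Adjointable X (TwistAlg f)) hT
  let π : TwistedRep f :=
    { K := φ.GNS
      hom := φ.gnsNonUnitalStarAlgHom.comp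
        (NonUnitalStarSubalgebraClass.subtype (algTwistedRoe f)) }
  exact ⟨π, hφ⟩

/-- The map from the algebraic twisted Roe algebra to the product of its representations. -/
def universalHom [CompleteSpace H] (hX : BoundedGeometry X) (hf : IsCoarseEmbedding f) :
    algTwistedRoe f →⋆ₙₐ[ℂ] RepProd f where
  toFun T := ⟨fun π => π.hom T, memℓp_infty ⟨‖(T : Adjointable X (TwistAlg f))‖, by
    rintro _ ⟨π, rfl⟩
    exact norm_rep_le hX hf π T⟩⟩
  map_smul' z T := Subtype.ext <| funext fun π => map_smul π.hom z T
  map_zero' := Subtype.ext <| funext fun π => map_zero π.hom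
  map_add' T T' := Subtype.ext <| funext fun π => map_add π.hom T T'
  map_mul' T T' := Subtype.ext <| funext fun π => map_mul π.hom T T'
  map_star' T := Subtype.ext <| funext fun π => map_star π.hom T

variable [CompleteSpace H] (hX : BoundedGeometry X) (hf : IsCoarseEmbedding f)

lemma isUniversalImage_iff {T : algTwistedRoe f} {b : RepProd f} :
    IsUniversalImage f T b ↔ b = universalHom hX hf T :=
  ⟨fun h => Subtype.ext (funext h), fun h π => by rw [h]; rfl⟩

/-- The universal norm is the reduced norm. -/
lemma norm_universalHom (T : algTwistedRoe f) :
    ‖universalHom hX hf T‖ = ‖(T : Adjointable X (TwistAlg f))‖ := by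
  refine le_antisymm (lp.norm_le_of_forall_le (norm_nonneg _) fun π => norm_rep_le hX hf π T) ?_
  obtain ⟨π, hπ⟩ := exists_twistedRep f T
  exact hπ.trans (lp.norm_apply_le_norm ENNReal.top_ne_zero
    (universalHom hX hf T : lp (fun π : TwistedRep f => π.K →L[ℂ] π.K) ∞) π)

end Universal

end TwistedRoe

theorem mainTheorem3 {X : Type*} [MetricSpace X]
    (hX : TwistedRoe.UniformlyDiscrete X) (hX' : TwistedRoe.BoundedGeometry X)
    {H : Type*} [NormedAddCommGroup H] [InnerProductSpace ℝ H] [CompleteSpace H]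
    (f : X → H) (hf : TwistedRoe.IsCoarseEmbedding f)
    (hV : Dense (Submodule.span ℝ (Set.range f) : Set H)) :
    -- the functions `T` form a `⋆`-algebra of adjointable operators on `E_X`
    (∀ T, TwistedRoe.IsTwisted f T → ∃ L, TwistedRoe.ActsBy f L T) ∧
    (TwistedRoe.algTwistedRoe f : Set _) = TwistedRoe.twistedOps f ∧
    -- the universal norm is finite
    (∀ T, ∃ b, TwistedRoe.IsUniversalImage f T b) ∧
    -- the canonical quotient map exists, is unique, and is an isomorphism
    ∃ φ : TwistedRoe.maxTwistedRoe f →⋆ₙₐ[ℂ] TwistedRoe.redTwistedRoe f,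
      TwistedRoe.IsCanonicalQuotient f φ ∧
      (∀ ψ, TwistedRoe.IsCanonicalQuotient f ψ → ψ = φ) ∧
      Function.Bijective φ ∧ Isometry φ := by
  open TwistedRoe in
  refine ⟨fun T hT => ?_, algTwistedRoe_eq hX' hf,
    fun T => ⟨universalHom hX' hf T, (isUniversalImage_iff hX' hf).2 rfl⟩, ?_⟩
  · obtain ⟨N, R, h⟩ := (isTwisted_iff hX').1 hT
    obtain ⟨L, hL⟩ := h.exists_isMatrix hX'
    exact ⟨L, actsBy_iff.2 hL⟩
  have hmem : ∀ T, universalHom hX' hf T ∈ universalAlg f := fun T =>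
    ⟨T, (isUniversalImage_iff hX' hf).2 rfl⟩
  let i : algTwistedRoe f →⋆ₙₐ[ℂ] maxTwistedRoe f :=
    NonUnitalStarAlgHom.codRestrict (universalHom hX' hf) (maxTwistedRoe f)
      fun T => subset_closure (hmem T)
  let j : algTwistedRoe f →⋆ₙₐ[ℂ] redTwistedRoe f :=
    NonUnitalStarSubalgebra.inclusion (algTwistedRoe f).le_topologicalClosure
  have hi : DenseRange i := by
    rintro ⟨b, hb⟩
    rw [closure_subtype]
    refine closure_mono ?_ hb
    rintro b ⟨T, hT⟩
    exact ⟨i T, ⟨T, rfl⟩, ((isUniversalImage_iff hX' hf).1 hT).symm⟩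
  have hj : DenseRange j := by
    rintro ⟨b, hb⟩
    rw [closure_subtype]
    refine closure_mono ?_ hb
    rintro b hb'
    exact ⟨j ⟨b, hb'⟩, ⟨⟨b, hb'⟩, rfl⟩, rfl⟩
  have := (universalAlg f).isClosed_topologicalClosure
  have : IsClosed (maxTwistedRoe f : Set (RepProd f)) := this
  have := (algTwistedRoe f).isClosed_topologicalClosure
  have : IsClosed (redTwistedRoe f : Set (Adjointable X (TwistAlg f))) := this
  obtain ⟨φ, hφ, hbij, hiso⟩ := exists_starIso i j hi hj fun T => (norm_universalHom hX' hf T).symm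
  have hib : ∀ (T : algTwistedRoe f) (b : maxTwistedRoe f), IsUniversalImage f T b → b = i T :=
    fun T b hb => Subtype.ext ((isUniversalImage_iff hX' hf).1 hb)
  refine ⟨φ, ⟨hiso.continuous, fun T b hb => ?_⟩, fun ψ hψ => ?_, hbij, hiso⟩
  · rw [hib T b hb, hφ]
    rfl
  · refine DFunLike.coe_injective (hi.equalizer hψ.1 hiso.continuous (funext fun T => ?_))
    refine Subtype.ext ?_
    change (ψ (i T) : Adjointable X (TwistAlg f)) = φ (i T)
    rw [hφ, hψ.2 T (i T) ((isUniversalImage_iff hX' hf).2 rfl)]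
    rfl

end
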